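/- **Setting.** Let $(M,g,J,\omega)$ be a non-empty Kähler manifold, $\omega=g(J\cdot,\cdot)$, with a hamiltonian 2-form $\varphi$, that is, a smooth $J$-invariant 2-form with $\nabla_U\varphi=\tfrac12\,(d\,\mathrm{tr}_\omega\varphi\wedge (JU)^\flat-d^c\,\mathrm{tr}_\omega\varphi\wedge U^\flat)$ for every vector field $U$. Let $\ell\ge 2$. We say that $\varphi$ has order $\ell$ with momentum domain $\mathcal D=I_1\times\dots\times I_\ell$ if $(M,\varphi)$ is given by the hamiltonian 2-form Ansatz, as follows. There are Kähler manifolds $(B_a,\check g_a,\check\omega_a)$, numbers $\varepsilon_a\in\{-1,1\}$, $\eta_a\in\mathbb R$ ($a=1,\dots,N$), a principal $\ell$-torus bundle $P\to\prod_a B_a$ with connection form $\theta=(\theta_1,\dots,\theta_\ell)$ satisfying $d\theta_r=\sum_a(-1)^r\varepsilon_a\eta_a^{\ell-r}\check\omega_a$, smooth functions $F_j$ on $I_j$, and a diffeomorphism of $\mathcal D\times P$ onto an open dense subset $M^0\subset M$ under which $$g=\sum_a\varepsilon_a p_{nc}(\eta_a)\check g_a+\sum_{j}\frac{p_c(\xi_j)\Delta(\xi_j)}{F_j(\xi_j)}d\xi_j^2+\sum_j\frac{F_j(\xi_j)}{p_c(\xi_j)\Delta(\xi_j)}\Big(\sum_{r=1}^\ell\sigma_{r-1}(\hat\xi_j)\theta_r\Big)^2,$$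 $$\omega=\sum_a\varepsilon_a p_{nc}(\eta_a)\check\omega_a+\sum_{r=1}^\ell d\sigma_r\wedge\theta_r,\qquad \varphi=\sum_a\varepsilon_a\eta_a p_{nc}(\eta_a)\check\omega_a+\sum_{r=1}^\ell(\sigma_r\,d\sigma_1-d\sigma_{r+1})\wedge\theta_r .$$ Here $(\xi_1,\dots,\xi_\ell)\in\mathcal D$, $\sigma_r$ (resp. $\sigma_r(\hat\xi_j)$) is the $r$-th elementary symmetric function of all $\xi_i$ (resp. of the $\xi_i$ with $i\ne j$), $\sigma_{\ell+1}=0$, $p_{nc}(t)=\prod_j(t-\xi_j)$, $p_c(t)=\prod_a(t-\eta_a)^{\dim_{\mathbb C}B_a}$, $\Delta(\xi_j)=\prod_{i\ne j}(\xi_j-\xi_i)$, and it is required that $\varepsilon_ap_{nc}(\eta_a)>0$ on $\mathcal D$ and $(-1)^{\ell-j}F_jp_c>0$ on $I_j$. Let $K_1$ be the vector field with hamiltonian potential $\sigma_1$, i.e. $\omega(K_1,\cdot)=-d\sigma_1$, so that $JK_1=-\nabla^g\sigma_1$. The domain is of Type 2 if $$\mathcal D=\mathcal D_2=(-\infty,\alpha_1)\times(\alpha_1,\alpha_2)\times\dots\times(\alpha_{\ell-2},\alpha_{\ell-1})\times(\alpha_\ell,\infty),\qquad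 \alpha_1<\dots<\alpha_{\ell-1}<0<\alpha_\ell .$$ A gradient Kähler–Ricci soliton is a Kähler metric together with a real holomorphic vector field $X=\nabla^g f$, $f$ smooth, such that $\mathrm{Ric}_\omega+\tfrac12\mathcal L_X\omega=\lambda\omega$ with $\lambda\in\mathbb R$; it is shrinking if $\lambda>0$ and expanding if $\lambda<0$. **Statement.** Let $(M,g,J,\omega)$ carry a hamiltonian 2-form of order $\ell\ge 2$ whose momentum domain is of Type 2, let $a\in\mathbb R$ and $\lambda\ne0$, and suppose that $a\neq 0$ if $\lambda<0$ (so the trivial expanding case, a Kähler–Einstein metric of negative Ricci curvature with $X=0$, is excluded). Then it is not possible that $g$ is complete and that $(\omega, X)$ with $X=aJK_1$ is a gradient Kähler–Ricci soliton with constant $\lambda$. That is, there is no complete shrinking gradient Kähler–Ricci soliton of this kind for any $a\in\mathbb R$, and no complete expanding one for any $a\ne0$. -/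

import Mathlib

open scoped Manifold ContDiff Topology ENNReal
open Set Filter Bundle

universe u v w

noncomputable section

namespace KRS

/-- The model space `ℂⁿ` of a complex manifold of complex dimension `n`. -/
abbrev Cn (n : ℕ) : Type := EuclideanSpace ℂ (Fin n)

/-- A complex manifold is in particular a smooth real manifold, for the same atlas. -/
instance realManifold (n : ℕ) (M : Type u) [TopologicalSpace M] [ChartedSpace (Cn n) M]
    [IsManifold 𝓘(ℂ, Cn n) ω M] : IsManifold 𝓘(ℝ, Cn n) ∞ M := by
  refine isManifold_of_contDiffOn _ _ _ ?_
  intro e e' he he'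
  have h := (contDiffGroupoid ω 𝓘(ℂ, Cn n)).compatible he he'
  rw [contDiffGroupoid, mem_groupoid_of_pregroupoid] at h
  have h1 := h.1
  simp only [contDiffPregroupoid, modelWithCornersSelf_coe, modelWithCornersSelf_coe_symm] at h1
  exact (ContDiffOn.restrict_scalars ℝ h1).of_le (by exact_mod_cast le_top)

/-! ### Tensors on a complex manifold, in holomorphic charts -/

section Tensors

variable {n : ℕ} {M : Type u} [TopologicalSpace M] [ChartedSpace (Cn n) M]

variable (n) in
/-- The real tangent space of a complex manifold. -/
abbrev RT (x : M) : Type := TangentSpace 𝓘(ℝ, Cn n) x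

/-- The complex structure `J` on the real tangent space: multiplication by `i` (the transition
maps are holomorphic, so this does not depend on the chart). -/
def J (x : M) : RT n x →L[ℝ] RT n x :=
  (Complex.I • ContinuousLinearMap.id ℝ (Cn n) : Cn n →L[ℝ] Cn n)

variable (n M) in
/-- Real bilinear forms on the tangent spaces: metrics and 2-forms. -/
abbrev TwoTensor : Type u := ∀ x : M, RT n x →L[ℝ] RT n x →L[ℝ] ℝ

/-- The coordinate frame of a chart `c` at the point with coordinates `z`. -/
def frame (c : OpenPartialHomeomorph M (Cn n)) (z : Cn n) : Cn n →L[ℝ] RT n (c.symm z) :=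
  mfderiv 𝓘(ℝ, Cn n) 𝓘(ℝ, Cn n) c.symm z

/-- A bilinear form in the coordinates of a chart. -/
def localForm (c : OpenPartialHomeomorph M (Cn n)) (β : TwoTensor n M) (z : Cn n) :
    Cn n →L[ℝ] Cn n →L[ℝ] ℝ :=
  (ContinuousLinearMap.precomp ℝ (frame c z)).comp ((β (c.symm z)).comp (frame c z))

/-- A vector field in the coordinates of a chart. -/
def localField (c : OpenPartialHomeomorph M (Cn n)) (X : ∀ x : M, RT n x) (z : Cn n) : Cn n :=
  mfderiv 𝓘(ℝ, Cn n) 𝓘(ℝ, Cn n) c (c.symm z) (X (c.symm z))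

/-- The fundamental form `ω = g(J·, ·)`. -/
def fundamentalForm (g : TwoTensor n M) : TwoTensor n M := fun x => (g x).comp (J x)

/-- Closedness of a 2-form: the exterior derivative vanishes in every chart. -/
def IsClosedForm (β : TwoTensor n M) : Prop :=
  ∀ c ∈ atlas (Cn n) M, ∀ z ∈ c.target, ∀ u v w : Cn n,
    fderiv ℝ (localForm c β) z u v w + fderiv ℝ (localForm c β) z v w u
      + fderiv ℝ (localForm c β) z w u v = 0

/-- Smoothness of a bilinear form. -/
def IsSmoothForm (β : TwoTensor n M) : Prop :=
  ∀ c ∈ atlas (Cn n) M, ContDiffOn ℝ ∞ (localForm c β) c.target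

end Tensors

/-- A Kähler manifold: a Hausdorff complex manifold with a smooth Riemannian metric that is
`J`-invariant and whose fundamental form is closed. -/
structure KahlerManifold : Type (u + 1) where
  /-- the complex dimension -/
  dim : ℕ
  Carrier : Type u
  [top : TopologicalSpace Carrier]
  [t2 : T2Space Carrier]
  [charted : ChartedSpace (Cn dim) Carrier]
  [complexManifold : IsManifold 𝓘(ℂ, Cn dim) ω Carrier]
  metric : ContMDiffRiemannianMetric 𝓘(ℝ, Cn dim) ∞ (Cn dim)
    (fun x : Carrier => TangentSpace 𝓘(ℝ, Cn dim) x)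
  J_invariant : ∀ (x : Carrier) (v w : RT dim x),
    metric.inner x (J x v) (J x w) = metric.inner x v w
  closed : IsClosedForm (fundamentalForm (n := dim) metric.inner)

namespace KahlerManifold

attribute [instance] top t2 charted complexManifold

variable (M : KahlerManifold.{u})

/-- The real tangent space. -/
abbrev T (x : M.Carrier) : Type := RT M.dim x

/-- The Riemannian metric `g`. -/
def g : TwoTensor M.dim M.Carrier := M.metric.inner

/-- The Kähler form `ω = g(J·, ·)`. -/
def kahlerForm : TwoTensor M.dim M.Carrier := fundamentalForm M.g

/-- Completeness for the Riemannian distance (the infimum of the lengths of `C¹` paths). -/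
def IsComplete : Prop :=
  letI : RiemannianBundle (fun x : M.Carrier => TangentSpace 𝓘(ℝ, Cn M.dim) x) :=
    ⟨M.metric.toRiemannianMetric⟩
  ∀ s : ℕ → M.Carrier,
    (∀ ε : ℝ≥0∞, 0 < ε → ∃ N : ℕ, ∀ i ≥ N, ∀ j ≥ N,
      Manifold.riemannianEDist 𝓘(ℝ, Cn M.dim) (s i) (s j) < ε) →
    ∃ x : M.Carrier, Tendsto s atTop (𝓝 x)

end KahlerManifold

/-! ### The Ricci form and gradient Kähler–Ricci solitons -/

section Soliton

/-- `i∂∂̄u` for a real function `u` on an open subset of `ℂⁿ`, as a real 2-form: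
`(i∂∂̄u)(v, w) = ½ (D²u(iv, w) - D²u(v, iw))`. -/
def iddbar {n : ℕ} (u : Cn n → ℝ) (z v w : Cn n) : ℝ :=
  (1 / 2) * (fderiv ℝ (fderiv ℝ u) z (Complex.I • v) w
    - fderiv ℝ (fderiv ℝ u) z v (Complex.I • w))

/-- The Hermitian matrix of a `J`-invariant real bilinear form on `ℂⁿ`, in the standard basis. -/
def hermitianMatrix {n : ℕ} (G : Cn n →L[ℝ] Cn n →L[ℝ] ℝ) : Matrix (Fin n) (Fin n) ℂ :=
  Matrix.of fun j k =>
    (G (EuclideanSpace.single j 1) (EuclideanSpace.single k 1) : ℂ)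
      + Complex.I * (G (EuclideanSpace.single j 1) (Complex.I • EuclideanSpace.single k 1) : ℂ)

variable (M : KahlerManifold.{u})

/-- The Ricci form `-i∂∂̄ log det (h_{jk̄})` in the coordinates of a holomorphic chart. -/
def ricciForm (c : OpenPartialHomeomorph M.Carrier (Cn M.dim)) (z v w : Cn M.dim) : ℝ :=
  iddbar (fun z' => -Real.log (hermitianMatrix (localForm c M.g z')).det.re) z v w

/-- The Lie derivative `𝓛_X ω` of the Kähler form in the coordinates of a chart. -/
def lieKahlerForm (c : OpenPartialHomeomorph M.Carrier (Cn M.dim)) (X : ∀ x, M.T x)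
    (z v w : Cn M.dim) : ℝ :=
  fderiv ℝ (localForm c M.kahlerForm) z (localField c X z) v w
    + localForm c M.kahlerForm z (fderiv ℝ (localField c X) z v) w
    + localForm c M.kahlerForm z v (fderiv ℝ (localField c X) z w)

/-- `(ω, X)` is a gradient Kähler–Ricci soliton with constant `lam`: `X = ∇f` is a real
holomorphic vector field and `Ric_ω + ½ 𝓛_X ω = lam · ω`. It is shrinking if `lam > 0`, steady if
`lam = 0` and expanding if `lam < 0`. -/
structure IsGradientKahlerRicciSoliton (X : ∀ x, M.T x) (lam : ℝ) : Prop where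
  gradient : ∃ f : M.Carrier → ℝ, ContMDiff 𝓘(ℝ, Cn M.dim) 𝓘(ℝ, ℝ) ∞ f ∧
    ∀ (x : M.Carrier) (v : M.T x), M.g x (X x) v = mfderiv 𝓘(ℝ, Cn M.dim) 𝓘(ℝ, ℝ) f x v
  holomorphic : ∀ c ∈ atlas (Cn M.dim) M.Carrier, DifferentiableOn ℂ (localField c X) c.target
  equation : ∀ c ∈ atlas (Cn M.dim) M.Carrier, ∀ z ∈ c.target, ∀ v w : Cn M.dim,
    ricciForm M c z v w + (1 / 2) * lieKahlerForm M c X z v w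
      = lam * localForm c M.kahlerForm z v w

end Soliton

/-! ### Hamiltonian 2-forms -/

section Hamiltonian

variable (M : KahlerManifold.{u})

/-- `s = tr_ω φ`, half the real trace of the endomorphism `A` with `φ(v, w) = ω(A v, w)`. -/
def IsKahlerTrace (φ : TwoTensor M.dim M.Carrier) (s : M.Carrier → ℝ) : Prop :=
  ∀ x, ∃ A : M.T x →ₗ[ℝ] M.T x, (∀ v w, φ x v w = M.kahlerForm x (A v) w) ∧
    s x = (1 / 2) * LinearMap.trace ℝ (M.T x) A

/-- `γ` is the value at `z` of the Levi-Civita derivative of the coordinate field `v` in the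
direction `u`, for the metric `G` on an open subset of `ℂⁿ`. -/
def IsChristoffel {n : ℕ} (G : Cn n → Cn n →L[ℝ] Cn n →L[ℝ] ℝ) (z u v γ : Cn n) : Prop :=
  ∀ w, G z γ w = (1 / 2) * (fderiv ℝ G z u v w + fderiv ℝ G z v u w - fderiv ℝ G z w u v)

/-- A hamiltonian 2-form: a smooth `J`-invariant 2-form `φ` such that, with `s = tr_ω φ`,
`∇_U φ = ½ (ds ∧ (JU)♭ - dᶜs ∧ U♭)` for every vector `U`, where `dᶜs = -ds ∘ J`. -/
structure IsHamiltonianTwoForm (φ : TwoTensor M.dim M.Carrier) : Prop where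
  antisymm : ∀ x v w, φ x v w = -φ x w v
  J_invariant : ∀ x v w, φ x (J x v) (J x w) = φ x v w
  smooth : IsSmoothForm φ
  equation : ∃ s : M.Carrier → ℝ, ContMDiff 𝓘(ℝ, Cn M.dim) 𝓘(ℝ, ℝ) ∞ s ∧ IsKahlerTrace M φ s ∧
    ∀ c ∈ atlas (Cn M.dim) M.Carrier, ∀ z ∈ c.target, ∀ u v w γv γw : Cn M.dim,
      IsChristoffel (localForm c M.g) z u v γv → IsChristoffel (localForm c M.g) z u w γw →
      fderiv ℝ (localForm c φ) z u v w - localForm c φ z γv w - localForm c φ z v γw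
        = (1 / 2) *
          (fderiv ℝ (s ∘ c.symm) z v * localForm c M.g z (Complex.I • u) w
            - fderiv ℝ (s ∘ c.symm) z w * localForm c M.g z (Complex.I • u) v
            + fderiv ℝ (s ∘ c.symm) z (Complex.I • v) * localForm c M.g z u w
            - fderiv ℝ (s ∘ c.symm) z (Complex.I • w) * localForm c M.g z u v)

end Hamiltonian

/-! ### Principal torus bundles over products of Kähler manifolds -/

/-- A principal bundle `P` over `∏ₐ Bₐ` for the torus `ℝ^ℓ / Λ`, with a connection 1-form
`θ = (θ₁, …, θ_ℓ)`. The torus action is recorded as an action of `ℝ^ℓ` with stabilizer `Λ`. -/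
structure TorusBundle (ℓ : ℕ) {N : ℕ} (B : Fin N → KahlerManifold.{v}) :
    Type (max v (w + 1)) where
  /-- the real dimension of `P` -/
  dimP : ℕ
  P : Type w
  [top : TopologicalSpace P]
  [t2 : T2Space P]
  [charted : ChartedSpace (EuclideanSpace ℝ (Fin dimP)) P]
  [manifold : IsManifold 𝓘(ℝ, EuclideanSpace ℝ (Fin dimP)) ∞ P]
  /-- the components of the projection -/
  proj : ∀ a, P → (B a).Carrier
  proj_smooth : ∀ a, ContMDiff 𝓘(ℝ, EuclideanSpace ℝ (Fin dimP)) 𝓘(ℝ, Cn (B a).dim) ∞ (proj a)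
  proj_surjective : ∀ b : ∀ a, (B a).Carrier, ∃ p, ∀ a, proj a p = b a
  /-- the lattice of the torus -/
  Λ : Submodule ℤ (Fin ℓ → ℝ)
  Λ_discrete : DiscreteTopology Λ
  Λ_spans : Submodule.span ℝ (Λ : Set (Fin ℓ → ℝ)) = ⊤
  act : (Fin ℓ → ℝ) → P → P
  act_zero : ∀ p, act 0 p = p
  act_add : ∀ s t p, act (s + t) p = act s (act t p)
  act_smooth : ContMDiff (𝓘(ℝ, Fin ℓ → ℝ).prod 𝓘(ℝ, EuclideanSpace ℝ (Fin dimP)))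
    𝓘(ℝ, EuclideanSpace ℝ (Fin dimP)) ∞ (fun x : (Fin ℓ → ℝ) × P => act x.1 x.2)
  act_eq_self : ∀ s p, act s p = p ↔ s ∈ Λ
  fiber_eq_orbit : ∀ p p', (∀ a, proj a p = proj a p') ↔ ∃ s, p' = act s p
  θ : ∀ p : P, TangentSpace 𝓘(ℝ, EuclideanSpace ℝ (Fin dimP)) p →L[ℝ] (Fin ℓ → ℝ)
  θ_smooth : ∀ c ∈ atlas (EuclideanSpace ℝ (Fin dimP)) P,
    ContDiffOn ℝ ∞ (fun z => (θ (c.symm z)).comp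
      (mfderiv 𝓘(ℝ, EuclideanSpace ℝ (Fin dimP)) 𝓘(ℝ, EuclideanSpace ℝ (Fin dimP)) c.symm z))
      c.target
  θ_fundamental : ∀ (p : P) (t : Fin ℓ → ℝ),
    θ (act 0 p) (mfderiv 𝓘(ℝ, Fin ℓ → ℝ) 𝓘(ℝ, EuclideanSpace ℝ (Fin dimP))
      (fun s => act s p) 0 t) = t
  θ_invariant : ∀ (t : Fin ℓ → ℝ) (p : P) (v : TangentSpace 𝓘(ℝ, EuclideanSpace ℝ (Fin dimP)) p),
    θ (act t p) (mfderiv 𝓘(ℝ, EuclideanSpace ℝ (Fin dimP)) 𝓘(ℝ, EuclideanSpace ℝ (Fin dimP))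
      (act t) p v) = θ p v
  /-- `ker θ` is a complement of the vertical space and projects isomorphically to the base. -/
  splitting : ∀ p : P, Function.Bijective
    (fun v : TangentSpace 𝓘(ℝ, EuclideanSpace ℝ (Fin dimP)) p =>
      ((fun a => mfderiv 𝓘(ℝ, EuclideanSpace ℝ (Fin dimP)) 𝓘(ℝ, Cn (B a).dim) (proj a) p v, θ p v) :
        (∀ a, (B a).T (proj a p)) × (Fin ℓ → ℝ)))

namespace TorusBundle

attribute [instance] top t2 charted manifold

variable {ℓ N : ℕ} {B : Fin N → KahlerManifold.{v}} (Q : TorusBundle.{v, w} ℓ B)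

/-- The model space of `P`. -/
abbrev E : Type := EuclideanSpace ℝ (Fin Q.dimP)

/-- The connection form in the coordinates of a chart of `P`. -/
def localθ (c : OpenPartialHomeomorph Q.P Q.E) (z : Q.E) : Q.E →L[ℝ] (Fin ℓ → ℝ) :=
  (Q.θ (c.symm z)).comp (mfderiv 𝓘(ℝ, Q.E) 𝓘(ℝ, Q.E) c.symm z)

/-- The pull-back to `P` of the metric of the `a`-th factor of the base. -/
def baseMetric (a : Fin N) (p : Q.P) (v w : TangentSpace 𝓘(ℝ, Q.E) p) : ℝ :=
  (B a).g (Q.proj a p) (mfderiv 𝓘(ℝ, Q.E) 𝓘(ℝ, Cn (B a).dim) (Q.proj a) p v)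
    (mfderiv 𝓘(ℝ, Q.E) 𝓘(ℝ, Cn (B a).dim) (Q.proj a) p w)

/-- The pull-back to `P` of the Kähler form of the `a`-th factor of the base. -/
def baseForm (a : Fin N) (p : Q.P) (v w : TangentSpace 𝓘(ℝ, Q.E) p) : ℝ :=
  (B a).kahlerForm (Q.proj a p) (mfderiv 𝓘(ℝ, Q.E) 𝓘(ℝ, Cn (B a).dim) (Q.proj a) p v)
    (mfderiv 𝓘(ℝ, Q.E) 𝓘(ℝ, Cn (B a).dim) (Q.proj a) p w)

/-- `dθ_r = ∑ₐ (-1)^r εₐ ηₐ^{ℓ-r} ω̌ₐ` for `r = 1, …, ℓ`; the index `r : Fin ℓ` stands for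
`r + 1`. -/
def HasCurvature (ε η : Fin N → ℝ) : Prop :=
  ∀ c ∈ atlas Q.E Q.P, ∀ z ∈ c.target, ∀ (v w : Q.E) (r : Fin ℓ),
    fderiv ℝ (Q.localθ c) z v w r - fderiv ℝ (Q.localθ c) z w v r
      = ∑ a, (-1) ^ (r.val + 1) * ε a * η a ^ (ℓ - (r.val + 1)) *
          Q.baseForm a (c.symm z)
            (mfderiv 𝓘(ℝ, Q.E) 𝓘(ℝ, Q.E) c.symm z v) (mfderiv 𝓘(ℝ, Q.E) 𝓘(ℝ, Q.E) c.symm z w)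

end TorusBundle

/-! ### The hamiltonian 2-form Ansatz of order `ℓ` -/

section Ansatz

variable {ℓ : ℕ}

/-- The `r`-th elementary symmetric function of the variables `ξ_i`, `i ∈ s`. -/
def esym (s : Finset (Fin ℓ)) (r : ℕ) (ξ : Fin ℓ → ℝ) : ℝ :=
  ∑ t ∈ s.powersetCard r, ∏ i ∈ t, ξ i

/-- `σ_r`, the `r`-th elementary symmetric function of all `ξ_i`. -/
def σ (r : ℕ) (ξ : Fin ℓ → ℝ) : ℝ := esym Finset.univ r ξ

/-- `σ_r(ξ̂_j)`, the `r`-th elementary symmetric function of the `ξ_i` with `i ≠ j`. -/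
def σhat (j : Fin ℓ) (r : ℕ) (ξ : Fin ℓ → ℝ) : ℝ := esym (Finset.univ.erase j) r ξ

/-- `dσ_r` -/
def dσ (r : ℕ) (ξ u : Fin ℓ → ℝ) : ℝ := fderiv ℝ (σ r) ξ u

/-- `Δ(ξ_j) = ∏_{i ≠ j} (ξ_j - ξ_i)` -/
def Δ (ξ : Fin ℓ → ℝ) (j : Fin ℓ) : ℝ := ∏ i ∈ Finset.univ.erase j, (ξ j - ξ i)

/-- `p_nc(t) = ∏_j (t - ξ_j)` -/
def pnc (ξ : Fin ℓ → ℝ) (t : ℝ) : ℝ := ∏ j, (t - ξ j)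

/-- `p_c(t) = ∏ₐ (t - ηₐ)^{dim Bₐ}` -/
def pc {N : ℕ} (B : Fin N → KahlerManifold.{v}) (η : Fin N → ℝ) (t : ℝ) : ℝ :=
  ∏ a, (t - η a) ^ (B a).dim

/-- The Kähler manifold `M` with the 2-form `φ` is given by the hamiltonian 2-form Ansatz of
order `ℓ`, with `(ξ_1, …, ξ_ℓ)` ranging over `D = I_1 × ⋯ × I_ℓ`: an open dense subset `M⁰` of `M`
is identified with `D × P` so that `g`, `ω` and `φ` take their normal forms there. In particular
`ξ_1, …, ξ_ℓ` are the non-constant and the `ηₐ` the constant eigenvalues of `φ` relative to `ω`. -/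
structure HamiltonianAnsatz (M : KahlerManifold.{u}) (φ : TwoTensor M.dim M.Carrier)
    (I : Fin ℓ → Set ℝ) : Type (max u (v + 1) (w + 1)) where
  N : ℕ
  B : Fin N → KahlerManifold.{v}
  Q : TorusBundle.{v, w} ℓ B
  ε : Fin N → ℝ
  ε_sign : ∀ a, ε a = 1 ∨ ε a = -1
  η : Fin N → ℝ
  curvature : Q.HasCurvature ε η
  F : Fin ℓ → ℝ → ℝ
  F_smooth : ∀ j, ContDiffOn ℝ ∞ (F j) (I j)
  pnc_pos : ∀ ξ ∈ univ.pi I, ∀ a, 0 < ε a * pnc ξ (η a)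
  /-- here `j : Fin ℓ` stands for the index `j + 1` -/
  F_pos : ∀ j, ∀ t ∈ I j, 0 < (-1) ^ (ℓ - (j.val + 1)) * F j t * pc B η t
  /-- the identification of `D × P` with `M⁰` -/
  Φ : (Fin ℓ → ℝ) × Q.P → M.Carrier
  Φ_smooth : ContMDiffOn (𝓘(ℝ, Fin ℓ → ℝ).prod 𝓘(ℝ, Q.E)) 𝓘(ℝ, Cn M.dim) ∞ Φ
    (univ.pi I ×ˢ univ)
  Φ_injective : InjOn Φ (univ.pi I ×ˢ univ)
  Φ_derivative : ∀ ξ ∈ univ.pi I, ∀ p, Function.Bijective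
    (mfderiv (𝓘(ℝ, Fin ℓ → ℝ).prod 𝓘(ℝ, Q.E)) 𝓘(ℝ, Cn M.dim) Φ (ξ, p))
  Φ_dense : Dense (Φ '' (univ.pi I ×ˢ univ))
  metric_eq : ∀ ξ ∈ univ.pi I, ∀ p, ∀ x y : (Fin ℓ → ℝ) × Q.E,
    M.g (Φ (ξ, p))
        (mfderiv (𝓘(ℝ, Fin ℓ → ℝ).prod 𝓘(ℝ, Q.E)) 𝓘(ℝ, Cn M.dim) Φ (ξ, p) x)
        (mfderiv (𝓘(ℝ, Fin ℓ → ℝ).prod 𝓘(ℝ, Q.E)) 𝓘(ℝ, Cn M.dim) Φ (ξ, p) y)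
      = ∑ a, ε a * pnc ξ (η a) * Q.baseMetric a p x.2 y.2
        + ∑ j, pc B η (ξ j) * Δ ξ j / F j (ξ j) * (x.1 j * y.1 j)
        + ∑ j, F j (ξ j) / (pc B η (ξ j) * Δ ξ j) *
            ((∑ r : Fin ℓ, σhat j r.val ξ * Q.θ p x.2 r) * (∑ r : Fin ℓ, σhat j r.val ξ * Q.θ p y.2 r))
  kahlerForm_eq : ∀ ξ ∈ univ.pi I, ∀ p, ∀ x y : (Fin ℓ → ℝ) × Q.E,
    M.kahlerForm (Φ (ξ, p))
        (mfderiv (𝓘(ℝ, Fin ℓ → ℝ).prod 𝓘(ℝ, Q.E)) 𝓘(ℝ, Cn M.dim) Φ (ξ, p) x)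
        (mfderiv (𝓘(ℝ, Fin ℓ → ℝ).prod 𝓘(ℝ, Q.E)) 𝓘(ℝ, Cn M.dim) Φ (ξ, p) y)
      = ∑ a, ε a * pnc ξ (η a) * Q.baseForm a p x.2 y.2
        + ∑ r : Fin ℓ, (dσ (r.val + 1) ξ x.1 * Q.θ p y.2 r - dσ (r.val + 1) ξ y.1 * Q.θ p x.2 r)
  /-- `φ = ∑ₐ εₐ ηₐ p_nc(ηₐ) ω̌ₐ + ∑_r (σ_r dσ_1 - dσ_{r+1}) ∧ θ_r`, where `σ_{ℓ+1} = 0` -/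
  form_eq : ∀ ξ ∈ univ.pi I, ∀ p, ∀ x y : (Fin ℓ → ℝ) × Q.E,
    φ (Φ (ξ, p))
        (mfderiv (𝓘(ℝ, Fin ℓ → ℝ).prod 𝓘(ℝ, Q.E)) 𝓘(ℝ, Cn M.dim) Φ (ξ, p) x)
        (mfderiv (𝓘(ℝ, Fin ℓ → ℝ).prod 𝓘(ℝ, Q.E)) 𝓘(ℝ, Cn M.dim) Φ (ξ, p) y)
      = ∑ a, ε a * η a * pnc ξ (η a) * Q.baseForm a p x.2 y.2
        + ∑ r : Fin ℓ,
          ((σ (r.val + 1) ξ * dσ 1 ξ x.1 - dσ (r.val + 2) ξ x.1) * Q.θ p y.2 r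
            - (σ (r.val + 1) ξ * dσ 1 ξ y.1 - dσ (r.val + 2) ξ y.1) * Q.θ p x.2 r)

/-- `K` is the vector field `K_r` with hamiltonian potential `σ_r`, i.e. `ω(K_r, ·) = -dσ_r` on
the dense open set `M⁰` where the `ξ_j` are coordinates. -/
def HamiltonianAnsatz.IsHamiltonianField {M : KahlerManifold.{u}}
    {φ : TwoTensor M.dim M.Carrier} {I : Fin ℓ → Set ℝ}
    (A : HamiltonianAnsatz.{u, v, w} M φ I) (r : ℕ) (K : ∀ x, M.T x) : Prop :=
  ∀ ξ ∈ univ.pi I, ∀ p, ∀ x : (Fin ℓ → ℝ) × A.Q.E,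
    M.kahlerForm (A.Φ (ξ, p)) (K (A.Φ (ξ, p)))
        (mfderiv (𝓘(ℝ, Fin ℓ → ℝ).prod 𝓘(ℝ, A.Q.E)) 𝓘(ℝ, Cn M.dim) A.Φ (ξ, p) x)
      = -dσ r ξ x.1

/-- The parameters of a Type 2 domain: `α_1 < ⋯ < α_{ℓ-1} < 0 < α_ℓ`. -/
structure IsType2 (α : Fin ℓ → ℝ) : Prop where
  strictMono : StrictMono α
  neg : ∀ j : Fin ℓ, j.val + 1 < ℓ → α j < 0
  pos : ∀ j : Fin ℓ, j.val + 1 = ℓ → 0 < α j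

/-- The factors of `𝒟₂ = (-∞, α_1) × (α_1, α_2) × ⋯ × (α_{ℓ-2}, α_{ℓ-1}) × (α_ℓ, ∞)`, for
`ℓ ≥ 2`. -/
def type2Interval (α : Fin ℓ → ℝ) (j : Fin ℓ) : Set ℝ :=
  if j.val + 1 = ℓ then Ioi (α j)
  else if j.val = 0 then Iio (α j)
  else Ioo (α ⟨j.val - 1, lt_of_le_of_lt (Nat.sub_le _ _) j.isLt⟩) (α j)

end Ansatz

end KRS

end

/-! The soliton equation, contracted with the Killing field `K_1`, becomes a scalar conservation
law, and along an unbounded coordinate line of the momentum domain that law is a linear first order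
ODE whose solutions cannot be both positive and compatible with completeness.

Write `q_j = F_j / p_c` and `Y_j = q_j(ξ_j) / Δ(ξ_j)`; these are the components of `Y = ∇σ_1`, and
`|∇σ_1|² = ∑ Y_j`. A direct computation in the Ansatz (`lie_fibreMetric`, `lie_fibreForm`) shows
that `L_Y g` and `L_Y ω` are given by one and the same endomorphism `C`, diagonal in the splitting
of the tangent space. Hence `Y` is holomorphic, `JY` is Killing, and half the trace of `C` is the
Laplacian `∑ F_j'(ξ_j) / (p_c(ξ_j) Δ(ξ_j))` of `σ_1`. Differentiating the divergences of `Y` and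
`JY` gives `Ric_ω(JY, ·) = ½ d(Δσ_1)` (`iddbar_neg_logDet`). Since `aJK_1 = -aY`, the soliton
equation evaluated on `JY` says that `Δσ_1 + a|∇σ_1|² + 2λσ_1` has zero differential on `𝒟`
(`hasFDerivAt_soliton`), so it is constant because `𝒟` is convex.

Now let only `ξ_j = δt` vary, with `δ = ±1` and `t → ∞`. For `i ≠ j` the factor `Δ(ξ_i)` is affine
in `ξ_j`, so the contribution of the index `i` converges. For `h = Y_j > 0` there remains `h' = -(δa
+ r)h - 2λt + b` with `r → 0`, `r ≥ 0` eventually and `b` convergent (`exists_end_equation`). A Type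
2 domain is unbounded in both directions, so the sign `δ` is free.

If `λ > 0`, choose `δ` with `δa ≥ 0`: then `h' → -∞`, contradicting `h > 0`. If `λ < 0` and `a ≠ 0`,
choose `δ` with `δa < 0`: then `h` grows exponentially, and since the coordinate line has speed
`h^(-1/2)` it has finite length. Completeness gives a limit along the line, but the potential of
`aJK_1` is affine in `t` with slope `-aδ ≠ 0` and cannot converge (`false_of_complete`). -/

noncomputable section

namespace KRS

/-! ### Hermitian forms on `ℂⁿ`: real and complex traces, determinants. -/

section LinearAlgebra

open scoped ComplexOrder

variable {n : ℕ}

/-- The real trace of a complex linear endomorphism is twice the real part of its complex trace. -/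
theorem trace_real_of_commute (f : Cn n →L[ℝ] Cn n)
    (hf : ∀ u, f (Complex.I • u) = Complex.I • f u) :
    LinearMap.trace ℝ (Cn n) (f : Cn n →ₗ[ℝ] Cn n)
      = 2 * (∑ j, (f (EuclideanSpace.single j 1)) j).re := by
  classical
  -- In the real basis `e_j, i e_j` the two diagonal entries attached to `j` agree, because `f (i
  -- e_j) = i f (e_j)`.
  rw [LinearMap.trace_eq_matrix_trace ℝ
    (Complex.basisOneI.smulTower (EuclideanSpace.basisFun (Fin n) ℂ).toBasis)]
  simp only [Matrix.trace, Matrix.diag, LinearMap.toMatrix_apply, Fintype.sum_prod_type,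
    Module.Basis.smulTower_apply, Module.Basis.smulTower_repr, Fin.sum_univ_two,
    Complex.coe_basisOneI, Complex.coe_basisOneI_repr]
  simp [hf, two_mul]

/-- Jacobi's formula for the derivative of the determinant along a curve of matrices. -/
theorem hasDerivAt_det {m : Type*} [Fintype m] [DecidableEq m] {H : ℝ → Matrix m m ℂ}
    {H' : Matrix m m ℂ} {t : ℝ} (hH : ∀ i j, HasDerivAt (fun s => H s i j) (H' i j) t)
    (hdet : IsUnit (H t).det) :
    HasDerivAt (fun s => (H s).det) ((H t).det * ((H t)⁻¹ * H').trace) t := by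
  -- By the Leibniz expansion the derivative depends only on the value and the velocity of the
  -- curve. The curve may therefore be replaced by its tangent line, where `det (1 + sN) = 1 + s tr
  -- N + O(s²)` gives the answer.
  have key : ∀ (L : ℝ → Matrix m m ℂ) (a : ℝ), L a = H t →
      (∀ i j, HasDerivAt (fun s => L s i j) (H' i j) a) →
      HasDerivAt (fun s => (L s).det) (∑ τ : Equiv.Perm m, Equiv.Perm.sign τ •
        ∑ i, (∏ k ∈ Finset.univ.erase i, H t (τ k) k) • H' (τ i) i) a := by
    intro L a hLa hL
    simp only [Matrix.det_apply]
    refine HasDerivAt.fun_sum fun τ _ => ?_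
    have h := HasDerivAt.fun_finsetProd (u := Finset.univ)
      (fun i _ => hL (τ i) i) (x := a)
    simp only [hLa] at h
    exact h.const_smul (Equiv.Perm.sign τ)
  have h1 := key H t rfl hH
  have h2 := key (fun s => H t + (s : ℂ) • H') 0 (by simp) (by
    intro i j
    have : HasDerivAt (fun s : ℝ => H t i j + (s : ℂ) * H' i j) (0 + 1 * H' i j) 0 :=
      (hasDerivAt_const _ _).add ((Complex.ofRealCLM.hasDerivAt).mul_const _)
    simpa using this)
  have h3 : HasDerivAt (fun s : ℝ => (H t + (s : ℂ) • H').det)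
      ((H t).det * ((H t)⁻¹ * H').trace) 0 := by
    set N := (H t)⁻¹ * H' with hN
    have e : ∀ s : ℝ, (H t + (s : ℂ) • H').det = (H t).det * (1 + N.trace * s +
        Polynomial.eval (s : ℂ) (1 + (Polynomial.X : Polynomial ℂ) •
          N.map Polynomial.C).det.divX.divX * (s : ℂ) ^ 2) := by
      intro s
      rw [← Matrix.det_one_add_smul, ← Matrix.det_mul, mul_add, mul_one, Matrix.mul_smul, hN,
        ← Matrix.mul_assoc, Matrix.mul_nonsing_inv _ hdet, Matrix.one_mul]
    have hs : HasDerivAt (fun s : ℝ => (s : ℂ)) 1 0 := Complex.ofRealCLM.hasDerivAt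
    set p := (1 + (Polynomial.X : Polynomial ℂ) • N.map Polynomial.C).det.divX.divX with hp
    have hpol : HasDerivAt (fun s : ℝ => p.eval (s : ℂ)) (p.derivative.eval ((0 : ℝ) : ℂ) * 1) 0 :=
      HasDerivAt.comp (0 : ℝ) (p.hasDerivAt ((0 : ℝ) : ℂ)) hs
    have := (((hs.const_mul N.trace).const_add 1).add (hpol.mul (hs.pow 2))).const_mul (H t).det
    refine (this.congr_deriv ?_).congr_of_eventuallyEq (Eventually.of_forall fun s => ?_)
    · simp
    · simp only [Pi.add_apply, Pi.mul_apply, Pi.pow_apply]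
      exact e s
  rw [← h2.unique h3]
  exact h1

/-- A positive definite `J`-invariant real inner product on `ℂⁿ`. -/
structure IsHermitianForm (G : Cn n →L[ℝ] Cn n →L[ℝ] ℝ) : Prop where
  symm : ∀ u w, G u w = G w u
  pos : ∀ u, u ≠ 0 → 0 < G u u
  inv : ∀ u w, G (Complex.I • u) (Complex.I • w) = G u w

namespace IsHermitianForm

variable {G : Cn n →L[ℝ] Cn n →L[ℝ] ℝ}

theorem I_left (hG : IsHermitianForm G) (u w : Cn n) :
    G (Complex.I • u) w = -G u (Complex.I • w) := by
  have h := hG.inv (Complex.I • u) w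
  rw [smul_smul, Complex.I_mul_I, neg_one_smul, map_neg, neg_apply] at h
  linarith

theorem eq_of_forall (hG : IsHermitianForm G) {u u' : Cn n} (h : ∀ w, G u w = G u' w) :
    u = u' := by
  by_contra hne
  have := hG.pos (u - u') (sub_ne_zero.2 hne)
  rw [map_sub, map_sub, sub_apply, sub_apply, h, h, sub_self, sub_self, sub_self] at this
  exact this.false

end IsHermitianForm

/-- The sesquilinear form of a real bilinear form. -/
def sesq (G : Cn n →L[ℝ] Cn n →L[ℝ] ℝ) (u w : Cn n) : ℂ :=
  (G u w : ℂ) + Complex.I * (G u (Complex.I • w) : ℂ)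

theorem hermitianMatrix_apply (G : Cn n →L[ℝ] Cn n →L[ℝ] ℝ) (j k : Fin n) :
    hermitianMatrix G j k = sesq G (EuclideanSpace.single j 1) (EuclideanSpace.single k 1) := rfl

/-- Invariance gives `G(iu, w) = -G(u, iw)`. This fixes the convention: complex linear in the first
slot and, once `G` is symmetric, antilinear in the second (`sesq_conj`). -/
theorem sesq_smul_left {G : Cn n →L[ℝ] Cn n →L[ℝ] ℝ}
    (hG : ∀ u w, G (Complex.I • u) (Complex.I • w) = G u w) (z : ℂ) (u w : Cn n) :
    sesq G (z • u) w = z * sesq G u w := by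
  have hI : ∀ u w, G (Complex.I • u) w = -G u (Complex.I • w) := by
    intro u w
    have h := hG (Complex.I • u) w
    rw [smul_smul, Complex.I_mul_I, neg_one_smul, map_neg, neg_apply] at h
    linarith
  have hz : z • u = z.re • u + z.im • (Complex.I • u) := by
    conv_lhs => rw [← Complex.re_add_im z]
    rw [add_smul, mul_smul]
    rfl
  simp only [sesq, hz, map_add, map_smul, add_apply,
    smul_apply, smul_eq_mul, hI u w, hG u w]
  apply Complex.ext <;> simp [sub_eq_add_neg]

theorem sesq_add_left (G : Cn n →L[ℝ] Cn n →L[ℝ] ℝ) (u u' w : Cn n) :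
    sesq G (u + u') w = sesq G u w + sesq G u' w := by
  simp only [sesq, map_add, add_apply]
  push_cast; ring

theorem sesq_conj {G : Cn n →L[ℝ] Cn n →L[ℝ] ℝ} (hG : IsHermitianForm G) (u w : Cn n) :
    star (sesq G u w) = sesq G w u := by
  have h1 := hG.I_left w u
  rw [hG.symm _ u] at h1
  simp only [sesq, hG.symm w u]
  apply Complex.ext <;> simp [h1]

theorem sesq_eq_sum_left {G : Cn n →L[ℝ] Cn n →L[ℝ] ℝ}
    (hG : ∀ u w, G (Complex.I • u) (Complex.I • w) = G u w) (u w : Cn n) :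
    sesq G u w = ∑ l, u l * sesq G (EuclideanSpace.single l 1) w := by
  have hu : u = ∑ l, u l • EuclideanSpace.single l (1 : ℂ) := by
    have := (EuclideanSpace.basisFun (Fin n) ℂ).sum_repr u
    simpa using this.symm
  let f : Cn n →+ ℂ := AddMonoidHom.mk' (fun u => sesq G u w) (fun a b => sesq_add_left G a b w)
  have h2 : f u = ∑ l, f (u l • EuclideanSpace.single l (1 : ℂ)) := by
    conv_lhs => rw [hu]
    rw [map_sum]
  simpa [f, sesq_smul_left hG] using h2

/-- The quadratic form of the matrix is `sesq G u u = G u u`, the imaginary part vanishing because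
`G(u, iu) = 0`. The transpose appears because `sesq` is linear in its first slot, whereas Mathlib's
quadratic form conjugates the left vector. -/
theorem posDef_hermitianMatrix {G : Cn n →L[ℝ] Cn n →L[ℝ] ℝ} (hG : IsHermitianForm G) :
    (hermitianMatrix G).transpose.PosDef := by
  refine Matrix.PosDef.of_dotProduct_mulVec_pos ?_ ?_
  · ext j k
    simp only [Matrix.conjTranspose_apply, Matrix.transpose_apply, hermitianMatrix_apply,
      sesq_conj hG]
  · intro x hx
    set u : Cn n := WithLp.toLp 2 x with hu
    have hu0 : u ≠ 0 := by
      intro h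
      apply hx
      ext i
      have := congrArg (fun v : Cn n => v i) h
      simpa [hu] using this
    have : star x ⬝ᵥ (hermitianMatrix G).transpose.mulVec x = sesq G u u := by
      rw [sesq_eq_sum_left hG.inv]
      simp only [dotProduct, Matrix.mulVec, Matrix.transpose_apply, hermitianMatrix_apply,
        Pi.star_apply]
      have h2 : ∀ l, sesq G (EuclideanSpace.single l 1) u
          = ∑ j, star (x j) * sesq G (EuclideanSpace.single l 1) (EuclideanSpace.single j 1) := by
        intro l
        rw [← sesq_conj hG, sesq_eq_sum_left hG.inv, star_sum]
        refine Finset.sum_congr rfl fun j _ => ?_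
        rw [star_mul', sesq_conj hG]
      simp_rw [h2, Finset.mul_sum]
      rw [Finset.sum_comm]
      refine Finset.sum_congr rfl fun j _ => Finset.sum_congr rfl fun l _ => ?_
      simp [hu]; ring
    rw [this]
    have h0 : G u (Complex.I • u) = 0 := by
      have := hG.I_left u u
      rw [hG.symm] at this
      linarith
    simpa [sesq, h0] using hG.pos u hu0

theorem det_hermitianMatrix_im {G : Cn n →L[ℝ] Cn n →L[ℝ] ℝ} (hG : IsHermitianForm G) :
    (hermitianMatrix G).det.im = 0 := by
  have h := (posDef_hermitianMatrix hG).det_pos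
  rw [Matrix.det_transpose] at h
  exact (Complex.lt_def.1 h).2.symm

theorem det_hermitianMatrix_re_pos {G : Cn n →L[ℝ] Cn n →L[ℝ] ℝ} (hG : IsHermitianForm G) :
    0 < (hermitianMatrix G).det.re := by
  have h := (posDef_hermitianMatrix hG).det_pos
  rw [Matrix.det_transpose] at h
  exact (Complex.lt_def.1 h).1

end LinearAlgebra

/-! ### The Ricci form contracted with `iY` for a holomorphic gradient field `Y`, in a chart. -/

section ChartCalculus

set_option synthInstance.maxHeartbeats 400000

theorem minSmoothness_two_le_infty : minSmoothness ℝ 2 ≤ (∞ : ℕ∞ω) := by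
  rw [minSmoothness_of_isRCLikeNormedField]
  norm_cast

variable {n : ℕ}

theorem fderiv_form_apply {E F : Type*} [NormedAddCommGroup E] [NormedSpace ℝ E]
    [NormedAddCommGroup F] [NormedSpace ℝ F] {G : E → F →L[ℝ] F →L[ℝ] ℝ} {z : E}
    (hG : DifferentiableAt ℝ G z) (y : E) (u w : F) :
    fderiv ℝ G z y u w = fderiv ℝ (fun z => G z u w) z y := by
  have h := ((hG.hasFDerivAt.clm_apply (hasFDerivAt_const u z)).clm_apply
    (hasFDerivAt_const w z)).fderiv
  rw [h]
  simp

/-- `log det h`, the logarithm of the volume density of a field of real bilinear forms. -/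
def logDet (G : Cn n → Cn n →L[ℝ] Cn n →L[ℝ] ℝ) (z : Cn n) : ℝ :=
  Real.log (hermitianMatrix (G z)).det.re

theorem contDiffAt_logDet {G : Cn n → Cn n →L[ℝ] Cn n →L[ℝ] ℝ} {z : Cn n}
    (hG : ContDiffAt ℝ ∞ G z) (hH : IsHermitianForm (G z)) : ContDiffAt ℝ ∞ (logDet G) z := by
  have hentry : ∀ u w : Cn n, ContDiffAt ℝ ∞ (fun z => ((G z u w : ℝ) : ℂ)) z := fun u w =>
    Complex.ofRealCLM.contDiff.contDiffAt.comp z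
      ((hG.clm_apply contDiffAt_const).clm_apply contDiffAt_const)
  have hdet : ContDiffAt ℝ ∞ (fun z => (hermitianMatrix (G z)).det) z := by
    simp only [Matrix.det_apply]
    refine ContDiffAt.sum fun τ _ => ?_
    refine ContDiffAt.const_smul (Equiv.Perm.sign τ : ℤˣ) ?_
    refine contDiffAt_prod fun i _ => ?_
    exact (hentry _ _).add (contDiffAt_const.mul (hentry _ _))
  have hre : ContDiffAt ℝ ∞ (fun z => (hermitianMatrix (G z)).det.re) z :=
    Complex.reCLM.contDiff.contDiffAt.comp z hdet
  exact hre.log (det_hermitianMatrix_re_pos hH).ne.symm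

/-- The divergence of a vector field whose differential `d` is complex linear, in terms of the
trace of the Lie derivative of the metric. -/
theorem fderiv_logDet_add_trace {G : Cn n → Cn n →L[ℝ] Cn n →L[ℝ] ℝ} {z y : Cn n}
    {d C : Cn n →L[ℝ] Cn n} (hG : ContDiffAt ℝ ∞ G z) (hH : IsHermitianForm (G z))
    (hd : ∀ u, d (Complex.I • u) = Complex.I • d u) (hCI : ∀ u, C (Complex.I • u) = Complex.I • C u)
    (hL : ∀ u w, fderiv ℝ G z y u w + G z (d u) w + G z u (d w) = G z (C u) w) :
    fderiv ℝ (logDet G) z y + LinearMap.trace ℝ (Cn n) (d : Cn n →ₗ[ℝ] Cn n)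
      = (1 / 2) * LinearMap.trace ℝ (Cn n) (C : Cn n →ₗ[ℝ] Cn n) := by
  classical
  set B := fderiv ℝ G z y with hB
  have hz0 : z + (0 : ℝ) • y = z := by rw [zero_smul, add_zero]
  have hGd : DifferentiableAt ℝ G z := hG.differentiableAt (by simp)
  have hGuw : ∀ u w : Cn n, HasDerivAt (fun t : ℝ => G (z + t • y) u w) (B u w) 0 := by
    intro u w
    rw [hB, fderiv_form_apply hGd]
    exact ((hGd.clm_apply (differentiableAt_const u)).clm_apply
      (differentiableAt_const w)).hasFDerivAt.hasLineDerivAt y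
  have hent : ∀ j k, HasDerivAt (fun t : ℝ => hermitianMatrix (G (z + t • y)) j k)
      (hermitianMatrix B j k) 0 := by
    intro j k
    exact ((hGuw _ _).ofReal_comp).add (((hGuw _ _).ofReal_comp).const_mul Complex.I)
  have hunit : IsUnit (hermitianMatrix (G (z + (0 : ℝ) • y))).det := by
    rw [hz0, isUnit_iff_ne_zero]
    intro h0
    have := det_hermitianMatrix_re_pos hH
    rw [h0] at this
    simp at this
  have hdet := hasDerivAt_det hent hunit
  rw [hz0] at hdet hunit
  set H := hermitianMatrix (G z) with hHdef
  have hre : HasDerivAt (fun t : ℝ => (hermitianMatrix (G (z + t • y))).det.re)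
      (H.det * (H⁻¹ * hermitianMatrix B).trace).re 0 :=
    (Complex.reCLM.hasFDerivAt.comp_hasDerivAt (0 : ℝ) hdet)
  have hlog : HasDerivAt (fun t : ℝ => logDet G (z + t • y))
      ((H.det * (H⁻¹ * hermitianMatrix B).trace).re / H.det.re) 0 := by
    have := hre.log (by rw [hz0]; exact (det_hermitianMatrix_re_pos hH).ne')
    rw [hz0] at this
    exact this
  have hfd : HasDerivAt (fun t : ℝ => logDet G (z + t • y)) (fderiv ℝ (logDet G) z y) 0 := by
    exact ((contDiffAt_logDet hG hH).differentiableAt (by simp)).hasFDerivAt.hasLineDerivAt y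
  have hval := hfd.unique hlog
  have him := det_hermitianMatrix_im hH
  have hpos := det_hermitianMatrix_re_pos hH
  rw [← hHdef] at him hpos
  rw [Complex.mul_re, him, zero_mul, sub_zero, mul_div_cancel_left₀ _ hpos.ne'] at hval
  -- the matrix of the derivative of the metric
  let mat : (Cn n →L[ℝ] Cn n) → Matrix (Fin n) (Fin n) ℂ :=
    fun f => Matrix.of fun j l => (f (EuclideanSpace.single j 1)) l
  -- The hypothesis on the Lie derivative, solved for the derivative of the metric. The matrix rows
  -- are images of basis vectors, so an endomorphism in the first slot multiplies `H` on the left,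
  -- and one in the second slot multiplies on the right by its conjugate transpose.
  have hBmat : hermitianMatrix B = mat C * H - mat d * H - H * (mat d).conjTranspose := by
    ext j k
    have hs : ∀ u w : Cn n, sesq B u w
        = sesq (G z) (C u) w - sesq (G z) (d u) w - sesq (G z) u (d w) := by
      intro u w
      have h1 := hL u w
      have h2 := hL u (Complex.I • w)
      rw [hd] at h2
      have e1 : B u w = G z (C u) w - G z (d u) w - G z u (d w) := by linarith
      have e2 : B u (Complex.I • w) = G z (C u) (Complex.I • w) - G z (d u) (Complex.I • w)
        - G z u (Complex.I • d w) := by linarith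
      simp only [sesq, e1, e2]
      push_cast; ring
    rw [hermitianMatrix_apply, hs]
    simp only [Matrix.sub_apply, Matrix.mul_apply, Matrix.conjTranspose_apply, mat, Matrix.of_apply,
      hHdef, hermitianMatrix_apply]
    rw [sesq_eq_sum_left hH.inv (C _), sesq_eq_sum_left hH.inv (d _)]
    congr 1
    rw [← sesq_conj hH, sesq_eq_sum_left hH.inv (d _), star_sum]
    refine Finset.sum_congr rfl fun l _ => ?_
    rw [star_mul', sesq_conj hH, mul_comm]
  -- Cyclicity of the trace removes `H`. The real part of the result is `Re tr C - 2 Re tr d`, and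
  -- twice a real part is a real trace.
  have htr : (H⁻¹ * hermitianMatrix B).trace
      = (mat C).trace - (mat d).trace - star (mat d).trace := by
    rw [hBmat, mul_sub, mul_sub, Matrix.trace_sub, Matrix.trace_sub, ← Matrix.mul_assoc H⁻¹ H,
      Matrix.nonsing_inv_mul _ hunit, Matrix.one_mul, Matrix.trace_conjTranspose,
      ← Matrix.mul_assoc, Matrix.trace_mul_comm, ← Matrix.mul_assoc,
      Matrix.mul_nonsing_inv _ hunit, Matrix.one_mul, ← Matrix.mul_assoc,
      Matrix.trace_mul_comm (H⁻¹ * mat d), ← Matrix.mul_assoc,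
      Matrix.mul_nonsing_inv _ hunit, Matrix.one_mul]
  rw [hval, htr, trace_real_of_commute d hd, trace_real_of_commute C hCI]
  have e1 : ∀ f, (mat f).trace = ∑ j, (f (EuclideanSpace.single j 1)) j := fun f => rfl
  rw [e1, e1]
  simp only [Complex.sub_re, Complex.star_def, Complex.conj_re]
  ring

/-- The real trace as a continuous linear functional. -/
def traceCLM (n : ℕ) : (Cn n →L[ℝ] Cn n) →L[ℝ] ℝ :=
  LinearMap.toContinuousLinearMap
    ((LinearMap.trace ℝ (Cn n)).comp (ContinuousLinearMap.coeLM ℝ))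

theorem traceCLM_apply (f : Cn n →L[ℝ] Cn n) :
    traceCLM n f = LinearMap.trace ℝ (Cn n) (f : Cn n →ₗ[ℝ] Cn n) := rfl

theorem I_smul_I_smul (u : Cn n) : Complex.I • (Complex.I • u) = -u := by
  rw [smul_smul, Complex.I_mul_I, neg_one_smul]

/-- Symmetries of a field of hermitian forms pass to its derivative. -/
theorem fderiv_form_symm {G : Cn n → Cn n →L[ℝ] Cn n →L[ℝ] ℝ} {z : Cn n}
    (hG : DifferentiableAt ℝ G z) (hH : ∀ᶠ z' in 𝓝 z, IsHermitianForm (G z')) (y u w : Cn n) :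
    fderiv ℝ G z y u w = fderiv ℝ G z y w u := by
  rw [fderiv_form_apply hG, fderiv_form_apply hG]
  have h : (fun z => G z u w) =ᶠ[𝓝 z] fun z => G z w u := hH.mono fun z' h => h.symm u w
  rw [h.fderiv_eq]

theorem fderiv_form_inv {G : Cn n → Cn n →L[ℝ] Cn n →L[ℝ] ℝ} {z : Cn n}
    (hG : DifferentiableAt ℝ G z) (hH : ∀ᶠ z' in 𝓝 z, IsHermitianForm (G z')) (y u w : Cn n) :
    fderiv ℝ G z y (Complex.I • u) (Complex.I • w) = fderiv ℝ G z y u w := by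
  rw [fderiv_form_apply hG, fderiv_form_apply hG]
  have h : (fun z => G z (Complex.I • u) (Complex.I • w)) =ᶠ[𝓝 z] fun z => G z u w :=
    hH.mono fun z' h => h.inv u w
  rw [h.fderiv_eq]

/-- If `Y` is a holomorphic gradient field of a Kähler metric, then `iY` is a Killing field. -/
theorem lie_I_smul_gradient {G : Cn n → Cn n →L[ℝ] Cn n →L[ℝ] ℝ} {Y : Cn n → Cn n}
    {s : Cn n → ℝ} {z : Cn n} (hG : DifferentiableAt ℝ G z) (hY : DifferentiableAt ℝ Y z)
    (hs : ContDiffAt ℝ ∞ s z) (hH : ∀ᶠ z' in 𝓝 z, IsHermitianForm (G z'))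
    (hclosed : ∀ u v w, fderiv ℝ G z u (Complex.I • v) w + fderiv ℝ G z v (Complex.I • w) u
      + fderiv ℝ G z w (Complex.I • u) v = 0)
    (hgrad : ∀ᶠ z' in 𝓝 z, ∀ w, G z' (Y z') w = fderiv ℝ s z' w)
    (hhol : ∀ u, fderiv ℝ Y z (Complex.I • u) = Complex.I • fderiv ℝ Y z u) (u w : Cn n) :
    fderiv ℝ G z (Complex.I • Y z) u w + G z (Complex.I • fderiv ℝ Y z u) w
      + G z u (Complex.I • fderiv ℝ Y z w) = 0 := by
  have hHz := hH.self_of_nhds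
  -- Differentiating `G(Y, b) = ds(b)` relates the derivatives of `G` and `Y` to the symmetric
  -- second derivative of `s`.
  have hess : ∀ a b, fderiv ℝ G z a (Y z) b + G z (fderiv ℝ Y z a) b
      = fderiv ℝ (fderiv ℝ s) z a b := by
    intro a b
    have h1 := ((hG.hasFDerivAt.clm_apply hY.hasFDerivAt).clm_apply
      (hasFDerivAt_const b z)).fderiv
    have hs' : DifferentiableAt ℝ (fderiv ℝ s) z :=
      (hs.fderiv_right (m := 1) (by norm_cast)).differentiableAt (by simp)
    have h2 := (hs'.hasFDerivAt.clm_apply (hasFDerivAt_const b z)).fderiv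
    have h3 : fderiv ℝ (fun z' => G z' (Y z') b) z = fderiv ℝ (fun z' => fderiv ℝ s z' b) z :=
      Filter.EventuallyEq.fderiv_eq (hgrad.mono fun z' h => h b)
    have h4 := congrArg (· a) (h1.symm.trans (h3.trans h2))
    simp at h4
    linarith
  have hsymm : ∀ a b, fderiv ℝ (fderiv ℝ s) z a b = fderiv ℝ (fderiv ℝ s) z b a :=
    fun a b => (hs.isSymmSndFDerivAt minSmoothness_two_le_infty).eq a b
  have hd := fderiv_form_symm hG hH
  have hi := fderiv_form_inv hG hH
  -- At `(iY, -iu, w)` closedness expresses the derivative of `G` along `iY` through derivatives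
  -- along `iu` and `w` with `Y` in one slot. Those are the terms controlled by `hess`.
  have c := hclosed (Complex.I • Y z) (-(Complex.I • u)) w
  have e1 : Complex.I • (-(Complex.I • u)) = u := by rw [smul_neg, I_smul_I_smul, neg_neg]
  rw [e1, I_smul_I_smul, hi] at c
  simp only [map_neg, neg_apply] at c
  have a1 := hess (Complex.I • u) w
  have a2 := hess w (Complex.I • u)
  have a3 := hsymm w (Complex.I • u)
  rw [hhol] at a1
  have a4 := hd (Complex.I • u) w (Y z)
  have a5 := hHz.I_left u (fderiv ℝ Y z w)
  have a6 := hHz.symm (Complex.I • u) (fderiv ℝ Y z w)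
  linarith

/-- The Ricci form of a Kähler metric contracted with `iY`, where `Y` is a gradient field and `C`
is the endomorphism of the Lie derivative of the metric along `Y`. -/
theorem iddbar_neg_logDet {G : Cn n → Cn n →L[ℝ] Cn n →L[ℝ] ℝ} {Y : Cn n → Cn n}
    {s : Cn n → ℝ} {C : Cn n → Cn n →L[ℝ] Cn n} {z : Cn n}
    (hG : ∀ᶠ z' in 𝓝 z, ContDiffAt ℝ ∞ G z') (hY : ∀ᶠ z' in 𝓝 z, ContDiffAt ℝ ∞ Y z')
    (hs : ∀ᶠ z' in 𝓝 z, ContDiffAt ℝ ∞ s z') (hH : ∀ᶠ z' in 𝓝 z, IsHermitianForm (G z'))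
    (hclosed : ∀ᶠ z' in 𝓝 z, ∀ u v w, fderiv ℝ G z' u (Complex.I • v) w
      + fderiv ℝ G z' v (Complex.I • w) u + fderiv ℝ G z' w (Complex.I • u) v = 0)
    (hgrad : ∀ᶠ z' in 𝓝 z, ∀ w, G z' (Y z') w = fderiv ℝ s z' w)
    (hCI : ∀ᶠ z' in 𝓝 z, ∀ u, C z' (Complex.I • u) = Complex.I • C z' u)
    (hL : ∀ᶠ z' in 𝓝 z, ∀ u w, fderiv ℝ G z' (Y z') u w + G z' (fderiv ℝ Y z' u) w
      + G z' u (fderiv ℝ Y z' w) = G z' (C z' u) w)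
    (hLω : ∀ᶠ z' in 𝓝 z, ∀ u w, fderiv ℝ G z' (Y z') (Complex.I • u) w
      + G z' (Complex.I • fderiv ℝ Y z' u) w + G z' (Complex.I • u) (fderiv ℝ Y z' w)
      = G z' (Complex.I • C z' u) w) :
    DifferentiableAt ℝ (fun z' => (1 / 2) * LinearMap.trace ℝ (Cn n) (C z' : Cn n →ₗ[ℝ] Cn n)) z ∧
    ∀ w, iddbar (fun z' => -logDet G z') z (Complex.I • Y z) w = (1 / 2) *
      fderiv ℝ (fun z' => (1 / 2) * LinearMap.trace ℝ (Cn n) (C z' : Cn n →ₗ[ℝ] Cn n)) z w := by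
  -- `L_Y g` and `L_Y ω` have the same endomorphism, which commutes with `i`; comparing them gives
  -- `L_Y J = 0`.
  have hhol : ∀ᶠ z' in 𝓝 z, ∀ u, fderiv ℝ Y z' (Complex.I • u) = Complex.I • fderiv ℝ Y z' u := by
    filter_upwards [hH, hCI, hL, hLω] with z' h1 h2 h3 h4 u
    refine h1.eq_of_forall fun w => ?_
    have e3 := h3 (Complex.I • u) w
    have e4 := h4 u w
    rw [h2] at e3
    linarith
  have hdivY : ∀ᶠ z' in 𝓝 z, fderiv ℝ (logDet G) z' (Y z') + traceCLM n (fderiv ℝ Y z')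
      = (1 / 2) * LinearMap.trace ℝ (Cn n) (C z' : Cn n →ₗ[ℝ] Cn n) := by
    filter_upwards [hG, hH, hhol, hCI, hL] with z' h1 h2 h3 h4 h5
    exact fderiv_logDet_add_trace h1 h2 h3 h4 h5
  let iL : Cn n →L[ℝ] Cn n := Complex.I • ContinuousLinearMap.id ℝ (Cn n)
  have hiL : ∀ u, iL u = Complex.I • u := fun u => rfl
  -- The same divergence formula for the Killing field `iY`, where the endomorphism of the Lie
  -- derivative is zero.
  have hdivK : ∀ᶠ z' in 𝓝 z, fderiv ℝ (logDet G) z' (Complex.I • Y z')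
      = -traceCLM n (iL.comp (fderiv ℝ Y z')) := by
    filter_upwards [hG, hY, hs, hH.eventually_nhds, hclosed, hgrad.eventually_nhds, hhol]
      with z' h1 h2 h3 h4 h5 h6 h7
    have := fderiv_logDet_add_trace (C := 0) (d := iL.comp (fderiv ℝ Y z'))
      (y := Complex.I • Y z') h1 h4.self_of_nhds
      (fun u => by rw [ContinuousLinearMap.comp_apply, h7]; rfl)
      (fun u => by rw [zero_apply, zero_apply, smul_zero])
      (fun u w => (lie_I_smul_gradient (h1.differentiableAt (by simp))
          (h2.differentiableAt (by simp)) h3 h4 h5 h6 h7 u w).trans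
          (by rw [zero_apply, map_zero, zero_apply]))
    rw [← traceCLM_apply, ContinuousLinearMap.toLinearMap_zero, map_zero, mul_zero] at this
    exact eq_neg_of_add_eq_zero_left this
  have hv : ContDiffAt ℝ ∞ (logDet G) z := contDiffAt_logDet hG.self_of_nhds hH.self_of_nhds
  have hYz := hY.self_of_nhds
  have hv' : DifferentiableAt ℝ (fderiv ℝ (logDet G)) z :=
    (hv.fderiv_right (m := 1) (by norm_cast)).differentiableAt (by simp)
  have hY' : DifferentiableAt ℝ (fderiv ℝ Y) z :=
    (hYz.fderiv_right (m := 1) (by norm_cast)).differentiableAt (by simp)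
  have hYd : DifferentiableAt ℝ Y z := hYz.differentiableAt (by simp)
  -- derivatives of the two divergence identities
  have dA := hv'.hasFDerivAt.clm_apply hYd.hasFDerivAt
  have dB := hv'.hasFDerivAt.clm_apply (iL.hasFDerivAt.comp z hYd.hasFDerivAt)
  have dT : HasFDerivAt (fun z' => traceCLM n (fderiv ℝ Y z'))
      ((traceCLM n).comp (fderiv ℝ (fderiv ℝ Y) z)) z :=
    (traceCLM n).hasFDerivAt.comp z hY'.hasFDerivAt
  have dS : HasFDerivAt (fun z' => traceCLM n (iL.comp (fderiv ℝ Y z')))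
      ((traceCLM n).comp ((ContinuousLinearMap.compL ℝ _ _ _ iL).comp
        (fderiv ℝ (fderiv ℝ Y) z))) z :=
    ((traceCLM n).comp (ContinuousLinearMap.compL ℝ _ _ _ iL)).hasFDerivAt.comp z hY'.hasFDerivAt
  have hE := (dA.add dT).congr_of_eventuallyEq (hdivY.mono fun z' h => h.symm)
  refine ⟨hE.differentiableAt, fun w => ?_⟩
  have hKeq := (dB.congr_of_eventuallyEq (f₁ := fun z' => -traceCLM n (iL.comp (fderiv ℝ Y z')))
    (hdivK.mono fun z' h => h.symm)).unique dS.neg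
  -- the second derivative of `Y` is complex bilinear
  have hsymY : ∀ a b, fderiv ℝ (fderiv ℝ Y) z a b = fderiv ℝ (fderiv ℝ Y) z b a :=
    fun a b => (hYz.isSymmSndFDerivAt minSmoothness_two_le_infty).eq a b
  have hcl : ∀ a b, fderiv ℝ (fderiv ℝ Y) z a (Complex.I • b)
      = Complex.I • fderiv ℝ (fderiv ℝ Y) z a b := by
    intro a b
    have h1 := hY'.hasFDerivAt.clm_apply (hasFDerivAt_const (Complex.I • b) z)
    have h2 := iL.hasFDerivAt.comp z (hY'.hasFDerivAt.clm_apply (hasFDerivAt_const b z))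
    have h3 := (h2.congr_of_eventuallyEq (f₁ := fun z' => fderiv ℝ Y z' (Complex.I • b))
      (hhol.mono fun z' h => by simp [h b, hiL])).unique h1
    have h4 := congrArg (· a) h3
    simpa [hiL] using h4.symm
  have hcl2 : fderiv ℝ (fderiv ℝ Y) z (Complex.I • w) = iL.comp (fderiv ℝ (fderiv ℝ Y) z w) := by
    ext1 b
    rw [hsymY, hcl, hsymY]
    rfl
  -- The divergence identity for `Y` is differentiated along `w`, the one for `iY` along `iw`. In
  -- the sum the terms containing `DY` and `D²Y` cancel because `i² = -1`, leaving `D²v(Y, w) +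
  -- D²v(iY, iw)` with `v = logDet G`, which is twice the Ricci term.
  have hKw := congrArg (· (Complex.I • w)) hKeq
  have hholz := hhol.self_of_nhds
  have hsymv : ∀ a b, fderiv ℝ (fderiv ℝ (logDet G)) z a b = fderiv ℝ (fderiv ℝ (logDet G)) z b a :=
    fun a b => (hv.isSymmSndFDerivAt minSmoothness_two_le_infty).eq a b
  have hneg : fderiv ℝ (fderiv ℝ fun z' => -logDet G z') z
      = -fderiv ℝ (fderiv ℝ (logDet G)) z := by
    rw [show (fderiv ℝ fun z' => -logDet G z') = fun z' => -fderiv ℝ (logDet G) z' from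
      funext fun z' => fderiv_fun_neg]
    exact fderiv_fun_neg
  have hii : iL.comp (iL.comp (fderiv ℝ (fderiv ℝ Y) z w)) = -fderiv ℝ (fderiv ℝ Y) z w := by
    ext1 b
    simp [hiL, smul_smul]
  rw [hE.fderiv, iddbar, hneg]
  simp [hiL, hcl2, hii, hholz, smul_smul] at hKw ⊢
  have b1 := hsymv (Y z) w
  have b2 := hsymv (Complex.I • Y z) (Complex.I • w)
  linarith

end ChartCalculus

/-! ### Derivatives of elementary symmetric functions. -/

section Symmetric

variable {ℓ : ℕ}

theorem esym_zero (s : Finset (Fin ℓ)) (ξ : Fin ℓ → ℝ) : esym s 0 ξ = 1 := by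
  simp [esym]

theorem esym_empty_succ (r : ℕ) (ξ : Fin ℓ → ℝ) : esym ∅ (r + 1) ξ = 0 := by
  rw [esym, Finset.powersetCard_eq_empty.2 (by simp), Finset.sum_empty]

/-- Subsets are separated according to whether they contain `k`. This recursion drives the
derivative formula and the comparison of `σ_r(ξ̂_j)` with `σ_r(ξ̂_k)`. -/
theorem esym_insert_succ {s : Finset (Fin ℓ)} {k : Fin ℓ} (hk : k ∉ s) (r : ℕ)
    (ξ : Fin ℓ → ℝ) : esym (insert k s) (r + 1) ξ = esym s (r + 1) ξ + ξ k * esym s r ξ := by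
  have hmem : ∀ t ∈ s.powersetCard r, k ∉ t := fun t ht h =>
    hk ((Finset.mem_powersetCard.1 ht).1 h)
  rw [esym, Finset.powersetCard_succ_insert hk, Finset.sum_union, Finset.sum_image]
  · congr 1
    rw [esym, Finset.mul_sum]
    exact Finset.sum_congr rfl fun t ht => Finset.prod_insert (hmem t ht)
  · intro t ht t' ht' h
    rw [← Finset.erase_insert (hmem t ht), h, Finset.erase_insert (hmem t' ht')]
  · rw [Finset.disjoint_left]
    intro t ht ht'
    obtain ⟨t', -, rfl⟩ := Finset.mem_image.1 ht'
    exact hk ((Finset.mem_powersetCard.1 ht).1 (Finset.mem_insert_self _ _))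

theorem hasFDerivAt_coord (j : Fin ℓ) (ξ : Fin ℓ → ℝ) :
    HasFDerivAt (fun ξ : Fin ℓ → ℝ => ξ j)
      (ContinuousLinearMap.proj (R := ℝ) (φ := fun _ : Fin ℓ => ℝ) j) ξ :=
  (ContinuousLinearMap.proj (R := ℝ) (φ := fun _ : Fin ℓ => ℝ) j).hasFDerivAt

theorem hasFDerivAt_esym (s : Finset (Fin ℓ)) (r : ℕ) (ξ : Fin ℓ → ℝ) :
    HasFDerivAt (esym s (r + 1)) (∑ k ∈ s, esym (s.erase k) r ξ •
      ContinuousLinearMap.proj (R := ℝ) (φ := fun _ : Fin ℓ => ℝ) k) ξ := by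
  induction s using Finset.induction_on generalizing r with
  | empty =>
    simp only [Finset.sum_empty]
    rw [show esym (∅ : Finset (Fin ℓ)) (r + 1) = fun _ => 0 from funext (esym_empty_succ r)]
    exact hasFDerivAt_const _ _
  | insert k s hk ih =>
    rw [show esym (insert k s) (r + 1) = fun ξ => esym s (r + 1) ξ + ξ k * esym s r ξ from
      funext (esym_insert_succ hk r)]
    have hne : ∀ i ∈ s, (insert k s).erase i = insert k (s.erase i) := fun i hi =>
      Finset.erase_insert_of_ne (fun h => hk (h ▸ hi))
    have hk' : ∀ i, k ∉ s.erase i := fun i h => hk (Finset.mem_of_mem_erase h)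
    rw [Finset.sum_insert hk, Finset.erase_insert hk]
    cases r with
    | zero =>
      simp only [esym_zero, mul_one, one_smul]
      have h := (ih 0).add (hasFDerivAt_coord k ξ)
      simp only [esym_zero, one_smul] at h
      exact h.congr_fderiv (add_comm _ _)
    | succ r =>
      have h := (ih (r + 1)).add ((hasFDerivAt_coord k ξ).mul (ih r))
      refine h.congr_fderiv ?_
      have : ∑ i ∈ s, esym ((insert k s).erase i) (r + 1) ξ •
            ContinuousLinearMap.proj (R := ℝ) (φ := fun _ : Fin ℓ => ℝ) i
          = ∑ i ∈ s, (esym (s.erase i) (r + 1) ξ • ContinuousLinearMap.proj (R := ℝ)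
              (φ := fun _ : Fin ℓ => ℝ) i + ξ k • esym (s.erase i) r ξ •
              ContinuousLinearMap.proj (R := ℝ) (φ := fun _ : Fin ℓ => ℝ) i) := by
        refine Finset.sum_congr rfl fun i hi => ?_
        rw [hne i hi, esym_insert_succ (hk' i), add_smul, mul_smul]
      rw [this, Finset.sum_add_distrib, ← Finset.smul_sum]
      abel

theorem dσ_succ (r : ℕ) (ξ x : Fin ℓ → ℝ) : dσ (r + 1) ξ x = ∑ j, σhat j r ξ * x j := by
  rw [dσ, show (σ (r + 1) : (Fin ℓ → ℝ) → ℝ) = esym Finset.univ (r + 1) from rfl,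
    (hasFDerivAt_esym Finset.univ r ξ).fderiv]
  simp [σhat]

theorem dσ_one (ξ x : Fin ℓ → ℝ) : dσ 1 ξ x = ∑ j, x j := by
  rw [dσ_succ]
  simp [σhat, esym_zero]

/-- The derivative of `σ_r(ξ̂_j)` in the direction `y`. -/
theorem hasDerivAt_σhat {ξ : Fin ℓ → ℝ} (hξ : Function.Injective ξ) (y : Fin ℓ → ℝ)
    (j : Fin ℓ) (r : ℕ) : HasDerivAt (fun t : ℝ => σhat j r (ξ + t • y))
      (∑ k, y k * (σhat j r ξ - σhat k r ξ) * (ξ k - ξ j)⁻¹) 0 := by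
  cases r with
  | zero =>
    simp only [σhat, esym_zero, sub_self, mul_zero, zero_mul, Finset.sum_const_zero]
    exact hasDerivAt_const _ _
  | succ r =>
    have h := (hasFDerivAt_esym (Finset.univ.erase j) r ξ).hasLineDerivAt y
    refine HasDerivAt.congr_deriv h ?_
    -- The term `k = j` carries a zero difference, so the value `0⁻¹ = 0` does no harm.
    rw [← Finset.add_sum_erase Finset.univ _ (Finset.mem_univ j)]
    simp only [sub_self, mul_zero, zero_mul, zero_add, sum_apply,
      smul_apply, ContinuousLinearMap.proj_apply, smul_eq_mul]
    refine Finset.sum_congr rfl fun k hk => ?_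
    have hkj : k ≠ j := Finset.ne_of_mem_erase hk
    set s := (Finset.univ.erase j).erase k with hs
    have hks : k ∉ s := Finset.notMem_erase _ _
    have hjs : j ∉ s := fun h => Finset.notMem_erase j _ (Finset.mem_of_mem_erase h)
    have e1 : Finset.univ.erase j = insert k s := by
      rw [hs, Finset.insert_erase]; simp [hkj]
    have e2 : Finset.univ.erase k = insert j s := by
      rw [hs, Finset.erase_right_comm, Finset.insert_erase]; simp [hkj.symm]
    have hne : ξ k - ξ j ≠ 0 := sub_ne_zero.2 fun h => hkj (hξ h)
    -- Over the set `s` omitting both indices, `σ_{r+1}(ξ̂_j) - σ_{r+1}(ξ̂_k) = (ξ_k - ξ_j) · esym s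
    -- r`, so the partial derivative is a divided difference.
    rw [σhat, σhat, e1, e2, esym_insert_succ hks, esym_insert_succ hjs]
    field_simp
    ring

end Symmetric

/-! ### Fibre metric and fibre Kähler form: their Lie derivatives along `∇σ_1`. -/

section Orthotoric

variable {ℓ : ℕ}

/-- The components `Y_j = q_j(ξ_j) / Δ(ξ_j)` of the gradient of `σ_1`, where `q_j = F_j / p_c`. -/
def gradComp (q : Fin ℓ → ℝ → ℝ) (ξ : Fin ℓ → ℝ) (j : Fin ℓ) : ℝ := q j (ξ j) / Δ ξ j

/-- The partial derivative `∂Y_j/∂ξ_j`, where `q'` is the value of `q_j'` at `ξ_j`. -/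
def gradCompDiag (q : Fin ℓ → ℝ → ℝ) (q' : Fin ℓ → ℝ) (ξ : Fin ℓ → ℝ) (j : Fin ℓ) : ℝ :=
  q' j / Δ ξ j - gradComp q ξ j * ∑ i, (ξ j - ξ i)⁻¹

/-- The eigenvalues of the Hessian of `σ_1` on the span of the `∂/∂ξ_j`. -/
def hessEigen (q : Fin ℓ → ℝ → ℝ) (q' : Fin ℓ → ℝ) (ξ : Fin ℓ → ℝ) (j : Fin ℓ) : ℝ :=
  gradCompDiag q q' ξ j + ∑ k, gradComp q ξ k * (ξ k - ξ j)⁻¹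

theorem Δ_ne_zero {ξ : Fin ℓ → ℝ} (hξ : Function.Injective ξ) (j : Fin ℓ) : Δ ξ j ≠ 0 :=
  Finset.prod_ne_zero_iff.2 fun _ hi =>
    sub_ne_zero.2 fun h => Finset.ne_of_mem_erase hi (hξ h).symm

/-- Logarithmic differentiation of a product. The sum may run over all `i`, since for `i = j` the
two projections cancel. -/
theorem hasFDerivAt_Δ {ξ : Fin ℓ → ℝ} (hξ : Function.Injective ξ) (j : Fin ℓ) :
    HasFDerivAt (fun ξ : Fin ℓ → ℝ => Δ ξ j) (Δ ξ j • ∑ i, (ξ j - ξ i)⁻¹ •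
      (ContinuousLinearMap.proj (R := ℝ) (φ := fun _ : Fin ℓ => ℝ) j -
        ContinuousLinearMap.proj (R := ℝ) (φ := fun _ : Fin ℓ => ℝ) i)) ξ := by
  have h := HasFDerivAt.finsetProd (u := Finset.univ.erase j) (x := ξ)
    (fun i _ => (hasFDerivAt_coord j ξ).fun_sub (hasFDerivAt_coord i ξ))
  refine h.congr_fderiv ?_
  rw [← Finset.add_sum_erase Finset.univ _ (Finset.mem_univ j), sub_self, sub_self, smul_zero,
    zero_add, Finset.smul_sum]
  refine Finset.sum_congr rfl fun i hi => ?_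
  have hne : ξ j - ξ i ≠ 0 := sub_ne_zero.2 fun h => Finset.ne_of_mem_erase hi (hξ h).symm
  rw [smul_smul, Δ, ← Finset.mul_prod_erase _ _ hi]
  congr 1
  field_simp

theorem hasFDerivAt_gradComp {q : Fin ℓ → ℝ → ℝ} {q' ξ : Fin ℓ → ℝ}
    (hξ : Function.Injective ξ) {j : Fin ℓ} (hq : HasDerivAt (q j) (q' j) (ξ j)) :
    HasFDerivAt (fun ξ => gradComp q ξ j) (gradCompDiag q q' ξ j •
      ContinuousLinearMap.proj (R := ℝ) (φ := fun _ : Fin ℓ => ℝ) j +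
      gradComp q ξ j • ∑ i, (ξ j - ξ i)⁻¹ •
        ContinuousLinearMap.proj (R := ℝ) (φ := fun _ : Fin ℓ => ℝ) i) ξ := by
  have h1 : HasFDerivAt (fun ξ : Fin ℓ → ℝ => q j (ξ j))
      (q' j • ContinuousLinearMap.proj (R := ℝ) (φ := fun _ : Fin ℓ => ℝ) j) ξ :=
    hq.comp_hasFDerivAt ξ (hasFDerivAt_coord j ξ)
  have h := h1.mul ((hasDerivAt_inv (Δ_ne_zero hξ j)).comp_hasFDerivAt ξ (hasFDerivAt_Δ hξ j))
  refine (h.congr_fderiv ?_).congr_of_eventuallyEq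
    (Eventually.of_forall fun ξ => div_eq_mul_inv _ _)
  have hΔ := Δ_ne_zero hξ j
  ext1 x
  simp only [Function.comp_apply, gradCompDiag, gradComp, smul_apply, sub_apply, add_apply,
    sum_apply, ContinuousLinearMap.proj_apply, smul_eq_mul, mul_sub,
    Finset.sum_sub_distrib, ← Finset.sum_mul]
  field_simp
  ring

/-- Used with `c i j = (ξ_i - ξ_j)⁻¹`: this is the mechanism by which all off-diagonal terms of the
Lie derivative of the metric disappear. -/
theorem sum_antisymm_eq_zero {c f : Fin ℓ → Fin ℓ → ℝ} (hc : ∀ i j, c i j = -c j i)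
    (hf : ∀ i j, f i j = f j i) : ∑ i, ∑ j, c i j * f i j = 0 := by
  have h : ∑ i, ∑ j, c i j * f i j = -∑ i, ∑ j, c i j * f i j := by
    conv_lhs => rw [Finset.sum_comm]
    rw [← Finset.sum_neg_distrib]
    refine Finset.sum_congr rfl fun i _ => ?_
    rw [← Finset.sum_neg_distrib]
    refine Finset.sum_congr rfl fun j _ => ?_
    rw [hc j i, hf j i]
    ring
  linarith

/-- `τ_j = ∑_r σ_{r-1}(ξ̂_j) θ_r` -/
def tau (ξ θ : Fin ℓ → ℝ) (j : Fin ℓ) : ℝ := ∑ r : Fin ℓ, σhat j r.val ξ * θ r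

/-- Linear in `θ`, so the divided differences of the `σ_r(ξ̂_j)` combine into divided differences of
the `τ_j`. -/
theorem hasDerivAt_tau {ξ : Fin ℓ → ℝ} (hξ : Function.Injective ξ) (y θ : Fin ℓ → ℝ)
    (j : Fin ℓ) : HasDerivAt (fun t : ℝ => tau (ξ + t • y) θ j)
      (∑ k, y k * (tau ξ θ j - tau ξ θ k) * (ξ k - ξ j)⁻¹) 0 := by
  have h := HasDerivAt.fun_sum (u := Finset.univ)
    (fun (r : Fin ℓ) _ => (hasDerivAt_σhat hξ y j r.val).mul_const (θ r))
  refine h.congr_deriv ?_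
  simp only [Finset.sum_mul]
  rw [Finset.sum_comm]
  refine Finset.sum_congr rfl fun k _ => ?_
  simp only [tau, ← Finset.sum_sub_distrib]
  rw [Finset.mul_sum, Finset.sum_mul]
  refine Finset.sum_congr rfl fun r _ => ?_
  ring

theorem hasDerivAt_pnc {ξ : Fin ℓ → ℝ} (y : Fin ℓ → ℝ) {e : ℝ} (he : ∀ j, ξ j ≠ e) :
    HasDerivAt (fun t : ℝ => pnc (ξ + t • y) e) ((∑ j, y j * (ξ j - e)⁻¹) * pnc ξ e) 0 := by
  have h := HasDerivAt.fun_finsetProd (u := Finset.univ) (x := (0 : ℝ))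
    (f := fun (j : Fin ℓ) (t : ℝ) => e - (ξ + t • y) j) (f' := fun j => -y j) (fun j _ => by
      have := (((hasDerivAt_id (0 : ℝ)).mul_const (y j)).const_add (ξ j)).const_sub e
      simpa using this)
  refine h.congr_deriv ?_
  rw [Finset.sum_mul]
  refine Finset.sum_congr rfl fun j _ => ?_
  have : pnc ξ e = (e - ξ j) * ∏ k ∈ Finset.univ.erase j, (e - ξ k) :=
    (Finset.mul_prod_erase Finset.univ (fun k => e - ξ k) (Finset.mem_univ j)).symm
  rw [this]
  have h1 : e - ξ j ≠ 0 := sub_ne_zero.2 (he j).symm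
  have h2 : ξ j - e ≠ 0 := sub_ne_zero.2 (he j)
  simp only [zero_smul, add_zero, smul_eq_mul]
  field_simp
  ring

variable {q : Fin ℓ → ℝ → ℝ} {q' ξ : Fin ℓ → ℝ}

/-- The differential of `Y_j`. -/
def gradCompDeriv (q : Fin ℓ → ℝ → ℝ) (q' ξ : Fin ℓ → ℝ) (x : Fin ℓ → ℝ) (j : Fin ℓ) : ℝ :=
  gradCompDiag q q' ξ j * x j + gradComp q ξ j * ∑ i, (ξ j - ξ i)⁻¹ * x i

theorem hasDerivAt_gradComp (hξ : Function.Injective ξ)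
    (hq : ∀ j, HasDerivAt (q j) (q' j) (ξ j)) (x : Fin ℓ → ℝ) (j : Fin ℓ) :
    HasDerivAt (fun t : ℝ => gradComp q (ξ + t • x) j) (gradCompDeriv q q' ξ x j) 0 := by
  have h := (hasFDerivAt_gradComp hξ (hq j)).hasLineDerivAt x
  refine HasDerivAt.congr_deriv h ?_
  simp [gradCompDeriv]

/-- With `x = Y` the coupling sum is, up to sign, the sum in the definition of `hessEigen`, by
antisymmetry of `(ξ_j - ξ_i)⁻¹`. -/
theorem gradCompDeriv_self (j : Fin ℓ) :
    gradCompDeriv q q' ξ (gradComp q ξ) j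
      = gradComp q ξ j * (2 * gradCompDiag q q' ξ j - hessEigen q q' ξ j) := by
  have h : ∑ i, (ξ j - ξ i)⁻¹ * gradComp q ξ i = -∑ k, gradComp q ξ k * (ξ k - ξ j)⁻¹ := by
    rw [← Finset.sum_neg_distrib]
    refine Finset.sum_congr rfl fun i _ => ?_
    rw [← neg_sub (ξ i) (ξ j), inv_neg]
    ring
  rw [gradCompDeriv, h, hessEigen]
  ring

/-- This is `d|∇σ_1|² = (L_{∇σ_1} g)(∇σ_1, ·)` in coordinates; it turns the vector field term of the
soliton equation into an exact differential. -/
theorem sum_gradCompDeriv (x : Fin ℓ → ℝ) :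
    ∑ j, gradCompDeriv q q' ξ x j = ∑ j, hessEigen q q' ξ j * x j := by
  simp only [gradCompDeriv, hessEigen, add_mul, Finset.sum_add_distrib, Finset.mul_sum,
    Finset.sum_mul]
  congr 1
  rw [Finset.sum_comm]
  refine Finset.sum_congr rfl fun i _ => Finset.sum_congr rfl fun j _ => ?_
  ring

theorem inv_sub_antisymm (a b : ℝ) : (a - b)⁻¹ = -(b - a)⁻¹ := by
  rw [← inv_neg, neg_sub]

/-- Separates the multiple of `τ_j`, which contributes to the eigenvalue, from the coupling to the
other `τ_k`, which has to cancel. -/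
theorem tau_deriv_eq (θ : Fin ℓ → ℝ) (j : Fin ℓ) :
    ∑ k, gradComp q ξ k * (tau ξ θ j - tau ξ θ k) * (ξ k - ξ j)⁻¹
      = (hessEigen q q' ξ j - gradCompDiag q q' ξ j) * tau ξ θ j
        - ∑ k, gradComp q ξ k * tau ξ θ k * (ξ k - ξ j)⁻¹ := by
  rw [hessEigen, add_sub_cancel_left, Finset.sum_mul, ← Finset.sum_sub_distrib]
  refine Finset.sum_congr rfl fun k _ => ?_
  ring

/-- The fibre part of the metric, as a function of `ξ`. -/
def fibreMetric (q : Fin ℓ → ℝ → ℝ) (ξ : Fin ℓ → ℝ) (x θx y θy : Fin ℓ → ℝ) : ℝ :=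
  ∑ j, (gradComp q ξ j)⁻¹ * (x j * y j) + ∑ j, gradComp q ξ j * (tau ξ θx j * tau ξ θy j)

/-- The Lie derivative of the fibre metric along `grad σ_1` is diagonal. -/
theorem lie_fibreMetric (hξ : Function.Injective ξ) (hq : ∀ j, HasDerivAt (q j) (q' j) (ξ j))
    (hq0 : ∀ j, q j (ξ j) ≠ 0) (x θx y θy : Fin ℓ → ℝ) :
    HasDerivAt (fun t : ℝ => fibreMetric q (ξ + t • gradComp q ξ) x θx y θy)
      (∑ j, hessEigen q q' ξ j * ((gradComp q ξ j)⁻¹ * (x j * y j)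
          + gradComp q ξ j * (tau ξ θx j * tau ξ θy j))
        - fibreMetric q ξ (gradCompDeriv q q' ξ x) 0 y θy
        - fibreMetric q ξ x θx (gradCompDeriv q q' ξ y) 0) 0 := by
  have hY0 : ∀ j, gradComp q ξ j ≠ 0 := fun j => div_ne_zero (hq0 j) (Δ_ne_zero hξ j)
  set Y := gradComp q ξ with hY
  have hz : ξ + (0 : ℝ) • Y = ξ := by simp
  have hYd := fun j => hasDerivAt_gradComp hξ hq Y j
  have hτ := fun θ j => hasDerivAt_tau hξ Y θ j
  have h1 := HasDerivAt.fun_sum (u := Finset.univ)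
    (fun (j : Fin ℓ) _ => ((hYd j).fun_inv (by rw [hz]; exact hY0 j)).mul_const (x j * y j))
  have h2 := HasDerivAt.fun_sum (u := Finset.univ)
    (fun (j : Fin ℓ) _ => (hYd j).fun_mul ((hτ θx j).fun_mul (hτ θy j)))
  refine (h1.fun_add h2).congr_deriv ?_
  simp only [hz, fibreMetric, ← hY]
  simp only [hY, tau_deriv_eq (q := q) (q' := q')]
  simp only [← hY]
  have t0 : ∀ j, tau ξ 0 j = 0 := fun j => by simp [tau]
  simp only [t0, zero_mul, mul_zero, Finset.sum_const_zero, add_zero]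
  rw [hY, funext (fun j => gradCompDeriv_self (q := q) (q' := q') (ξ := ξ) j), ← hY]
  -- cancellation of the off-diagonal terms
  have a1 : ∑ i, ∑ j, (ξ i - ξ j)⁻¹ * (x j * y i + x i * y j) = 0 :=
    sum_antisymm_eq_zero (fun i j => inv_sub_antisymm _ _) (fun i j => by ring)
  have a2 : ∑ i, ∑ j, (ξ j - ξ i)⁻¹ * (Y i * Y j *
      (tau ξ θx j * tau ξ θy i + tau ξ θx i * tau ξ θy j)) = 0 :=
    sum_antisymm_eq_zero (fun i j => inv_sub_antisymm _ _) (fun i j => by ring)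
  have e1 : ∑ j, (Y j)⁻¹ * (gradCompDeriv q q' ξ x j * y j)
      + ∑ j, (Y j)⁻¹ * (x j * gradCompDeriv q q' ξ y j)
      = ∑ j, 2 * gradCompDiag q q' ξ j * (Y j)⁻¹ * (x j * y j) := by
    rw [← add_zero (∑ j, 2 * gradCompDiag q q' ξ j * (Y j)⁻¹ * (x j * y j)), ← a1,
      ← Finset.sum_add_distrib, ← Finset.sum_add_distrib]
    refine Finset.sum_congr rfl fun j _ => ?_
    have : ∑ i, (ξ j - ξ i)⁻¹ * (x i * y j + x j * y i)
        = (∑ i, (ξ j - ξ i)⁻¹ * x i) * y j + x j * ∑ i, (ξ j - ξ i)⁻¹ * y i := by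
      rw [Finset.sum_mul, Finset.mul_sum, ← Finset.sum_add_distrib]
      exact Finset.sum_congr rfl fun i _ => by ring
    rw [this, gradCompDeriv, gradCompDeriv, ← hY]
    have := hY0 j
    field_simp
    ring
  have e2 : ∑ j, Y j * ((∑ k, Y k * tau ξ θx k * (ξ k - ξ j)⁻¹) * tau ξ θy j
      + tau ξ θx j * ∑ k, Y k * tau ξ θy k * (ξ k - ξ j)⁻¹) = 0 := by
    rw [← a2]
    refine Finset.sum_congr rfl fun j _ => ?_
    rw [Finset.sum_mul, Finset.mul_sum, ← Finset.sum_add_distrib, Finset.mul_sum]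
    exact Finset.sum_congr rfl fun i _ => by ring
  rw [sub_sub, e1, ← sub_zero (_ - _), ← e2, ← Finset.sum_sub_distrib, ← Finset.sum_sub_distrib,
    ← Finset.sum_add_distrib]
  refine Finset.sum_congr rfl fun j _ => ?_
  have := hY0 j
  field_simp
  ring

/-- The fibre part of the Kähler form, as a function of `ξ`. -/
def fibreForm (ξ : Fin ℓ → ℝ) (x θx y θy : Fin ℓ → ℝ) : ℝ :=
  ∑ j, (x j * tau ξ θy j - y j * tau ξ θx j)

theorem fibreForm_eq (ξ x θx y θy : Fin ℓ → ℝ) :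
    ∑ r : Fin ℓ, (dσ (r.val + 1) ξ x * θy r - dσ (r.val + 1) ξ y * θx r)
      = fibreForm ξ x θx y θy := by
  have h : ∀ x θ : Fin ℓ → ℝ, ∑ r : Fin ℓ, dσ (r.val + 1) ξ x * θ r = ∑ j, x j * tau ξ θ j := by
    intro x θ
    simp only [dσ_succ, tau, Finset.sum_mul, Finset.mul_sum]
    rw [Finset.sum_comm]
    exact Finset.sum_congr rfl fun j _ => Finset.sum_congr rfl fun r _ => by ring
  rw [Finset.sum_sub_distrib, h, h, fibreForm, Finset.sum_sub_distrib]

/-- The Lie derivative of the fibre part of the Kähler form along `grad σ_1` is diagonal. -/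
theorem lie_fibreForm (hξ : Function.Injective ξ) (x θx y θy : Fin ℓ → ℝ) :
    HasDerivAt (fun t : ℝ => fibreForm (ξ + t • gradComp q ξ) x θx y θy)
      (∑ j, hessEigen q q' ξ j * (x j * tau ξ θy j - y j * tau ξ θx j)
        - fibreForm ξ (gradCompDeriv q q' ξ x) 0 y θy
        - fibreForm ξ x θx (gradCompDeriv q q' ξ y) 0) 0 := by
  have h := HasDerivAt.fun_sum (u := Finset.univ)
    (fun (j : Fin ℓ) _ => ((hasDerivAt_tau hξ (gradComp q ξ) θy j).const_mul (x j)).fun_sub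
      ((hasDerivAt_tau hξ (gradComp q ξ) θx j).const_mul (y j)))
  refine h.congr_deriv ?_
  simp only [tau_deriv_eq (q := q) (q' := q')]
  have t0 : ∀ j, tau ξ 0 j = 0 := fun j => by simp [tau]
  simp only [fibreForm, t0, mul_zero, sub_zero, zero_sub]
  set Y := gradComp q ξ with hY
  -- Exchanging the two sums brings the coupling terms of `dY_j` to the form of those produced by
  -- differentiating `τ_j`, so that they cancel.
  have key : ∀ x θ : Fin ℓ → ℝ, ∑ j, gradCompDeriv q q' ξ x j * tau ξ θ j
      = ∑ j, (gradCompDiag q q' ξ j * x j * tau ξ θ j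
        + x j * ∑ k, Y k * tau ξ θ k * (ξ k - ξ j)⁻¹) := by
    intro x θ
    simp only [gradCompDeriv, add_mul, Finset.sum_add_distrib, Finset.mul_sum, Finset.sum_mul,
      ← hY]
    congr 1
    rw [Finset.sum_comm]
    exact Finset.sum_congr rfl fun j _ => Finset.sum_congr rfl fun r _ => by ring
  rw [Finset.sum_neg_distrib, key, key, sub_neg_eq_add, ← Finset.sum_sub_distrib,
    ← Finset.sum_add_distrib]
  refine Finset.sum_congr rfl fun j _ => ?_
  ring

/-- The two coupling sums are exchanged into each other by swapping indices, so only the derivatives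
of the `q_j` survive in the trace. -/
theorem sum_hessEigen : ∑ j, hessEigen q q' ξ j = ∑ j, q' j / Δ ξ j := by
  simp only [hessEigen, gradCompDiag, Finset.sum_add_distrib, Finset.sum_sub_distrib,
    Finset.mul_sum]
  rw [Finset.sum_comm (f := fun j k => gradComp q ξ k * (ξ k - ξ j)⁻¹)]
  ring

end Orthotoric

/-! ### Holomorphic charts: differentials, coordinate frames and `J`. -/

section Charts

set_option synthInstance.maxHeartbeats 400000

variable {n : ℕ} {M : Type u} [TopologicalSpace M] [ChartedSpace (Cn n) M]

/-- The differential of a chart, in the coordinates of the preferred chart of the source. -/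
def chartDeriv (c : OpenPartialHomeomorph M (Cn n)) (x : M) : Cn n →L[ℝ] Cn n :=
  mfderiv 𝓘(ℝ, Cn n) 𝓘(ℝ, Cn n) c x

/-- The coordinate frame of a chart, in the coordinates of the preferred chart. -/
def frameDeriv (c : OpenPartialHomeomorph M (Cn n)) (z : Cn n) : Cn n →L[ℝ] Cn n := frame c z

/-- The values of a bilinear form, in the coordinates of the preferred chart. -/
def formAt (β : TwoTensor n M) (x : M) : Cn n →L[ℝ] Cn n →L[ℝ] ℝ := β x

theorem localForm_apply (c : OpenPartialHomeomorph M (Cn n)) (β : TwoTensor n M) (z u w : Cn n) :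
    localForm c β z u w = formAt β (c.symm z) (frameDeriv c z u) (frameDeriv c z w) := rfl

theorem formAt_fundamentalForm (β : TwoTensor n M) (x : M) (u w : Cn n) :
    formAt (fundamentalForm β) x u w = formAt β x (Complex.I • u) w := rfl

variable [IsManifold 𝓘(ℂ, Cn n) ω M] {c : OpenPartialHomeomorph M (Cn n)}

theorem mem_maximalAtlas_real (hc : c ∈ atlas (Cn n) M) :
    c ∈ IsManifold.maximalAtlas 𝓘(ℝ, Cn n) ∞ M :=
  IsManifold.subset_maximalAtlas hc

theorem contMDiffAt_chart (hc : c ∈ atlas (Cn n) M) {x : M} (hx : x ∈ c.source) :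
    ContMDiffAt 𝓘(ℝ, Cn n) 𝓘(ℝ, Cn n) ∞ c x :=
  (contMDiffOn_of_mem_maximalAtlas (mem_maximalAtlas_real hc)).contMDiffAt
    (c.open_source.mem_nhds hx)

theorem mdifferentiableAt_chart (hc : c ∈ atlas (Cn n) M) {x : M} (hx : x ∈ c.source) :
    MDifferentiableAt 𝓘(ℝ, Cn n) 𝓘(ℝ, Cn n) c x :=
  (contMDiffAt_chart hc hx).mdifferentiableAt (by simp)

theorem contMDiffAt_chart_symm (hc : c ∈ atlas (Cn n) M) {z : Cn n} (hz : z ∈ c.target) :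
    ContMDiffAt 𝓘(ℝ, Cn n) 𝓘(ℝ, Cn n) ∞ c.symm z :=
  (contMDiffOn_symm_of_mem_maximalAtlas (mem_maximalAtlas_real hc)).contMDiffAt
    (c.open_target.mem_nhds hz)

theorem mdifferentiableAt_chart_symm (hc : c ∈ atlas (Cn n) M) {z : Cn n} (hz : z ∈ c.target) :
    MDifferentiableAt 𝓘(ℝ, Cn n) 𝓘(ℝ, Cn n) c.symm z :=
  (contMDiffAt_chart_symm hc hz).mdifferentiableAt (by simp)

/-- Holomorphic charts intertwine `J` with the multiplication by `i`. -/
theorem chartDeriv_I (hc : c ∈ atlas (Cn n) M) {x : M} (hx : x ∈ c.source) (v : Cn n) :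
    chartDeriv c x (Complex.I • v) = Complex.I • chartDeriv c x v := by
  have h := (contDiffGroupoid ω 𝓘(ℂ, Cn n)).compatible (chart_mem_atlas (Cn n) x) hc
  rw [contDiffGroupoid, mem_groupoid_of_pregroupoid] at h
  have h1 := h.1
  simp only [contDiffPregroupoid, modelWithCornersSelf_coe, modelWithCornersSelf_coe_symm,
    Function.comp_id, Function.id_comp, range_id, inter_univ, preimage_id] at h1
  have hmem : chartAt (Cn n) x x ∈ ((chartAt (Cn n) x).symm ≫ₕ c).source := by
    simp [hx]
  have hd : DifferentiableAt ℂ ((chartAt (Cn n) x).symm ≫ₕ c) (chartAt (Cn n) x x) :=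
    ((h1 _ hmem).contDiffAt (((chartAt (Cn n) x).symm ≫ₕ c).open_source.mem_nhds hmem)
      ).differentiableAt (by simp)
  -- Read in the preferred chart at `x`, the differential of `c` is that of a holomorphic transition
  -- map, hence complex linear.
  have hm : HasMFDerivAt 𝓘(ℝ, Cn n) 𝓘(ℝ, Cn n) c x
      ((fderiv ℂ ((chartAt (Cn n) x).symm ≫ₕ c) (chartAt (Cn n) x x)).restrictScalars ℝ) :=
    ⟨c.continuousAt hx, (hd.hasFDerivAt.restrictScalars ℝ).hasFDerivWithinAt⟩
  have key : chartDeriv c x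
      = (fderiv ℂ ((chartAt (Cn n) x).symm ≫ₕ c) (chartAt (Cn n) x x)).restrictScalars ℝ :=
    hm.mfderiv
  rw [key]
  exact (fderiv ℂ ((chartAt (Cn n) x).symm ≫ₕ c) (chartAt (Cn n) x x)).map_smul Complex.I v

theorem chartDeriv_frameDeriv (hc : c ∈ atlas (Cn n) M) {z : Cn n} (hz : z ∈ c.target)
    (u : Cn n) : chartDeriv c (c.symm z) (frameDeriv c z u) = u := by
  have h := mfderiv_comp z (mdifferentiableAt_chart hc (c.map_target hz))
    (mdifferentiableAt_chart_symm hc hz)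
  have h2 : (c ∘ c.symm) =ᶠ[𝓝 z] id := by
    filter_upwards [c.open_target.mem_nhds hz] with y hy using c.right_inv hy
  rw [h2.mfderiv_eq, mfderiv_id] at h
  exact (congrArg (fun L : Cn n →L[ℝ] Cn n => L u) h).symm

theorem frameDeriv_chartDeriv (hc : c ∈ atlas (Cn n) M) {z : Cn n} (hz : z ∈ c.target)
    (u : Cn n) : frameDeriv c z (chartDeriv c (c.symm z) u) = u := by
  have h1 : Function.LeftInverse (chartDeriv c (c.symm z)) (frameDeriv c z) :=
    chartDeriv_frameDeriv hc hz
  have h2 : Function.Injective (frameDeriv c z : Cn n →ₗ[ℝ] Cn n) := h1.injective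
  have h3 := LinearMap.injective_iff_surjective.1 h2
  obtain ⟨y, rfl⟩ := h3 u
  exact congrArg (frameDeriv c z) (h1 y)

theorem frameDeriv_I (hc : c ∈ atlas (Cn n) M) {z : Cn n} (hz : z ∈ c.target) (u : Cn n) :
    frameDeriv c z (Complex.I • u) = Complex.I • frameDeriv c z u := by
  have h := chartDeriv_I hc (c.map_target hz) (frameDeriv c z u)
  rw [chartDeriv_frameDeriv hc hz] at h
  rw [← h, frameDeriv_chartDeriv hc hz]

theorem localForm_fundamentalForm (hc : c ∈ atlas (Cn n) M) {z : Cn n} (hz : z ∈ c.target)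
    (β : TwoTensor n M) (u w : Cn n) :
    localForm c (fundamentalForm β) z u w = localForm c β z (Complex.I • u) w := by
  rw [localForm_apply, localForm_apply, formAt_fundamentalForm, frameDeriv_I hc hz]

/-- Coordinate fields are smooth sections of the tangent bundle. -/
theorem contMDiffAt_frame (hc : c ∈ atlas (Cn n) M) {z : Cn n} (hz : z ∈ c.target) (u : Cn n) :
    ContMDiffAt 𝓘(ℝ, Cn n) (𝓘(ℝ, Cn n).prod 𝓘(ℝ, Cn n)) ∞
      (fun z => (⟨c.symm z, frame c z u⟩ :
        TotalSpace (Cn n) (fun x : M => TangentSpace 𝓘(ℝ, Cn n) x))) z := by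
  rw [contMDiffAt_totalSpace]
  refine ⟨contMDiffAt_chart_symm hc hz, ?_⟩
  set x₀ := c.symm z with hx₀
  set e := chartAt (Cn n) x₀ with he
  have hea : e ∈ atlas (Cn n) M := chart_mem_atlas _ _
  have hsm : ∀ᶠ z' in 𝓝 z, z' ∈ c.target ∧ c.symm z' ∈ e.source := by
    have h1 : ∀ᶠ z' in 𝓝 z, z' ∈ c.target := c.open_target.mem_nhds hz
    have h2 : ∀ᶠ z' in 𝓝 z, c.symm z' ∈ e.source :=
      (c.symm.continuousAt hz).eventually (e.open_source.mem_nhds (mem_chart_source _ _))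
    exact h1.and h2
  have hcomp : ContDiffAt ℝ ∞ (e ∘ c.symm) z :=
    (ContMDiffAt.comp z (contMDiffAt_chart hea hsm.self_of_nhds.2)
      (contMDiffAt_chart_symm hc hz)).contDiffAt
  have hsmooth : ContDiffAt ℝ ∞ (fun z' => fderiv ℝ (e ∘ c.symm) z' u) z :=
    (hcomp.fderiv_right (m := ∞) (by simp)).clm_apply contDiffAt_const
  refine hsmooth.contMDiffAt.congr_of_eventuallyEq ?_
  filter_upwards [hsm] with z' hz'
  -- In the trivialization of the tangent bundle by `e`, the coordinate frame is the differential of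
  -- the transition map `e ∘ c.symm`, which is smooth.
  have h1 : fderiv ℝ (e ∘ c.symm) z' = (chartDeriv e (c.symm z')).comp (frameDeriv c z') := by
    rw [← mfderiv_eq_fderiv]
    exact mfderiv_comp z' (mdifferentiableAt_chart hea hz'.2) (mdifferentiableAt_chart_symm hc hz'.1)
  rw [h1]
  have h2 := TangentBundle.continuousLinearMapAt_trivializationAt
    (I := 𝓘(ℝ, Cn n)) (x₀ := x₀) (x := c.symm z') hz'.2
  have h3 : (trivializationAt (Cn n) (TangentSpace 𝓘(ℝ, Cn n)) x₀
      ⟨c.symm z', frame c z' u⟩).2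
      = (trivializationAt (Cn n) (TangentSpace 𝓘(ℝ, Cn n)) x₀).continuousLinearMapAt ℝ
        (c.symm z') (frame c z' u) := by
    rw [Trivialization.continuousLinearMapAt_apply, Trivialization.coe_linearMapAt_of_mem]
    exact hz'.2
  refine h3.trans ?_
  rw [h2]
  rfl

end Charts

/-! ### The Kähler metric in a chart: smooth, Hermitian, closed. -/

namespace KahlerManifold

variable (M : KahlerManifold.{u}) {c : OpenPartialHomeomorph M.Carrier (Cn M.dim)}

set_option synthInstance.maxHeartbeats 400000

/-- The components are the smooth section `g` evaluated on smooth coordinate fields. -/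
theorem contDiffOn_localForm_g (hc : c ∈ atlas (Cn M.dim) M.Carrier) :
    ContDiffOn ℝ ∞ (localForm c M.g) c.target := by
  rw [contDiffOn_clm_apply]
  intro u
  rw [contDiffOn_clm_apply]
  intro w z hz
  refine ContDiffAt.contDiffWithinAt ?_
  have hg : ContMDiffAt 𝓘(ℝ, Cn M.dim)
      (𝓘(ℝ, Cn M.dim).prod 𝓘(ℝ, Cn M.dim →L[ℝ] Cn M.dim →L[ℝ] ℝ)) ∞
      (fun z => (⟨c.symm z, M.metric.inner (c.symm z)⟩ :
        TotalSpace (Cn M.dim →L[ℝ] Cn M.dim →L[ℝ] ℝ)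
          (fun x : M.Carrier => TangentSpace 𝓘(ℝ, Cn M.dim) x →L[ℝ]
            TangentSpace 𝓘(ℝ, Cn M.dim) x →L[ℝ] ℝ))) z :=
    ContMDiffAt.comp z M.metric.contMDiff.contMDiffAt (contMDiffAt_chart_symm hc hz)
  have h : ContMDiffAt 𝓘(ℝ, Cn M.dim) (𝓘(ℝ, Cn M.dim).prod 𝓘(ℝ, ℝ)) ∞
      (fun z => TotalSpace.mk' ℝ (E := Bundle.Trivial M.Carrier ℝ) (c.symm z)
        (M.metric.inner (c.symm z) (frame c z u) (frame c z w))) z := by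
    apply ContMDiffAt.clm_bundle_apply₂ (F₁ := Cn M.dim) (F₂ := Cn M.dim)
    · exact hg
    · exact contMDiffAt_frame hc hz u
    · exact contMDiffAt_frame hc hz w
  rw [contMDiffAt_totalSpace] at h
  exact h.2.contDiffAt

theorem contDiffAt_localForm_g (hc : c ∈ atlas (Cn M.dim) M.Carrier) {z : Cn M.dim}
    (hz : z ∈ c.target) : ContDiffAt ℝ ∞ (localForm c M.g) z :=
  (M.contDiffOn_localForm_g hc).contDiffAt (c.open_target.mem_nhds hz)

theorem isHermitianForm_localForm (hc : c ∈ atlas (Cn M.dim) M.Carrier) {z : Cn M.dim}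
    (hz : z ∈ c.target) : IsHermitianForm (localForm c M.g z) where
  symm u w := M.metric.symm _ _ _
  pos u hu := by
    refine M.metric.pos _ (frame c z u) fun h => hu ?_
    rw [← chartDeriv_frameDeriv hc hz u, show frameDeriv c z u = 0 from h, map_zero]
  inv u w := by
    rw [localForm_apply, localForm_apply, frameDeriv_I hc hz, frameDeriv_I hc hz]
    exact M.J_invariant _ _ _

theorem differentiableAt_localForm_kahlerForm (hc : c ∈ atlas (Cn M.dim) M.Carrier)
    {z : Cn M.dim} (hz : z ∈ c.target) : DifferentiableAt ℝ (localForm c M.kahlerForm) z := by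
  have hd := (M.contDiffAt_localForm_g hc hz).differentiableAt (by simp)
  have heq : localForm c M.kahlerForm =ᶠ[𝓝 z] fun z' => (localForm c M.g z').comp
      (Complex.I • ContinuousLinearMap.id ℝ (Cn M.dim)) := by
    filter_upwards [c.open_target.mem_nhds hz] with z' hz'
    ext u w
    exact localForm_fundamentalForm hc hz' M.g u w
  exact (hd.clm_comp (differentiableAt_const _)).congr_of_eventuallyEq heq

theorem fderiv_localForm_kahlerForm (hc : c ∈ atlas (Cn M.dim) M.Carrier) {z : Cn M.dim}
    (hz : z ∈ c.target) (y u w : Cn M.dim) :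
    fderiv ℝ (localForm c M.kahlerForm) z y u w
      = fderiv ℝ (localForm c M.g) z y (Complex.I • u) w := by
  have he2 : (fun z' => localForm c M.kahlerForm z' u w) =ᶠ[𝓝 z]
      fun z' => localForm c M.g z' (Complex.I • u) w := by
    filter_upwards [c.open_target.mem_nhds hz] with z' hz'
    exact localForm_fundamentalForm hc hz' M.g u w
  rw [fderiv_form_apply (M.differentiableAt_localForm_kahlerForm hc hz),
    fderiv_form_apply ((M.contDiffAt_localForm_g hc hz).differentiableAt (by simp)),
    he2.fderiv_eq]

/-- Holomorphic charts have constant `J`, so `dω = 0` can be written with the derivative of `g`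
alone; this is the form that the chart calculus consumes. -/
theorem closed_localForm (hc : c ∈ atlas (Cn M.dim) M.Carrier) {z : Cn M.dim}
    (hz : z ∈ c.target) (u v w : Cn M.dim) :
    fderiv ℝ (localForm c M.g) z u (Complex.I • v) w
      + fderiv ℝ (localForm c M.g) z v (Complex.I • w) u
      + fderiv ℝ (localForm c M.g) z w (Complex.I • u) v = 0 := by
  have h := M.closed c hc z hz u v w
  have e := M.fderiv_localForm_kahlerForm hc hz
  rw [kahlerForm, g] at e
  rw [e, e, e] at h
  exact h

end KahlerManifold

/-! ### Naturality of the Lie derivative. -/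

section Naturality

set_option synthInstance.maxHeartbeats 400000

variable {E F : Type*} [NormedAddCommGroup E] [NormedSpace ℝ E] [NormedAddCommGroup F]
  [NormedSpace ℝ F]

/-- The Lie derivative of a bilinear form is natural: if `Ψ` maps the field `y` to `Y` and pulls
`G` back to `R`, then `L_Y G` is pulled back to `L_y R`. -/
theorem lie_pullback {Ψ : E → F} {G : F → F →L[ℝ] F →L[ℝ] ℝ} {Y : F → F} {y : E → E}
    {y' : E →L[ℝ] E} {x : E} {R : E → E → E → ℝ} {r : E → E → ℝ}
    (hΨ : ContDiffAt ℝ ∞ Ψ x) (hG : DifferentiableAt ℝ G (Ψ x)) (hY : DifferentiableAt ℝ Y (Ψ x))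
    (hy : HasFDerivAt y y' x) (hYy : ∀ᶠ x' in 𝓝 x, Y (Ψ x') = fderiv ℝ Ψ x' (y x'))
    (hR : ∀ᶠ x' in 𝓝 x, ∀ u w, G (Ψ x') (fderiv ℝ Ψ x' u) (fderiv ℝ Ψ x' w) = R x' u w)
    (hr : ∀ u w, HasDerivAt (fun t : ℝ => R (x + t • y x) u w)
      (r u w - R x (y' u) w - R x u (y' w)) 0) (u w : E) :
    fderiv ℝ G (Ψ x) (Y (Ψ x)) (fderiv ℝ Ψ x u) (fderiv ℝ Ψ x w)
      + G (Ψ x) (fderiv ℝ Y (Ψ x) (fderiv ℝ Ψ x u)) (fderiv ℝ Ψ x w)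
      + G (Ψ x) (fderiv ℝ Ψ x u) (fderiv ℝ Y (Ψ x) (fderiv ℝ Ψ x w)) = r u w := by
  have hΨd : HasFDerivAt Ψ (fderiv ℝ Ψ x) x := (hΨ.differentiableAt (by simp)).hasFDerivAt
  have hΨ2 : HasFDerivAt (fderiv ℝ Ψ) (fderiv ℝ (fderiv ℝ Ψ) x) x :=
    ((hΨ.fderiv_right (m := 1) (by norm_cast)).differentiableAt (by simp)).hasFDerivAt
  have hsymm : ∀ a b, fderiv ℝ (fderiv ℝ Ψ) x a b = fderiv ℝ (fderiv ℝ Ψ) x b a :=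
    fun a b => (hΨ.isSymmSndFDerivAt minSmoothness_two_le_infty).eq a b
  -- Differentiating `Y ∘ Ψ = dΨ(y)`. The `D²Ψ` term, after the symmetry of second derivatives, is
  -- the one that appears when the pulled back form is differentiated along `y`.
  have hfield : ∀ a, fderiv ℝ Y (Ψ x) (fderiv ℝ Ψ x a)
      = fderiv ℝ (fderiv ℝ Ψ) x (y x) a + fderiv ℝ Ψ x (y' a) := by
    intro a
    have h1 := hY.hasFDerivAt.comp x hΨd
    have h2 := (hΨ2.clm_apply hy).congr_of_eventuallyEq (f₁ := Y ∘ Ψ) hYy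
    have h3 := congrArg (fun L : E →L[ℝ] F => L a) (h1.unique h2)
    simp only [ContinuousLinearMap.comp_apply, add_apply, ContinuousLinearMap.flip_apply] at h3
    rw [h3, hsymm a, add_comm]
  have hGΨ : HasFDerivAt (fun x' => G (Ψ x')) ((fderiv ℝ G (Ψ x)).comp (fderiv ℝ Ψ x)) x :=
    HasFDerivAt.comp (g := G) x hG.hasFDerivAt hΨd
  have hu := hΨ2.clm_apply (hasFDerivAt_const u x)
  have hw := hΨ2.clm_apply (hasFDerivAt_const w x)
  have hGu := hGΨ.clm_apply hu
  have hpull := hGu.clm_apply hw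
  have hpull' := (hpull.congr_of_eventuallyEq (f₁ := fun x' => R x' u w)
    (hR.mono fun x' h => (h u w).symm)).hasLineDerivAt (y x)
  have h := HasDerivAt.unique hpull' (hr u w)
  have hRx := hR.self_of_nhds
  have hYx := hYy.self_of_nhds
  rw [← hRx, ← hRx] at h
  simp only [ContinuousLinearMap.comp_apply, add_apply, ContinuousLinearMap.flip_apply,
    zero_apply, map_zero, zero_add] at h
  rw [hfield, hfield, hYx]
  simp only [map_add, add_apply]
  linarith

end Naturality

/-! ### Traces of block scalar endomorphisms. -/

section Trace

/-- The trace of a block scalar endomorphism of a product. -/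
theorem trace_pi_smul {ι : Type*} [Fintype ι] {V : ι → Type*} [∀ i, AddCommGroup (V i)]
    [∀ i, Module ℝ (V i)] [∀ i, FiniteDimensional ℝ (V i)] (k : ι → ℝ) :
    LinearMap.trace ℝ (∀ i, V i) (LinearMap.pi fun i => k i • LinearMap.proj i)
      = ∑ i, k i * Module.finrank ℝ (V i) := by
  classical
  have h : (LinearMap.pi fun i => k i • LinearMap.proj i : (∀ i, V i) →ₗ[ℝ] ∀ i, V i)
      = ∑ i, k i • (LinearMap.single ℝ V i ∘ₗ LinearMap.proj i) := by
    ext i v j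
    simp only [LinearMap.coe_comp, Function.comp_apply, LinearMap.pi_apply, LinearMap.smul_apply,
      LinearMap.proj_apply, LinearMap.sum_apply, Finset.sum_apply, Pi.smul_apply,
      LinearMap.coe_single]
    rw [Finset.sum_eq_single j]
    · simp
    · intro b _ hb
      simp [Pi.single_eq_of_ne hb.symm]
    · simp
  rw [h, map_sum]
  refine Finset.sum_congr rfl fun i _ => ?_
  rw [map_smul, LinearMap.trace_comp_comm', LinearMap.proj_comp_single_same, LinearMap.trace_id,
    smul_eq_mul]

theorem finrank_real_Cn (n : ℕ) : Module.finrank ℝ (Cn n) = 2 * n := by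
  have h : Module.finrank ℝ (Cn n) = 2 * Module.finrank ℂ (Cn n) := finrank_real_of_complex (Cn n)
  rw [h, finrank_euclideanSpace_fin]

end Trace

/-! ### The normal form at a point and its eigenspace splitting. -/

namespace HamiltonianAnsatz

set_option synthInstance.maxHeartbeats 400000

variable {ℓ : ℕ} {M : KahlerManifold.{u}} {φ : TwoTensor M.dim M.Carrier} {I : Fin ℓ → Set ℝ}
  (A : HamiltonianAnsatz.{u, v, w} M φ I)

/-- The functions `F_j / p_c`. -/
def profile (j : Fin ℓ) (t : ℝ) : ℝ := A.F j t / pc A.B A.η t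

/-- The differential of the identification of `𝒟 × P` with `M⁰`. -/
def derivΦ (y : (Fin ℓ → ℝ) × A.Q.P) : ((Fin ℓ → ℝ) × A.Q.E) →L[ℝ] Cn M.dim :=
  mfderiv (𝓘(ℝ, Fin ℓ → ℝ).prod 𝓘(ℝ, A.Q.E)) 𝓘(ℝ, Cn M.dim) A.Φ y

/-- The connection form at a point. -/
def conn (p : A.Q.P) : A.Q.E →L[ℝ] (Fin ℓ → ℝ) := A.Q.θ p

/-- The differential of the projection to a factor of the base. -/
def projDeriv (a : Fin A.N) (p : A.Q.P) : A.Q.E →L[ℝ] Cn (A.B a).dim :=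
  mfderiv 𝓘(ℝ, A.Q.E) 𝓘(ℝ, Cn (A.B a).dim) (A.Q.proj a) p

/-- The pull-back of the metric of a factor of the base. -/
def baseMet (a : Fin A.N) (p : A.Q.P) (x y : A.Q.E) : ℝ :=
  formAt (A.B a).g (A.Q.proj a p) (A.projDeriv a p x) (A.projDeriv a p y)

/-- The pull-back of the Kähler form of a factor of the base. -/
def baseOm (a : Fin A.N) (p : A.Q.P) (x y : A.Q.E) : ℝ :=
  formAt (A.B a).kahlerForm (A.Q.proj a p) (A.projDeriv a p x) (A.projDeriv a p y)

theorem derivΦ_bijective {ξ : Fin ℓ → ℝ} (hξ : ξ ∈ univ.pi I) (p : A.Q.P) :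
    Function.Bijective (A.derivΦ (ξ, p)) := A.Φ_derivative ξ hξ p

theorem split_bijective (p : A.Q.P) : Function.Bijective
    (fun x : A.Q.E => ((fun a => A.projDeriv a p x, A.conn p x) :
      (∀ a, Cn (A.B a).dim) × (Fin ℓ → ℝ))) := A.Q.splitting p

theorem F_ne_zero {j : Fin ℓ} {t : ℝ} (ht : t ∈ I j) : A.F j t ≠ 0 := fun h => by
  simpa [h] using A.F_pos j t ht

theorem pc_ne_zero {j : Fin ℓ} {t : ℝ} (ht : t ∈ I j) : pc A.B A.η t ≠ 0 := fun h => by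
  simpa [h] using A.F_pos j t ht

theorem profile_ne_zero {j : Fin ℓ} {t : ℝ} (ht : t ∈ I j) : A.profile j t ≠ 0 :=
  div_ne_zero (A.F_ne_zero ht) (A.pc_ne_zero ht)

theorem ne_η {ξ : Fin ℓ → ℝ} (hξ : ξ ∈ univ.pi I) (a : Fin A.N) (j : Fin ℓ) : ξ j ≠ A.η a := by
  intro h
  have := A.pnc_pos ξ hξ a
  rw [pnc, Finset.prod_eq_zero (Finset.mem_univ j) (sub_eq_zero.2 h.symm), mul_zero] at this
  exact this.false

theorem metric_formAt {ξ : Fin ℓ → ℝ} (hξ : ξ ∈ univ.pi I) (p : A.Q.P)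
    (x y : (Fin ℓ → ℝ) × A.Q.E) :
    formAt M.g (A.Φ (ξ, p)) (A.derivΦ (ξ, p) x) (A.derivΦ (ξ, p) y)
      = ∑ a, A.ε a * pnc ξ (A.η a) * A.baseMet a p x.2 y.2
        + fibreMetric A.profile ξ x.1 (A.conn p x.2) y.1 (A.conn p y.2) := by
  refine (A.metric_eq ξ hξ p x y).trans ?_
  rw [add_assoc, fibreMetric]
  congr 1
  congr 1
  · refine Finset.sum_congr rfl fun j _ => ?_
    rw [gradComp, profile, div_div, inv_div]
  · refine Finset.sum_congr rfl fun j _ => ?_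
    rw [gradComp, profile, div_div]
    rfl

theorem kahlerForm_formAt {ξ : Fin ℓ → ℝ} (hξ : ξ ∈ univ.pi I) (p : A.Q.P)
    (x y : (Fin ℓ → ℝ) × A.Q.E) :
    formAt M.kahlerForm (A.Φ (ξ, p)) (A.derivΦ (ξ, p) x) (A.derivΦ (ξ, p) y)
      = ∑ a, A.ε a * pnc ξ (A.η a) * A.baseOm a p x.2 y.2
        + fibreForm ξ x.1 (A.conn p x.2) y.1 (A.conn p y.2) := by
  rw [← fibreForm_eq]
  exact A.kahlerForm_eq ξ hξ p x y

theorem formAt_pos (x : M.Carrier) {v : Cn M.dim} (hv : v ≠ 0) : 0 < formAt M.g x v v :=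
  M.metric.pos x v hv

/-- `tau` as a linear map. -/
def tauLin (ξ : Fin ℓ → ℝ) : (Fin ℓ → ℝ) →ₗ[ℝ] (Fin ℓ → ℝ) where
  toFun θ := tau ξ θ
  map_add' θ θ' := by
    ext j
    simp [tau, mul_add, Finset.sum_add_distrib]
  map_smul' r θ := by
    ext j
    simp only [tau, Pi.smul_apply, smul_eq_mul, Finset.mul_sum, RingHom.id_apply]
    exact Finset.sum_congr rfl fun _ _ => by ring

/-- A tangent vector of `P` that is horizontal over the base and has all `τ_j` zero would have
length zero, so positivity of `g` forces injectivity. -/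
theorem tauLin_injective {ξ : Fin ℓ → ℝ} (hξ : ξ ∈ univ.pi I) (p : A.Q.P) :
    Function.Injective (tauLin ξ) := by
  rw [injective_iff_map_eq_zero]
  intro θ hθ
  obtain ⟨x, hx⟩ := (A.split_bijective p).2 (0, θ)
  have h1 : ∀ a, A.projDeriv a p x = 0 := fun a => congrFun (congrArg Prod.fst hx) a
  have h2 : A.conn p x = θ := congrArg Prod.snd hx
  have h3 := A.metric_formAt hξ p (0, x) (0, x)
  have h4 : ∀ j, tau ξ θ j = 0 := fun j => congrFun hθ j
  have h5 : formAt M.g (A.Φ (ξ, p)) (A.derivΦ (ξ, p) (0, x)) (A.derivΦ (ξ, p) (0, x)) = 0 := by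
    rw [h3]
    simp [baseMet, h1, fibreMetric, h2, h4]
  have h6 : A.derivΦ (ξ, p) (0, x) = 0 := by
    by_contra hne
    exact (formAt_pos _ hne).ne' h5
  have h7 : ((0 : Fin ℓ → ℝ), x) = 0 := (A.derivΦ_bijective hξ p).1 (h6.trans (map_zero _).symm)
  have h8 : x = 0 := congrArg Prod.snd h7
  rw [← h2, h8, map_zero]

/-- The tangent space of `𝒟 × P` splits into eigenspaces; endomorphisms that are diagonal for this
splitting exist, and their traces are as expected. -/
theorem exists_diagonal {ξ : Fin ℓ → ℝ} (hξ : ξ ∈ univ.pi I) (p : A.Q.P) (m : Fin ℓ → ℝ)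
    (κ : Fin A.N → ℝ) :
    ∃ C : ((Fin ℓ → ℝ) × A.Q.E) →ₗ[ℝ] ((Fin ℓ → ℝ) × A.Q.E),
      (∀ x j, (C x).1 j = m j * x.1 j) ∧
      (∀ x a, A.projDeriv a p (C x).2 = κ a • A.projDeriv a p x.2) ∧
      (∀ x j, tau ξ (A.conn p (C x).2) j = m j * tau ξ (A.conn p x.2) j) ∧
      LinearMap.trace ℝ _ C = 2 * (∑ j, m j + ∑ a, κ a * (A.B a).dim) := by
  let split : A.Q.E →ₗ[ℝ] (∀ a, Cn (A.B a).dim) × (Fin ℓ → ℝ) :=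
    (LinearMap.pi fun a => (A.projDeriv a p : A.Q.E →ₗ[ℝ] Cn (A.B a).dim)).prod
      (A.conn p : A.Q.E →ₗ[ℝ] (Fin ℓ → ℝ))
  have hsplit : Function.Bijective split := A.split_bijective p
  have hτ : Function.Bijective (tauLin ξ) :=
    ⟨A.tauLin_injective hξ p, LinearMap.injective_iff_surjective.1 (A.tauLin_injective hξ p)⟩
  -- The linear coordinates `(dξ, projections to the factors, τ ∘ θ)`, in which `g` and `ω` are
  -- block diagonal.
  let S : ((Fin ℓ → ℝ) × A.Q.E) ≃ₗ[ℝ]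
      (Fin ℓ → ℝ) × ((∀ a, Cn (A.B a).dim) × (Fin ℓ → ℝ)) :=
    (LinearEquiv.refl ℝ (Fin ℓ → ℝ)).prodCongr
      ((LinearEquiv.ofBijective split hsplit).trans
        ((LinearEquiv.refl ℝ (∀ a, Cn (A.B a).dim)).prodCongr
          (LinearEquiv.ofBijective (tauLin ξ) hτ)))
  let dm : (Fin ℓ → ℝ) →ₗ[ℝ] (Fin ℓ → ℝ) := LinearMap.pi fun j => m j • LinearMap.proj j
  let dκ : (∀ a, Cn (A.B a).dim) →ₗ[ℝ] (∀ a, Cn (A.B a).dim) :=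
    LinearMap.pi fun a => κ a • LinearMap.proj a
  let D := dm.prodMap (dκ.prodMap dm)
  refine ⟨S.symm.conj D, ?_⟩
  have hC : ∀ x, S (S.symm.conj D x) = D (S x) := fun x => by
    rw [LinearEquiv.conj_apply_apply, LinearEquiv.apply_symm_apply]
    rfl
  refine ⟨fun x j => ?_, fun x a => ?_, fun x j => ?_, ?_⟩
  · have := congrArg Prod.fst (hC x)
    exact congrFun this j
  · have := congrArg (fun z => z.2.1) (hC x)
    exact congrFun this a
  · have := congrArg (fun z => z.2.2) (hC x)
    exact congrFun this j
  -- Each `m j` occurs twice, on the `dξ` block and on the `τ` block, and each `κ a` occurs with the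
  -- real dimension `2 dim B_a`; hence the common factor 2.
  · rw [LinearMap.trace_conj', LinearMap.trace_prodMap', LinearMap.trace_prodMap', trace_pi_smul,
      trace_pi_smul]
    simp only [Module.finrank_self, Nat.cast_one, mul_one, finrank_real_Cn]
    push_cast
    rw [show ∑ x, κ x * (2 * ((A.B x).dim : ℝ)) = ∑ x, 2 * (κ x * (A.B x).dim) from
      Finset.sum_congr rfl fun _ _ => by ring, ← Finset.mul_sum]
    ring

end HamiltonianAnsatz

/-! ### The change of coordinates from `𝒟 × P` to a chart of `M`. -/

namespace HamiltonianAnsatz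

set_option synthInstance.maxHeartbeats 400000

variable {ℓ : ℕ} {M : KahlerManifold.{u}} {φ : TwoTensor M.dim M.Carrier} {I : Fin ℓ → Set ℝ}
  (A : HamiltonianAnsatz.{u, v, w} M φ I)

section Coordinates

variable (c : OpenPartialHomeomorph M.Carrier (Cn M.dim)) (e : OpenPartialHomeomorph A.Q.P A.Q.E)

/-- The change of coordinates from `𝒟 × P` to `M`. -/
def coord (x : (Fin ℓ → ℝ) × A.Q.E) : Cn M.dim := c (A.Φ (x.1, e.symm x.2))

/-- The domain of the change of coordinates. -/
def coordDomain : Set ((Fin ℓ → ℝ) × A.Q.E) :=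
  {x | (x.1 ∈ univ.pi I ∧ x.2 ∈ e.target) ∧ A.Φ (x.1, e.symm x.2) ∈ c.source}

/-- The differential of the inverse of a chart of `P`. -/
def symmDeriv (q : A.Q.E) : A.Q.E →L[ℝ] A.Q.E := mfderiv 𝓘(ℝ, A.Q.E) 𝓘(ℝ, A.Q.E) e.symm q

/-- The differential of `c ∘ Φ`. -/
def chartDerivΦ (y : (Fin ℓ → ℝ) × A.Q.P) : ((Fin ℓ → ℝ) × A.Q.E) →L[ℝ] Cn M.dim :=
  (chartDeriv c (A.Φ y)).comp (A.derivΦ y)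

variable {c e}

theorem contMDiffAt_Φ (hI : ∀ j, IsOpen (I j)) {ξ : Fin ℓ → ℝ} (hξ : ξ ∈ univ.pi I) (p : A.Q.P) :
    ContMDiffAt (𝓘(ℝ, Fin ℓ → ℝ).prod 𝓘(ℝ, A.Q.E)) 𝓘(ℝ, Cn M.dim) ∞ A.Φ (ξ, p) :=
  A.Φ_smooth.contMDiffAt (((isOpen_set_pi finite_univ fun j _ => hI j).prod isOpen_univ).mem_nhds
    ⟨hξ, mem_univ p⟩)

theorem contMDiffAt_symm (he : e ∈ atlas A.Q.E A.Q.P) {q : A.Q.E} (hq : q ∈ e.target) :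
    ContMDiffAt 𝓘(ℝ, A.Q.E) 𝓘(ℝ, A.Q.E) ∞ e.symm q :=
  (contMDiffOn_symm_of_mem_maximalAtlas (IsManifold.subset_maximalAtlas he)).contMDiffAt
    (e.open_target.mem_nhds hq)

theorem contMDiffAt_prod_symm (he : e ∈ atlas A.Q.E A.Q.P) {x : (Fin ℓ → ℝ) × A.Q.E}
    (hx : x.2 ∈ e.target) :
    ContMDiffAt 𝓘(ℝ, (Fin ℓ → ℝ) × A.Q.E) (𝓘(ℝ, Fin ℓ → ℝ).prod 𝓘(ℝ, A.Q.E)) ∞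
      (fun x : (Fin ℓ → ℝ) × A.Q.E => (x.1, e.symm x.2)) x := by
  have h1 : ContMDiffAt 𝓘(ℝ, (Fin ℓ → ℝ) × A.Q.E) 𝓘(ℝ, Fin ℓ → ℝ) ∞
      (Prod.fst : (Fin ℓ → ℝ) × A.Q.E → (Fin ℓ → ℝ)) x := contDiff_fst.contDiffAt.contMDiffAt
  have h2 : ContMDiffAt 𝓘(ℝ, (Fin ℓ → ℝ) × A.Q.E) 𝓘(ℝ, A.Q.E) ∞
      (Prod.snd : (Fin ℓ → ℝ) × A.Q.E → A.Q.E) x := contDiff_snd.contDiffAt.contMDiffAt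
  exact h1.prodMk (ContMDiffAt.comp x (A.contMDiffAt_symm he hx) h2)

theorem isOpen_coordDomain (hI : ∀ j, IsOpen (I j)) (he : e ∈ atlas A.Q.E A.Q.P) :
    IsOpen (A.coordDomain c e) := by
  have hW : IsOpen {x : (Fin ℓ → ℝ) × A.Q.E | x.1 ∈ univ.pi I ∧ x.2 ∈ e.target} :=
    (isOpen_set_pi finite_univ fun j _ => hI j).prod e.open_target
  have hcont : ContinuousOn (fun x : (Fin ℓ → ℝ) × A.Q.E => A.Φ (x.1, e.symm x.2))
      {x : (Fin ℓ → ℝ) × A.Q.E | x.1 ∈ univ.pi I ∧ x.2 ∈ e.target} := by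
    intro x hx
    exact (ContinuousAt.comp (f := fun x : (Fin ℓ → ℝ) × A.Q.E => (x.1, e.symm x.2))
      (A.contMDiffAt_Φ hI hx.1 (e.symm x.2)).continuousAt
      (A.contMDiffAt_prod_symm he hx.2).continuousAt).continuousWithinAt
  exact hcont.isOpen_inter_preimage hW c.open_source

theorem contMDiffAt_coord (hI : ∀ j, IsOpen (I j)) (hc : c ∈ atlas (Cn M.dim) M.Carrier)
    (he : e ∈ atlas A.Q.E A.Q.P) {x : (Fin ℓ → ℝ) × A.Q.E} (hx : x ∈ A.coordDomain c e) :
    ContDiffAt ℝ ∞ (A.coord c e) x := by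
  have h := ContMDiffAt.comp x (A.contMDiffAt_Φ hI hx.1.1 (e.symm x.2))
    (A.contMDiffAt_prod_symm he hx.1.2)
  exact (ContMDiffAt.comp x (contMDiffAt_chart hc hx.2) h).contDiffAt

theorem fderiv_coord (hI : ∀ j, IsOpen (I j)) (hc : c ∈ atlas (Cn M.dim) M.Carrier)
    (he : e ∈ atlas A.Q.E A.Q.P) {x : (Fin ℓ → ℝ) × A.Q.E} (hx : x ∈ A.coordDomain c e)
    (u : (Fin ℓ → ℝ) × A.Q.E) :
    fderiv ℝ (A.coord c e) x u
      = A.chartDerivΦ c (x.1, e.symm x.2) (u.1, A.symmDeriv e x.2 u.2) := by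
  have h1 := A.contMDiffAt_Φ hI hx.1.1 (e.symm x.2)
  have h2 := A.contMDiffAt_prod_symm he hx.1.2
  have h3 := contMDiffAt_chart hc hx.2
  have m1 := (h1.mdifferentiableAt (by simp)).hasMFDerivAt
  have m3 := (h3.mdifferentiableAt (by simp)).hasMFDerivAt
  have ms := ((A.contMDiffAt_symm he hx.1.2).mdifferentiableAt (by simp)).hasMFDerivAt
  have mf : HasMFDerivAt 𝓘(ℝ, (Fin ℓ → ℝ) × A.Q.E) 𝓘(ℝ, Fin ℓ → ℝ)
      (Prod.fst : (Fin ℓ → ℝ) × A.Q.E → (Fin ℓ → ℝ)) x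
      (ContinuousLinearMap.fst ℝ (Fin ℓ → ℝ) A.Q.E) := hasFDerivAt_fst.hasMFDerivAt
  have mg : HasMFDerivAt 𝓘(ℝ, (Fin ℓ → ℝ) × A.Q.E) 𝓘(ℝ, A.Q.E)
      (Prod.snd : (Fin ℓ → ℝ) × A.Q.E → A.Q.E) x
      (ContinuousLinearMap.snd ℝ (Fin ℓ → ℝ) A.Q.E) := hasFDerivAt_snd.hasMFDerivAt
  have m2 := mf.prodMk (HasMFDerivAt.comp x ms mg)
  have m := HasMFDerivAt.comp x m3 (HasMFDerivAt.comp x m1 m2)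
  have hm : HasMFDerivAt 𝓘(ℝ, (Fin ℓ → ℝ) × A.Q.E) 𝓘(ℝ, Cn M.dim) (A.coord c e) x
      ((A.chartDerivΦ c (x.1, e.symm x.2)).comp
        ((ContinuousLinearMap.fst ℝ (Fin ℓ → ℝ) A.Q.E).prod
          ((A.symmDeriv e x.2).comp (ContinuousLinearMap.snd ℝ (Fin ℓ → ℝ) A.Q.E)))) := m
  have hf : HasFDerivAt (A.coord c e) ((A.chartDerivΦ c (x.1, e.symm x.2)).comp
        ((ContinuousLinearMap.fst ℝ (Fin ℓ → ℝ) A.Q.E).prod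
          ((A.symmDeriv e x.2).comp (ContinuousLinearMap.snd ℝ (Fin ℓ → ℝ) A.Q.E)))) x :=
    hasMFDerivAt_iff_hasFDerivAt.1 hm
  rw [hf.fderiv]
  rfl

theorem symmDeriv_bijective (he : e ∈ atlas A.Q.E A.Q.P) {q : A.Q.E} (hq : q ∈ e.target) :
    Function.Bijective (A.symmDeriv e q) := by
  have hsrc : ContMDiffAt 𝓘(ℝ, A.Q.E) 𝓘(ℝ, A.Q.E) ∞ e (e.symm q) :=
    (contMDiffOn_of_mem_maximalAtlas (IsManifold.subset_maximalAtlas he)).contMDiffAt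
      (e.open_source.mem_nhds (e.map_target hq))
  have h := mfderiv_comp q (hsrc.mdifferentiableAt (by simp))
    ((A.contMDiffAt_symm he hq).mdifferentiableAt (by simp))
  have h2 : (e ∘ e.symm) =ᶠ[𝓝 q] id := by
    filter_upwards [e.open_target.mem_nhds hq] with y hy using e.right_inv hy
  rw [h2.mfderiv_eq, mfderiv_id] at h
  let L : A.Q.E →L[ℝ] A.Q.E := mfderiv 𝓘(ℝ, A.Q.E) 𝓘(ℝ, A.Q.E) e (e.symm q)
  have h3 : Function.LeftInverse L (A.symmDeriv e q) := fun u =>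
    (congrArg (fun L : A.Q.E →L[ℝ] A.Q.E => L u) h).symm
  have h4 : Function.Injective (A.symmDeriv e q : A.Q.E →ₗ[ℝ] A.Q.E) := h3.injective
  exact ⟨h4, LinearMap.injective_iff_surjective.1 h4⟩

theorem chartDeriv_bijective (hc : c ∈ atlas (Cn M.dim) M.Carrier) {x : M.Carrier}
    (hx : x ∈ c.source) : Function.Bijective (chartDeriv c x) := by
  have hz := c.map_source hx
  have h1 := chartDeriv_frameDeriv hc hz
  have h2 := frameDeriv_chartDeriv hc hz
  rw [c.left_inv hx] at h1 h2
  exact ⟨Function.LeftInverse.injective h2, Function.RightInverse.surjective h1⟩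

theorem chartDerivΦ_bijective (hc : c ∈ atlas (Cn M.dim) M.Carrier) {ξ : Fin ℓ → ℝ}
    (hξ : ξ ∈ univ.pi I) {p : A.Q.P} (hp : A.Φ (ξ, p) ∈ c.source) :
    Function.Bijective (A.chartDerivΦ c (ξ, p)) :=
  (chartDeriv_bijective hc hp).comp (A.derivΦ_bijective hξ p)

theorem fderiv_coord_bijective (hI : ∀ j, IsOpen (I j)) (hc : c ∈ atlas (Cn M.dim) M.Carrier)
    (he : e ∈ atlas A.Q.E A.Q.P) {x : (Fin ℓ → ℝ) × A.Q.E} (hx : x ∈ A.coordDomain c e) :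
    Function.Bijective (fderiv ℝ (A.coord c e) x) := by
  have h : ⇑(fderiv ℝ (A.coord c e) x)
      = A.chartDerivΦ c (x.1, e.symm x.2) ∘ Prod.map id (A.symmDeriv e x.2) :=
    funext fun u => A.fderiv_coord hI hc he hx u
  rw [h]
  exact (A.chartDerivΦ_bijective hc hx.1.1 hx.2).comp
    (Function.bijective_id.prodMap (A.symmDeriv_bijective he hx.1.2))

/-- The coordinate frame undoes the differential of the chart, so the chart drops out and the Ansatz
formulas apply directly. -/
theorem localForm_chartDerivΦ (hc : c ∈ atlas (Cn M.dim) M.Carrier) (β : TwoTensor M.dim M.Carrier)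
    {y : (Fin ℓ → ℝ) × A.Q.P} (hy : A.Φ y ∈ c.source) (u w : (Fin ℓ → ℝ) × A.Q.E) :
    localForm c β (c (A.Φ y)) (A.chartDerivΦ c y u) (A.chartDerivΦ c y w)
      = formAt β (A.Φ y) (A.derivΦ y u) (A.derivΦ y w) := by
  have h := frameDeriv_chartDeriv hc (c.map_source hy)
  rw [c.left_inv hy] at h
  rw [localForm_apply, c.left_inv hy, chartDerivΦ, ContinuousLinearMap.comp_apply,
    ContinuousLinearMap.comp_apply, h, h]

theorem localForm_g_eq (hc : c ∈ atlas (Cn M.dim) M.Carrier) {ξ : Fin ℓ → ℝ}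
    (hξ : ξ ∈ univ.pi I) {p : A.Q.P} (hp : A.Φ (ξ, p) ∈ c.source)
    (u w : (Fin ℓ → ℝ) × A.Q.E) :
    localForm c M.g (c (A.Φ (ξ, p))) (A.chartDerivΦ c (ξ, p) u) (A.chartDerivΦ c (ξ, p) w)
      = ∑ a, A.ε a * pnc ξ (A.η a) * A.baseMet a p u.2 w.2
        + fibreMetric A.profile ξ u.1 (A.conn p u.2) w.1 (A.conn p w.2) := by
  rw [A.localForm_chartDerivΦ hc M.g hp, A.metric_formAt hξ]

theorem localForm_kahlerForm_eq (hc : c ∈ atlas (Cn M.dim) M.Carrier) {ξ : Fin ℓ → ℝ}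
    (hξ : ξ ∈ univ.pi I) {p : A.Q.P} (hp : A.Φ (ξ, p) ∈ c.source)
    (u w : (Fin ℓ → ℝ) × A.Q.E) :
    localForm c M.kahlerForm (c (A.Φ (ξ, p))) (A.chartDerivΦ c (ξ, p) u)
        (A.chartDerivΦ c (ξ, p) w)
      = ∑ a, A.ε a * pnc ξ (A.η a) * A.baseOm a p u.2 w.2
        + fibreForm ξ u.1 (A.conn p u.2) w.1 (A.conn p w.2) := by
  rw [A.localForm_chartDerivΦ hc M.kahlerForm hp, A.kahlerForm_formAt hξ]

end Coordinates

end HamiltonianAnsatz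

/-! ### Eigenvalues of `L_{∇σ_1} g` and the Laplacian of `σ_1`. -/

theorem hasDerivAt_pc {N : ℕ} (B : Fin N → KahlerManifold.{v}) {η : Fin N → ℝ} {t : ℝ}
    (ht : ∀ a, t ≠ η a) :
    HasDerivAt (pc B η) (pc B η t * ∑ a, (B a).dim * (t - η a)⁻¹) t := by
  have h := HasDerivAt.fun_finsetProd (u := Finset.univ) (x := t)
    (f := fun (a : Fin N) (t : ℝ) => (t - η a) ^ (B a).dim)
    (fun a _ => ((hasDerivAt_id t).sub_const (η a)).fun_pow (B a).dim)
  refine h.congr_deriv ?_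
  rw [Finset.mul_sum]
  refine Finset.sum_congr rfl fun a _ => ?_
  have h0 : t - η a ≠ 0 := sub_ne_zero.2 (ht a)
  have : pc B η t = (t - η a) ^ (B a).dim * ∏ k ∈ Finset.univ.erase a, (t - η k) ^ (B k).dim :=
    (Finset.mul_prod_erase Finset.univ (fun k => (t - η k) ^ (B k).dim) (Finset.mem_univ a)).symm
  rw [this]
  -- A zero-dimensional factor is treated apart, because the exponent `dim - 1` is truncated there.
  rcases Nat.eq_zero_or_pos (B a).dim with hd | hd
  · simp [hd]
  · obtain ⟨m, hm⟩ := Nat.exists_eq_succ_of_ne_zero hd.ne'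
    simp only [hm, Nat.succ_eq_add_one, Nat.add_sub_cancel, id_eq, smul_eq_mul, pow_succ]
    field_simp

theorem contDiff_pc {N : ℕ} (B : Fin N → KahlerManifold.{v}) (η : Fin N → ℝ) :
    ContDiff ℝ ∞ (pc B η) :=
  contDiff_prod fun _ _ => (contDiff_id.sub contDiff_const).pow _

namespace HamiltonianAnsatz

set_option synthInstance.maxHeartbeats 400000

variable {ℓ : ℕ} {M : KahlerManifold.{u}} {φ : TwoTensor M.dim M.Carrier} {I : Fin ℓ → Set ℝ}
  (A : HamiltonianAnsatz.{u, v, w} M φ I)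

/-- The derivatives of the functions `F_j / p_c` at the point `ξ`. -/
def profileDeriv (ξ : Fin ℓ → ℝ) (j : Fin ℓ) : ℝ := deriv (A.profile j) (ξ j)

/-- The eigenvalues of the Hessian of `σ_1` on the base. -/
def baseEigen (ξ : Fin ℓ → ℝ) (a : Fin A.N) : ℝ :=
  ∑ j, gradComp A.profile ξ j * (ξ j - A.η a)⁻¹

/-- The eigenvalues of the Hessian of `σ_1` on the fibres. -/
def fibreEigen (ξ : Fin ℓ → ℝ) (j : Fin ℓ) : ℝ :=
  hessEigen A.profile (A.profileDeriv ξ) ξ j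

/-- The Laplacian of `σ_1`. -/
def laplacian (ξ : Fin ℓ → ℝ) : ℝ :=
  ∑ j, deriv (A.F j) (ξ j) / (pc A.B A.η (ξ j) * Δ ξ j)

theorem contDiffAt_F (hI : ∀ j, IsOpen (I j)) {j : Fin ℓ} {t : ℝ} (ht : t ∈ I j) :
    ContDiffAt ℝ ∞ (A.F j) t := (A.F_smooth j).contDiffAt ((hI j).mem_nhds ht)

theorem contDiffAt_profile (hI : ∀ j, IsOpen (I j)) {j : Fin ℓ} {t : ℝ} (ht : t ∈ I j) :
    ContDiffAt ℝ ∞ (A.profile j) t :=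
  (A.contDiffAt_F hI ht).div (contDiff_pc A.B A.η).contDiffAt (A.pc_ne_zero ht)

theorem hasDerivAt_profile (hI : ∀ j, IsOpen (I j)) {ξ : Fin ℓ → ℝ} (hξ : ξ ∈ univ.pi I)
    (j : Fin ℓ) : HasDerivAt (A.profile j) (A.profileDeriv ξ j) (ξ j) :=
  ((A.contDiffAt_profile hI (hξ j (mem_univ j))).differentiableAt (by simp)).hasDerivAt

/-- From `F_j = q_j p_c`: the logarithmic derivative of `p_c` is the share of the base in the
Laplacian. -/
theorem deriv_F_div (hI : ∀ j, IsOpen (I j)) {ξ : Fin ℓ → ℝ} (hξ : ξ ∈ univ.pi I)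
    (hinj : Function.Injective ξ) (j : Fin ℓ) :
    deriv (A.F j) (ξ j) / (pc A.B A.η (ξ j) * Δ ξ j) = A.profileDeriv ξ j / Δ ξ j
      + gradComp A.profile ξ j * ∑ a, ((A.B a).dim : ℝ) * (ξ j - A.η a)⁻¹ := by
  have hF := ((A.contDiffAt_F hI (hξ j (mem_univ j))).differentiableAt (by simp)).hasDerivAt
  have hp := hasDerivAt_pc A.B (fun a => A.ne_η hξ a j)
  have hp0 := A.pc_ne_zero (hξ j (mem_univ j))
  have hd : A.profileDeriv ξ j = _ := (hF.div hp hp0).deriv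
  have hΔ := Δ_ne_zero hinj j
  rw [hd, gradComp, profile]
  field_simp
  ring

/-- The fibre eigenvalues contribute `q_j'/Δ(ξ_j)` and the base eigenvalues contribute `Y_j
p_c'/p_c`; together they are `F_j'/(p_c Δ(ξ_j))`. -/
theorem half_trace_eq_laplacian (hI : ∀ j, IsOpen (I j)) {ξ : Fin ℓ → ℝ} (hξ : ξ ∈ univ.pi I)
    (hinj : Function.Injective ξ) :
    ∑ j, A.fibreEigen ξ j + ∑ a, A.baseEigen ξ a * (A.B a).dim = A.laplacian ξ := by
  simp only [fibreEigen, sum_hessEigen, baseEigen, laplacian, Finset.sum_mul]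
  rw [Finset.sum_comm, ← Finset.sum_add_distrib]
  refine Finset.sum_congr rfl fun j _ => ?_
  rw [A.deriv_F_div hI hξ hinj, Finset.mul_sum]
  congr 1
  exact Finset.sum_congr rfl fun _ _ => by ring

/-- The Lie derivative of the metric along `grad σ_1`. -/
def lieMetric (ξ : Fin ℓ → ℝ) (p : A.Q.P) (u w : (Fin ℓ → ℝ) × A.Q.E) : ℝ :=
  ∑ a, A.baseEigen ξ a * (A.ε a * pnc ξ (A.η a) * A.baseMet a p u.2 w.2)
    + ∑ j, A.fibreEigen ξ j * ((gradComp A.profile ξ j)⁻¹ * (u.1 j * w.1 j)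
      + gradComp A.profile ξ j * (tau ξ (A.conn p u.2) j * tau ξ (A.conn p w.2) j))

/-- The Lie derivative of the Kähler form along `grad σ_1`. -/
def lieForm (ξ : Fin ℓ → ℝ) (p : A.Q.P) (u w : (Fin ℓ → ℝ) × A.Q.E) : ℝ :=
  ∑ a, A.baseEigen ξ a * (A.ε a * pnc ξ (A.η a) * A.baseOm a p u.2 w.2)
    + ∑ j, A.fibreEigen ξ j * (u.1 j * tau ξ (A.conn p w.2) j - w.1 j * tau ξ (A.conn p u.2) j)

/-- The endomorphism of the Lie derivatives of `g` and `ω` along `grad σ_1`, in a chart. -/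
theorem exists_hessian (hI : ∀ j, IsOpen (I j)) {c : OpenPartialHomeomorph M.Carrier (Cn M.dim)}
    (hc : c ∈ atlas (Cn M.dim) M.Carrier) {ξ : Fin ℓ → ℝ} (hξ : ξ ∈ univ.pi I)
    (hinj : Function.Injective ξ) {p : A.Q.P} (hp : A.Φ (ξ, p) ∈ c.source) :
    ∃ C : Cn M.dim →L[ℝ] Cn M.dim,
      (∀ u w, localForm c M.g (c (A.Φ (ξ, p))) (C (A.chartDerivΦ c (ξ, p) u))
        (A.chartDerivΦ c (ξ, p) w) = A.lieMetric ξ p u w) ∧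
      (∀ u w, localForm c M.kahlerForm (c (A.Φ (ξ, p))) (C (A.chartDerivΦ c (ξ, p) u))
        (A.chartDerivΦ c (ξ, p) w) = A.lieForm ξ p u w) ∧
      (∀ v, C (Complex.I • v) = Complex.I • C v) ∧
      (1 / 2) * LinearMap.trace ℝ (Cn M.dim) (C : Cn M.dim →ₗ[ℝ] Cn M.dim) = A.laplacian ξ := by
  obtain ⟨D, hD1, hD2, hD3, hDt⟩ := A.exists_diagonal hξ p (A.fibreEigen ξ) (A.baseEigen ξ)
  have hb := A.chartDerivΦ_bijective hc hξ hp
  set z := c (A.Φ (ξ, p)) with hz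
  set T := A.chartDerivΦ c (ξ, p) with hT
  let L : ((Fin ℓ → ℝ) × A.Q.E) ≃ₗ[ℝ] Cn M.dim :=
    LinearEquiv.ofBijective (T : ((Fin ℓ → ℝ) × A.Q.E) →ₗ[ℝ] Cn M.dim) hb
  have hL : ∀ u, L u = T u := fun u => rfl
  let C : Cn M.dim →L[ℝ] Cn M.dim := LinearMap.toContinuousLinearMap (L.conj D)
  have hC : ∀ u, C (T u) = T (D u) := fun u => by
    change L.conj D (L u) = L (D u)
    rw [LinearEquiv.conj_apply_apply, LinearEquiv.symm_apply_apply]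
  have g1 : ∀ u w, localForm c M.g z (T (D u)) (T w) = A.lieMetric ξ p u w := by
    intro u w
    rw [A.localForm_g_eq hc hξ hp, lieMetric, fibreMetric, ← Finset.sum_add_distrib]
    congr 1
    · refine Finset.sum_congr rfl fun a _ => ?_
      simp only [baseMet, hD2, map_smul, smul_apply, smul_eq_mul]
      ring
    · refine Finset.sum_congr rfl fun j _ => ?_
      rw [hD1, hD3]
      ring
  have g2 : ∀ u w, localForm c M.g z (T u) (T (D w)) = A.lieMetric ξ p u w := by
    intro u w
    rw [A.localForm_g_eq hc hξ hp, lieMetric, fibreMetric, ← Finset.sum_add_distrib]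
    congr 1
    · refine Finset.sum_congr rfl fun a _ => ?_
      simp only [baseMet, hD2, map_smul, smul_eq_mul]
      ring
    · refine Finset.sum_congr rfl fun j _ => ?_
      rw [hD1, hD3]
      ring
  have w1 : ∀ u w, localForm c M.kahlerForm z (T (D u)) (T w) = A.lieForm ξ p u w := by
    intro u w
    rw [A.localForm_kahlerForm_eq hc hξ hp, lieForm, fibreForm]
    congr 1
    · refine Finset.sum_congr rfl fun a _ => ?_
      simp only [baseOm, hD2, map_smul, smul_apply, smul_eq_mul]
      ring
    · refine Finset.sum_congr rfl fun j _ => ?_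
      rw [hD1, hD3]
      ring
  have w2 : ∀ u w, localForm c M.kahlerForm z (T u) (T (D w)) = A.lieForm ξ p u w := by
    intro u w
    rw [A.localForm_kahlerForm_eq hc hξ hp, lieForm, fibreForm]
    congr 1
    · refine Finset.sum_congr rfl fun a _ => ?_
      simp only [baseOm, hD2, map_smul, smul_eq_mul]
      ring
    · refine Finset.sum_congr rfl fun j _ => ?_
      rw [hD1, hD3]
      ring
  have hzt : z ∈ c.target := c.map_source hp
  have hω : ∀ u w, localForm c M.kahlerForm z u w = localForm c M.g z (Complex.I • u) w :=
    fun u w => localForm_fundamentalForm hc hzt M.g u w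
  have hH := M.isHermitianForm_localForm hc hzt
  refine ⟨C, fun u w => by rw [hC, g1], fun u w => by rw [hC, w1], fun v => ?_, ?_⟩
  · refine hH.eq_of_forall fun w' => ?_
    obtain ⟨u, rfl⟩ := hb.2 v
    obtain ⟨w, rfl⟩ := hb.2 w'
    obtain ⟨u', hu'⟩ := hb.2 (Complex.I • T u)
    -- `D` can be moved between the slots both of `g` and of `ω = g(i·, ·)`; moving it across once
    -- with each form shows that it commutes with `i`.
    rw [← hu', hC, g1, ← g2, hu', ← hω, w2, hC, ← hω, w1]
  · have ht : LinearMap.trace ℝ (Cn M.dim) (C : Cn M.dim →ₗ[ℝ] Cn M.dim)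
        = LinearMap.trace ℝ (Cn M.dim) (L.conj D) := rfl
    rw [ht, LinearMap.trace_conj', hDt, ← A.half_trace_eq_laplacian hI hξ hinj]
    ring

end HamiltonianAnsatz

/-! ### Lie derivatives of `g` and `ω` along `∇σ_1`. -/

namespace HamiltonianAnsatz

set_option synthInstance.maxHeartbeats 400000

variable {ℓ : ℕ} {M : KahlerManifold.{u}} {φ : TwoTensor M.dim M.Carrier} {I : Fin ℓ → Set ℝ}
  (A : HamiltonianAnsatz.{u, v, w} M φ I)

theorem contDiffAt_gradComp (hI : ∀ j, IsOpen (I j)) {ξ : Fin ℓ → ℝ} (hξ : ξ ∈ univ.pi I)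
    (hinj : Function.Injective ξ) : ContDiffAt ℝ ∞ (gradComp A.profile) ξ := by
  rw [contDiffAt_pi]
  intro j
  have hcoord : ∀ i, ContDiffAt ℝ ∞ (fun ξ : Fin ℓ → ℝ => ξ i) ξ := fun i =>
    (contDiff_apply ℝ ℝ i).contDiffAt
  have h1 : ContDiffAt ℝ ∞ (fun ξ : Fin ℓ → ℝ => A.profile j (ξ j)) ξ :=
    ContDiffAt.comp ξ (A.contDiffAt_profile hI (hξ j (mem_univ j))) (hcoord j)
  have h2 : ContDiffAt ℝ ∞ (fun ξ : Fin ℓ → ℝ => Δ ξ j) ξ :=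
    contDiffAt_prod fun i _ => (hcoord j).sub (hcoord i)
  exact h1.div h2 (Δ_ne_zero hinj j)

/-- The gradient of `σ_1` on `𝒟 × P`, in a chart of `P`. -/
def gradField (x : (Fin ℓ → ℝ) × A.Q.E) : (Fin ℓ → ℝ) × A.Q.E := (gradComp A.profile x.1, 0)

theorem contDiffAt_gradField (hI : ∀ j, IsOpen (I j)) {x : (Fin ℓ → ℝ) × A.Q.E}
    (hξ : x.1 ∈ univ.pi I) (hinj : Function.Injective x.1) : ContDiffAt ℝ ∞ A.gradField x :=
  (ContDiffAt.comp x (A.contDiffAt_gradComp hI hξ hinj) contDiffAt_fst).prodMk contDiffAt_const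

theorem exists_hasFDerivAt_gradField (hI : ∀ j, IsOpen (I j)) {x : (Fin ℓ → ℝ) × A.Q.E}
    (hξ : x.1 ∈ univ.pi I) (hinj : Function.Injective x.1) :
    ∃ y' : ((Fin ℓ → ℝ) × A.Q.E) →L[ℝ] ((Fin ℓ → ℝ) × A.Q.E), HasFDerivAt A.gradField y' x ∧
      ∀ u, y' u = (gradCompDeriv A.profile (A.profileDeriv x.1) x.1 u.1, 0) := by
  have h1 : HasFDerivAt (gradComp A.profile) (ContinuousLinearMap.pi fun j => _) x.1 :=
    hasFDerivAt_pi.2 fun j => hasFDerivAt_gradComp hinj (A.hasDerivAt_profile hI hξ j)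
  have h2 := (h1.comp x hasFDerivAt_fst).prodMk (hasFDerivAt_const (0 : A.Q.E) x)
  refine ⟨_, h2, fun u => ?_⟩
  refine Prod.ext ?_ rfl
  ext j
  simp [gradCompDeriv]

theorem hasDerivAt_base (ξ : Fin ℓ → ℝ) (hξ : ξ ∈ univ.pi I) (b : Fin A.N → ℝ) :
    HasDerivAt (fun t : ℝ => ∑ a, A.ε a * pnc (ξ + t • gradComp A.profile ξ) (A.η a) * b a)
      (∑ a, A.baseEigen ξ a * (A.ε a * pnc ξ (A.η a) * b a)) 0 := by
  refine (HasDerivAt.fun_sum fun a _ => ((hasDerivAt_pnc (gradComp A.profile ξ)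
    (fun j => A.ne_η hξ a j)).const_mul (A.ε a)).mul_const (b a)).congr_deriv ?_
  refine Finset.sum_congr rfl fun a _ => ?_
  rw [baseEigen]
  ring

section Pullback

variable {c : OpenPartialHomeomorph M.Carrier (Cn M.dim)} {e : OpenPartialHomeomorph A.Q.P A.Q.E}

/-- On `𝒟 × P` the gradient field has no component along `P`, so only the `ξ`-dependent coefficients
are differentiated and the base and connection data stay frozen. `lie_pullback` then transports the
result to the chart. -/
theorem lie_g (hI : ∀ j, IsOpen (I j)) (hinj : ∀ ξ ∈ univ.pi I, Function.Injective ξ)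
    (hc : c ∈ atlas (Cn M.dim) M.Carrier) (he : e ∈ atlas A.Q.E A.Q.P)
    {x : (Fin ℓ → ℝ) × A.Q.E} (hx : x ∈ A.coordDomain c e) {Y : Cn M.dim → Cn M.dim}
    (hY : DifferentiableAt ℝ Y (A.coord c e x))
    (hYx : ∀ᶠ x' in 𝓝 x, Y (A.coord c e x') = fderiv ℝ (A.coord c e) x' (A.gradField x'))
    (u w : (Fin ℓ → ℝ) × A.Q.E) :
    fderiv ℝ (localForm c M.g) (A.coord c e x) (Y (A.coord c e x))
        (fderiv ℝ (A.coord c e) x u) (fderiv ℝ (A.coord c e) x w)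
      + localForm c M.g (A.coord c e x) (fderiv ℝ Y (A.coord c e x) (fderiv ℝ (A.coord c e) x u))
        (fderiv ℝ (A.coord c e) x w)
      + localForm c M.g (A.coord c e x) (fderiv ℝ (A.coord c e) x u)
        (fderiv ℝ Y (A.coord c e x) (fderiv ℝ (A.coord c e) x w))
      = A.lieMetric x.1 (e.symm x.2) (u.1, A.symmDeriv e x.2 u.2)
          (w.1, A.symmDeriv e x.2 w.2) := by
  obtain ⟨y', hy', hy'u⟩ := A.exists_hasFDerivAt_gradField hI hx.1.1 (hinj _ hx.1.1)
  have hz : A.coord c e x ∈ c.target := c.map_source hx.2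
  refine lie_pullback (y := A.gradField) (y' := y')
    (R := fun x u w => ∑ a, A.ε a * pnc x.1 (A.η a) * A.baseMet a (e.symm x.2)
        (A.symmDeriv e x.2 u.2) (A.symmDeriv e x.2 w.2)
      + fibreMetric A.profile x.1 u.1 (A.conn (e.symm x.2) (A.symmDeriv e x.2 u.2))
        w.1 (A.conn (e.symm x.2) (A.symmDeriv e x.2 w.2)))
    (r := fun u w => A.lieMetric x.1 (e.symm x.2) (u.1, A.symmDeriv e x.2 u.2)
          (w.1, A.symmDeriv e x.2 w.2))
    (A.contMDiffAt_coord hI hc he hx)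
    ((M.contDiffAt_localForm_g hc hz).differentiableAt (by simp)) hY hy' hYx ?_ ?_ u w
  · filter_upwards [(A.isOpen_coordDomain hI he).mem_nhds hx] with x' hx' u w
    rw [A.fderiv_coord hI hc he hx', A.fderiv_coord hI hc he hx']
    exact A.localForm_g_eq hc hx'.1.1 hx'.2 _ _
  · intro u w
    have h2 : ∀ t : ℝ, (x + t • A.gradField x).2 = x.2 := fun t => by simp [gradField]
    have h1 : ∀ t : ℝ, (x + t • A.gradField x).1 = x.1 + t • gradComp A.profile x.1 :=
      fun t => rfl
    simp only [h1, h2, hy'u, map_zero]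
    refine ((A.hasDerivAt_base x.1 hx.1.1 _).add (lie_fibreMetric (hinj _ hx.1.1)
      (A.hasDerivAt_profile hI hx.1.1)
      (fun j => A.profile_ne_zero (hx.1.1 j (mem_univ j))) u.1 _ w.1 _)).congr_deriv ?_
    simp only [lieMetric, baseMet, fibreEigen, map_zero, zero_apply, mul_zero,
      Finset.sum_const_zero, zero_add]
    ring

/-- The eigenvalues that occur here are the same as for the metric, which is what makes `∇σ_1`
holomorphic. -/
theorem lie_kahlerForm (hI : ∀ j, IsOpen (I j)) (hinj : ∀ ξ ∈ univ.pi I, Function.Injective ξ)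
    (hc : c ∈ atlas (Cn M.dim) M.Carrier) (he : e ∈ atlas A.Q.E A.Q.P)
    {x : (Fin ℓ → ℝ) × A.Q.E} (hx : x ∈ A.coordDomain c e) {Y : Cn M.dim → Cn M.dim}
    (hY : DifferentiableAt ℝ Y (A.coord c e x))
    (hYx : ∀ᶠ x' in 𝓝 x, Y (A.coord c e x') = fderiv ℝ (A.coord c e) x' (A.gradField x'))
    (u w : (Fin ℓ → ℝ) × A.Q.E) :
    fderiv ℝ (localForm c M.kahlerForm) (A.coord c e x) (Y (A.coord c e x))
        (fderiv ℝ (A.coord c e) x u) (fderiv ℝ (A.coord c e) x w)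
      + localForm c M.kahlerForm (A.coord c e x)
        (fderiv ℝ Y (A.coord c e x) (fderiv ℝ (A.coord c e) x u)) (fderiv ℝ (A.coord c e) x w)
      + localForm c M.kahlerForm (A.coord c e x) (fderiv ℝ (A.coord c e) x u)
        (fderiv ℝ Y (A.coord c e x) (fderiv ℝ (A.coord c e) x w))
      = A.lieForm x.1 (e.symm x.2) (u.1, A.symmDeriv e x.2 u.2)
          (w.1, A.symmDeriv e x.2 w.2) := by
  obtain ⟨y', hy', hy'u⟩ := A.exists_hasFDerivAt_gradField hI hx.1.1 (hinj _ hx.1.1)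
  have hz : A.coord c e x ∈ c.target := c.map_source hx.2
  refine lie_pullback (y := A.gradField) (y' := y')
    (R := fun x u w => ∑ a, A.ε a * pnc x.1 (A.η a) * A.baseOm a (e.symm x.2)
        (A.symmDeriv e x.2 u.2) (A.symmDeriv e x.2 w.2)
      + fibreForm x.1 u.1 (A.conn (e.symm x.2) (A.symmDeriv e x.2 u.2))
        w.1 (A.conn (e.symm x.2) (A.symmDeriv e x.2 w.2)))
    (r := fun u w => A.lieForm x.1 (e.symm x.2) (u.1, A.symmDeriv e x.2 u.2)
          (w.1, A.symmDeriv e x.2 w.2))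
    (A.contMDiffAt_coord hI hc he hx) (M.differentiableAt_localForm_kahlerForm hc hz)
    hY hy' hYx ?_ ?_ u w
  · filter_upwards [(A.isOpen_coordDomain hI he).mem_nhds hx] with x' hx' u w
    rw [A.fderiv_coord hI hc he hx', A.fderiv_coord hI hc he hx']
    exact A.localForm_kahlerForm_eq hc hx'.1.1 hx'.2 _ _
  · intro u w
    have h2 : ∀ t : ℝ, (x + t • A.gradField x).2 = x.2 := fun t => by simp [gradField]
    have h1 : ∀ t : ℝ, (x + t • A.gradField x).1 = x.1 + t • gradComp A.profile x.1 :=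
      fun t => rfl
    simp only [h1, h2, hy'u, map_zero]
    refine ((A.hasDerivAt_base x.1 hx.1.1 _).add (lie_fibreForm (q := A.profile)
      (q' := A.profileDeriv x.1) (hinj _ hx.1.1) u.1 _ w.1 _)).congr_deriv ?_
    simp only [lieForm, baseOm, fibreEigen, map_zero, zero_apply, mul_zero,
      Finset.sum_const_zero, zero_add]
    ring

end Pullback

end HamiltonianAnsatz

/-! ### The soliton equation contracted with `K_1`. -/

/-- A smooth map that is a local diffeomorphism on an open set has smooth local inverses. -/
theorem exists_smooth_local_inverse {E F : Type*} [NormedAddCommGroup E] [NormedSpace ℝ E]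
    [FiniteDimensional ℝ E] [NormedAddCommGroup F] [NormedSpace ℝ F] [FiniteDimensional ℝ F]
    {Ψ : E → F} {V : Set E} (hV : IsOpen V) (hΨ : ∀ x ∈ V, ContDiffAt ℝ ∞ Ψ x)
    (hb : ∀ x ∈ V, Function.Bijective (fderiv ℝ Ψ x)) {x₀ : E} (hx₀ : x₀ ∈ V) :
    ∃ Θ : F → E, Θ (Ψ x₀) = x₀ ∧ ∀ᶠ z in 𝓝 (Ψ x₀), Θ z ∈ V ∧ Ψ (Θ z) = z ∧
      ContDiffAt ℝ ∞ Θ z ∧ ∀ᶠ x in 𝓝 (Θ z), Θ (Ψ x) = x := by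
  have : CompleteSpace E := FiniteDimensional.complete ℝ E
  let L : ∀ x ∈ V, E ≃L[ℝ] F := fun x hx =>
    (LinearEquiv.ofBijective (fderiv ℝ Ψ x : E →ₗ[ℝ] F) (hb x hx)).toContinuousLinearEquiv
  have hL : ∀ x (hx : x ∈ V), HasFDerivAt Ψ (L x hx : E →L[ℝ] F) x := fun x hx => by
    have : (L x hx : E →L[ℝ] F) = fderiv ℝ Ψ x := by ext v; rfl
    rw [this]
    exact ((hΨ x hx).differentiableAt (by simp)).hasFDerivAt
  let Ph := (hΨ x₀ hx₀).toOpenPartialHomeomorph Ψ (hL x₀ hx₀) (by simp)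
  have hPh : ⇑Ph = Ψ := rfl
  have hsrc : x₀ ∈ Ph.source := (hΨ x₀ hx₀).mem_toOpenPartialHomeomorph_source (hL x₀ hx₀) (by simp)
  have htgt : Ψ x₀ ∈ Ph.target := Ph.map_source hsrc
  have hinv : Ph.symm (Ψ x₀) = x₀ := Ph.left_inv hsrc
  refine ⟨Ph.symm, hinv, ?_⟩
  have hU : IsOpen (Ph.target ∩ Ph.symm ⁻¹' V) := Ph.isOpen_inter_preimage_symm hV
  -- The inverse is smooth at every nearby point, not only at `Ψ x₀`, because the differential is
  -- invertible throughout `V`.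
  filter_upwards [hU.mem_nhds ⟨htgt, by rw [mem_preimage, hinv]; exact hx₀⟩] with z hz
  refine ⟨hz.2, Ph.right_inv hz.1, ?_, ?_⟩
  · exact Ph.contDiffAt_symm hz.1 (hL _ hz.2) (hΨ _ hz.2)
  · filter_upwards [Ph.open_source.mem_nhds (Ph.map_target hz.1)] with x hx using Ph.left_inv hx

namespace HamiltonianAnsatz

set_option synthInstance.maxHeartbeats 400000

variable {ℓ : ℕ} {M : KahlerManifold.{u}} {φ : TwoTensor M.dim M.Carrier} {I : Fin ℓ → Set ℝ}
  (A : HamiltonianAnsatz.{u, v, w} M φ I)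

/-- The components `Y_j` cancel the metric coefficients `1 / Y_j`, leaving `dσ_1`; this identifies
the field as `∇σ_1`. -/
theorem localForm_gradField (hI : ∀ j, IsOpen (I j))
    (hinj : ∀ ξ ∈ univ.pi I, Function.Injective ξ)
    {c : OpenPartialHomeomorph M.Carrier (Cn M.dim)} {e : OpenPartialHomeomorph A.Q.P A.Q.E}
    (hc : c ∈ atlas (Cn M.dim) M.Carrier) (he : e ∈ atlas A.Q.E A.Q.P)
    {x : (Fin ℓ → ℝ) × A.Q.E} (hx : x ∈ A.coordDomain c e) (u : (Fin ℓ → ℝ) × A.Q.E) :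
    localForm c M.g (A.coord c e x) (fderiv ℝ (A.coord c e) x (A.gradField x))
      (fderiv ℝ (A.coord c e) x u) = ∑ j, u.1 j := by
  rw [A.fderiv_coord hI hc he hx, A.fderiv_coord hI hc he hx]
  refine (A.localForm_g_eq hc hx.1.1 hx.2 _ _).trans ?_
  have h0 : ∀ j, tau x.1 0 j = 0 := fun j => by simp [tau]
  simp only [gradField, baseMet, fibreMetric, map_zero, zero_apply, mul_zero,
    Finset.sum_const_zero, zero_add, h0, zero_mul, add_zero]
  refine Finset.sum_congr rfl fun j _ => ?_
  have hY : gradComp A.profile x.1 j ≠ 0 :=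
    div_ne_zero (A.profile_ne_zero (hx.1.1 j (mem_univ j))) (Δ_ne_zero (hinj _ hx.1.1) j)
  field_simp

/-- In a chart of `M`, the field `aJK_1` is `-a grad σ_1`. -/
theorem localField_eq (hI : ∀ j, IsOpen (I j)) (hinj : ∀ ξ ∈ univ.pi I, Function.Injective ξ)
    {c : OpenPartialHomeomorph M.Carrier (Cn M.dim)} {e : OpenPartialHomeomorph A.Q.P A.Q.E}
    (hc : c ∈ atlas (Cn M.dim) M.Carrier) (he : e ∈ atlas A.Q.E A.Q.P)
    {K : ∀ x, M.T x} (hK : A.IsHamiltonianField 1 K) (a : ℝ)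
    {x : (Fin ℓ → ℝ) × A.Q.E} (hx : x ∈ A.coordDomain c e) :
    localField c (fun x => a • J x (K x)) (A.coord c e x)
      = (-a) • fderiv ℝ (A.coord c e) x (A.gradField x) := by
  let Kc : M.Carrier → Cn M.dim := K
  set y := A.Φ (x.1, e.symm x.2) with hy
  have hz : A.coord c e x ∈ c.target := c.map_source hx.2
  have hcs : c.symm (A.coord c e x) = y := c.left_inv hx.2
  have h1 : localField c (fun x => a • J x (K x)) (A.coord c e x)
      = chartDeriv c (c.symm (A.coord c e x))
        (a • (Complex.I • Kc (c.symm (A.coord c e x)))) := rfl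
  -- Tested against `g`: `g(JK_1, ·) = ω(K_1, ·) = -dσ_1`.
  have h2 : Complex.I • chartDeriv c y (Kc y)
      = -fderiv ℝ (A.coord c e) x (A.gradField x) := by
    refine (M.isHermitianForm_localForm hc hz).eq_of_forall fun w => ?_
    obtain ⟨u, rfl⟩ := (A.fderiv_coord_bijective hI hc he hx).2 w
    rw [map_neg, neg_apply, A.localForm_gradField hI hinj hc he hx,
      ← localForm_fundamentalForm hc hz, A.fderiv_coord hI hc he hx, localForm_apply, hcs,
      chartDerivΦ, ContinuousLinearMap.comp_apply]
    have hf := frameDeriv_chartDeriv hc hz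
    rw [hcs] at hf
    rw [hf, hf, ← dσ_one x.1]
    exact hK x.1 hx.1.1 (e.symm x.2) _
  rw [h1, hcs, map_smul, chartDeriv_I hc hx.2, h2, smul_neg, neg_smul]

set_option maxHeartbeats 1000000 in
/-- The soliton equation contracted with `K_1`: the function `Δσ_1 + a |∇σ_1|² + 2 λ σ_1` is
locally constant. -/
theorem hasFDerivAt_soliton (hI : ∀ j, IsOpen (I j))
    (hinj : ∀ ξ ∈ univ.pi I, Function.Injective ξ) {K : ∀ x, M.T x}
    (hK : A.IsHamiltonianField 1 K) {a lam : ℝ}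
    (hsol : IsGradientKahlerRicciSoliton M (fun x => a • J x (K x)) lam)
    {ξ₀ : Fin ℓ → ℝ} (hξ₀ : ξ₀ ∈ univ.pi I) (p : A.Q.P) :
    HasFDerivAt (fun ξ => A.laplacian ξ + a * ∑ j, gradComp A.profile ξ j
      + 2 * lam * ∑ j, ξ j) (0 : (Fin ℓ → ℝ) →L[ℝ] ℝ) ξ₀ := by
  set c := chartAt (Cn M.dim) (A.Φ (ξ₀, p)) with hcdef
  set e := chartAt A.Q.E p with hedef
  have hc : c ∈ atlas (Cn M.dim) M.Carrier := chart_mem_atlas _ _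
  have he : e ∈ atlas A.Q.E A.Q.P := chart_mem_atlas _ _
  have hep : e.symm (e p) = p := e.left_inv (mem_chart_source _ _)
  set x₀ : (Fin ℓ → ℝ) × A.Q.E := (ξ₀, e p) with hx₀def
  have hx₀ : x₀ ∈ A.coordDomain c e := by
    refine ⟨⟨hξ₀, mem_chart_target _ _⟩, ?_⟩
    simp only [hx₀def, hep]
    exact mem_chart_source _ _
  have hVo : IsOpen (A.coordDomain c e) := A.isOpen_coordDomain hI he
  set Ψ := A.coord c e with hΨdef
  obtain ⟨Θ, hΘ0, hΘ⟩ := exists_smooth_local_inverse hVo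
    (fun x hx => A.contMDiffAt_coord hI hc he hx)
    (fun x hx => A.fderiv_coord_bijective hI hc he hx) hx₀
  rw [← hΨdef] at hΘ0 hΘ
  set z₀ := Ψ x₀ with hz₀
  set G := localForm c M.g with hGdef
  -- The gradient of `σ_1` and `σ_1` itself are pushed to the chart by the local inverse `Θ`, so
  -- that they are defined near `z₀`.
  let Y : Cn M.dim → Cn M.dim := fun z => fderiv ℝ Ψ (Θ z) (A.gradField (Θ z))
  let s : Cn M.dim → ℝ := fun z => ∑ j, (Θ z).1 j
  have hYΨ : ∀ x, Θ (Ψ x) = x → Y (Ψ x) = fderiv ℝ Ψ x (A.gradField x) := fun x hx => by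
    simp only [Y, hx]
  have htgt : ∀ᶠ z in 𝓝 z₀, z ∈ c.target := c.open_target.mem_nhds (c.map_source hx₀.2)
  have hG : ∀ᶠ z in 𝓝 z₀, ContDiffAt ℝ ∞ G z :=
    htgt.mono fun z hz => M.contDiffAt_localForm_g hc hz
  have hH : ∀ᶠ z in 𝓝 z₀, IsHermitianForm (G z) :=
    htgt.mono fun z hz => M.isHermitianForm_localForm hc hz
  have hclosed : ∀ᶠ z in 𝓝 z₀, ∀ u v w, fderiv ℝ G z u (Complex.I • v) w
      + fderiv ℝ G z v (Complex.I • w) u + fderiv ℝ G z w (Complex.I • u) v = 0 :=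
    htgt.mono fun z hz => M.closed_localForm hc hz
  have hY : ∀ᶠ z in 𝓝 z₀, ContDiffAt ℝ ∞ Y z := by
    filter_upwards [hΘ] with z hz
    have h1 : ContDiffAt ℝ ∞ (fderiv ℝ Ψ) (Θ z) :=
      (A.contMDiffAt_coord hI hc he hz.1).fderiv_right (m := ∞) (by simp)
    exact (ContDiffAt.comp (g := fderiv ℝ Ψ) z h1 hz.2.2.1).clm_apply
      (ContDiffAt.comp z (A.contDiffAt_gradField hI hz.1.1.1 (hinj _ hz.1.1.1)) hz.2.2.1)
  have hs : ∀ᶠ z in 𝓝 z₀, ContDiffAt ℝ ∞ s z := by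
    filter_upwards [hΘ] with z hz
    refine ContDiffAt.sum fun j _ => ?_
    exact (contDiff_apply ℝ ℝ j).contDiffAt.comp z (contDiffAt_fst.comp z hz.2.2.1)
  have hgrad : ∀ᶠ z in 𝓝 z₀, ∀ w, G z (Y z) w = fderiv ℝ s z w := by
    filter_upwards [hΘ, hs] with z hz hsz w
    have hΨz := hz.2.1
    obtain ⟨u, rfl⟩ := (A.fderiv_coord_bijective hI hc he hz.1).2 w
    have h1 : HasFDerivAt (s ∘ Ψ) ((fderiv ℝ s z).comp (fderiv ℝ Ψ (Θ z))) (Θ z) := by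
      refine HasFDerivAt.comp (Θ z) ?_
        ((A.contMDiffAt_coord hI hc he hz.1).differentiableAt (by simp)).hasFDerivAt
      rw [hΨz]
      exact (hsz.differentiableAt (by simp)).hasFDerivAt
    have h2 : HasFDerivAt (fun x : (Fin ℓ → ℝ) × A.Q.E => ∑ j, x.1 j)
        (∑ j, (ContinuousLinearMap.proj (R := ℝ) (φ := fun _ : Fin ℓ => ℝ) j).comp
          (ContinuousLinearMap.fst ℝ (Fin ℓ → ℝ) A.Q.E)) (Θ z) :=
      HasFDerivAt.fun_sum fun j _ =>
        ((ContinuousLinearMap.proj (R := ℝ) (φ := fun _ : Fin ℓ => ℝ) j).comp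
          (ContinuousLinearMap.fst ℝ (Fin ℓ → ℝ) A.Q.E)).hasFDerivAt
    have h3 := (h2.congr_of_eventuallyEq (f₁ := s ∘ Ψ) (hz.2.2.2.mono fun x hx => by
      simp only [s, Function.comp_apply, hx])).unique h1
    have h4 := congrArg (fun L : ((Fin ℓ → ℝ) × A.Q.E) →L[ℝ] ℝ => L u) h3
    simp only [ContinuousLinearMap.comp_apply, sum_apply, ContinuousLinearMap.coe_fst',
      ContinuousLinearMap.proj_apply] at h4
    rw [← h4]
    have h5 := A.localForm_gradField hI hinj hc he hz.1 u
    rw [← hΨdef, hΨz] at h5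
    exact h5
  -- the endomorphism of the Lie derivative
  have hex : ∀ z, (Θ z ∈ A.coordDomain c e ∧ Ψ (Θ z) = z) → ∃ C : Cn M.dim →L[ℝ] Cn M.dim,
      (∀ u w, G z (C (fderiv ℝ Ψ (Θ z) u)) (fderiv ℝ Ψ (Θ z) w)
        = A.lieMetric (Θ z).1 (e.symm (Θ z).2) (u.1, A.symmDeriv e (Θ z).2 u.2)
          (w.1, A.symmDeriv e (Θ z).2 w.2)) ∧
      (∀ u w, localForm c M.kahlerForm z (C (fderiv ℝ Ψ (Θ z) u)) (fderiv ℝ Ψ (Θ z) w)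
        = A.lieForm (Θ z).1 (e.symm (Θ z).2) (u.1, A.symmDeriv e (Θ z).2 u.2)
          (w.1, A.symmDeriv e (Θ z).2 w.2)) ∧
      (∀ v, C (Complex.I • v) = Complex.I • C v) ∧
      (1 / 2) * LinearMap.trace ℝ (Cn M.dim) (C : Cn M.dim →ₗ[ℝ] Cn M.dim)
        = A.laplacian (Θ z).1 := by
    rintro z ⟨hV, hΨz⟩
    obtain ⟨C, h1, h2, h3, h4⟩ := A.exists_hessian hI hc hV.1.1 (hinj _ hV.1.1) hV.2
    have hzz : c (A.Φ ((Θ z).1, e.symm (Θ z).2)) = z := hΨz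
    rw [hzz] at h1 h2
    refine ⟨C, fun u w => ?_, fun u w => ?_, h3, h4⟩
    · rw [A.fderiv_coord hI hc he hV, A.fderiv_coord hI hc he hV]
      exact h1 _ _
    · rw [A.fderiv_coord hI hc he hV, A.fderiv_coord hI hc he hV]
      exact h2 _ _
  -- The endomorphisms are chosen point by point, with no regularity. Differentiability of their
  -- trace is an output of `iddbar_neg_logDet`.
  choose! C hC1 hC2 hC3 hC4 using hex
  have hCI : ∀ᶠ z in 𝓝 z₀, ∀ u, C z (Complex.I • u) = Complex.I • C z u := by
    filter_upwards [hΘ] with z hz using hC3 z ⟨hz.1, hz.2.1⟩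
  have hYnear : ∀ z, (∀ᶠ x in 𝓝 (Θ z), Θ (Ψ x) = x) →
      ∀ᶠ x in 𝓝 (Θ z), Y (Ψ x) = fderiv ℝ Ψ x (A.gradField x) :=
    fun z hz => hz.mono hYΨ
  have hL : ∀ᶠ z in 𝓝 z₀, ∀ u w, fderiv ℝ G z (Y z) u w + G z (fderiv ℝ Y z u) w
      + G z u (fderiv ℝ Y z w) = G z (C z u) w := by
    filter_upwards [hΘ, hY] with z hz hYz u' w'
    have hΨz := hz.2.1
    obtain ⟨u, rfl⟩ := (A.fderiv_coord_bijective hI hc he hz.1).2 u'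
    obtain ⟨w, rfl⟩ := (A.fderiv_coord_bijective hI hc he hz.1).2 w'
    have h := A.lie_g hI hinj hc he hz.1 (Y := Y)
      (by rw [← hΨdef, hΨz]; exact hYz.differentiableAt (by simp)) (hYnear z hz.2.2.2) u w
    rw [← hΨdef, hΨz] at h
    rw [h, hC1 z ⟨hz.1, hΨz⟩]
  have hLK : ∀ᶠ z in 𝓝 z₀, ∀ u w, fderiv ℝ (localForm c M.kahlerForm) z (Y z) u w
      + localForm c M.kahlerForm z (fderiv ℝ Y z u) w
      + localForm c M.kahlerForm z u (fderiv ℝ Y z w) = localForm c M.kahlerForm z (C z u) w := by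
    filter_upwards [hΘ, hY] with z hz hYz u' w'
    have hΨz := hz.2.1
    obtain ⟨u, rfl⟩ := (A.fderiv_coord_bijective hI hc he hz.1).2 u'
    obtain ⟨w, rfl⟩ := (A.fderiv_coord_bijective hI hc he hz.1).2 w'
    have h := A.lie_kahlerForm hI hinj hc he hz.1 (Y := Y)
      (by rw [← hΨdef, hΨz]; exact hYz.differentiableAt (by simp)) (hYnear z hz.2.2.2) u w
    rw [← hΨdef, hΨz] at h
    rw [h, hC2 z ⟨hz.1, hΨz⟩]
  have hω : ∀ z ∈ c.target, ∀ u w, localForm c M.kahlerForm z u w = G z (Complex.I • u) w :=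
    fun z hz u w => localForm_fundamentalForm hc hz M.g u w
  have hLω : ∀ᶠ z in 𝓝 z₀, ∀ u w, fderiv ℝ G z (Y z) (Complex.I • u) w
      + G z (Complex.I • fderiv ℝ Y z u) w + G z (Complex.I • u) (fderiv ℝ Y z w)
      = G z (Complex.I • C z u) w := by
    filter_upwards [hLK, htgt] with z hz hzt u w
    have h := hz u w
    rw [hω z hzt, hω z hzt, hω z hzt, M.fderiv_localForm_kahlerForm hc hzt] at h
    exact h
  obtain ⟨hdiff, hric⟩ := iddbar_neg_logDet hG hY hs hH hclosed hgrad hCI hL hLω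
  have hz₀ := hΘ.self_of_nhds
  have hzt := htgt.self_of_nhds
  have hY₀ : Y z₀ = fderiv ℝ Ψ x₀ (A.gradField x₀) := hYΨ x₀ hΘ0
  have hYd : DifferentiableAt ℝ Y z₀ := hY.self_of_nhds.differentiableAt (by simp)
  have hX : localField c (fun x => a • J x (K x)) =ᶠ[𝓝 z₀] fun z => (-a) • Y z := by
    filter_upwards [hΘ] with z hz
    have h := A.localField_eq hI hinj hc he hK a hz.1
    rw [← hΨdef, hz.2.1] at h
    exact h
  have hXd : fderiv ℝ (localField c (fun x => a • J x (K x))) z₀ = (-a) • fderiv ℝ Y z₀ := by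
    rw [hX.fderiv_eq]
    exact fderiv_const_smul hYd (-a)
  -- Here `X = -aY`, and `ω(C(iY), w) = g(iC(iY), w) = -g(CY, w)` because `C` commutes with `i`.
  have hlie : ∀ w, lieKahlerForm M c (fun x => a • J x (K x)) z₀ (Complex.I • Y z₀) w
      = a * G z₀ (C z₀ (Y z₀)) w := fun w => by
    have h := hLK.self_of_nhds (Complex.I • Y z₀) w
    rw [hω _ hzt (C z₀ _), hCI.self_of_nhds, I_smul_I_smul, map_neg, neg_apply] at h
    rw [lieKahlerForm, hXd, hX.self_of_nhds]
    simp only [map_smul, smul_apply, smul_eq_mul]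
    linear_combination (-a) * h
  have hY0 : ∀ j, gradComp A.profile ξ₀ j ≠ 0 := fun j =>
    div_ne_zero (A.profile_ne_zero (hξ₀ j (mem_univ j))) (Δ_ne_zero (hinj _ hξ₀) j)
  have hGC : ∀ x : Fin ℓ → ℝ, G z₀ (C z₀ (Y z₀)) (fderiv ℝ Ψ x₀ (x, 0))
      = ∑ j, A.fibreEigen ξ₀ j * x j := fun x => by
    have h := hC1 z₀ ⟨hz₀.1, hz₀.2.1⟩ (A.gradField x₀) (x, 0)
    rw [hΘ0] at h
    rw [hY₀, h]
    have h0 : ∀ j, tau ξ₀ 0 j = 0 := fun j => by simp [tau]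
    simp only [lieMetric, gradField, baseMet, map_zero, mul_zero, hx₀def,
      Finset.sum_const_zero, zero_add, h0, add_zero]
    refine Finset.sum_congr rfl fun j _ => ?_
    have := hY0 j
    field_simp
  -- Twice the soliton equation on the pair `(iY, ∂_x)`: the Ricci term gives the derivative of the
  -- Laplacian, and `ω(iY, ·) = -g(Y, ·)` gives the sign of the last term.
  have hkey : ∀ x : Fin ℓ → ℝ, fderiv ℝ (fun z' => (1 / 2) * LinearMap.trace ℝ (Cn M.dim)
      (C z' : Cn M.dim →ₗ[ℝ] Cn M.dim)) z₀ (fderiv ℝ Ψ x₀ (x, 0))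
      + a * ∑ j, A.fibreEigen ξ₀ j * x j + 2 * lam * ∑ j, x j = 0 := fun x => by
    have h := hsol.equation c hc z₀ hzt (Complex.I • Y z₀) (fderiv ℝ Ψ x₀ (x, 0))
    have h1 : ricciForm M c z₀ (Complex.I • Y z₀) (fderiv ℝ Ψ x₀ (x, 0)) = _ :=
      hric (fderiv ℝ Ψ x₀ (x, 0))
    have h2 : G z₀ (Y z₀) (fderiv ℝ Ψ x₀ (x, 0)) = ∑ j, x j := by
      rw [hY₀]
      exact A.localForm_gradField hI hinj hc he hx₀ (x, 0)
    rw [h1, hlie, hGC, hω _ hzt, I_smul_I_smul, map_neg, neg_apply, h2] at h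
    linear_combination 2 * h
  have hlap : HasFDerivAt A.laplacian ((fderiv ℝ (fun z' => (1 / 2) * LinearMap.trace ℝ (Cn M.dim)
      (C z' : Cn M.dim →ₗ[ℝ] Cn M.dim)) z₀).comp ((fderiv ℝ Ψ x₀).comp
        (ContinuousLinearMap.inl ℝ (Fin ℓ → ℝ) A.Q.E))) ξ₀ := by
    have hι : HasFDerivAt (fun ξ : Fin ℓ → ℝ => (ξ, e p))
        (ContinuousLinearMap.inl ℝ (Fin ℓ → ℝ) A.Q.E) ξ₀ := hasFDerivAt_prodMk_left ξ₀ (e p)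
    have hΨ : HasFDerivAt (fun ξ : Fin ℓ → ℝ => Ψ (ξ, e p)) ((fderiv ℝ Ψ x₀).comp
        (ContinuousLinearMap.inl ℝ (Fin ℓ → ℝ) A.Q.E)) ξ₀ :=
      HasFDerivAt.comp ξ₀ (g := Ψ)
        ((A.contMDiffAt_coord hI hc he hx₀).differentiableAt (by simp)).hasFDerivAt hι
    refine (HasFDerivAt.comp ξ₀ hdiff.hasFDerivAt hΨ).congr_of_eventuallyEq ?_
    have hn := hz₀.2.2.2
    rw [hΘ0] at hn
    have hcont : Tendsto (fun ξ : Fin ℓ → ℝ => (ξ, e p)) (𝓝 ξ₀) (𝓝 x₀) :=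
      hι.continuousAt
    filter_upwards [hcont.eventually hn, hcont.eventually (hVo.mem_nhds hx₀)] with ξ h1 h2
    have h3 := hC4 (Ψ (ξ, e p)) ⟨by rw [h1]; exact h2, by rw [h1]⟩
    rw [h1] at h3
    exact h3.symm
  have hsum : HasFDerivAt (fun ξ => ∑ j, gradComp A.profile ξ j) _ ξ₀ :=
    HasFDerivAt.fun_sum fun j _ =>
      hasFDerivAt_gradComp (q' := A.profileDeriv ξ₀) (hinj _ hξ₀) (A.hasDerivAt_profile hI hξ₀ j)
  have hid : HasFDerivAt (fun ξ : Fin ℓ → ℝ => ∑ j, ξ j) _ ξ₀ :=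
    HasFDerivAt.fun_sum fun j _ => hasFDerivAt_coord j ξ₀
  refine ((hlap.add (hsum.const_mul a)).add (hid.const_mul (2 * lam))).congr_fderiv ?_
  ext1 x
  refine Eq.trans ?_ (hkey x)
  have h := sum_gradCompDeriv (q := A.profile) (q' := A.profileDeriv ξ₀) (ξ := ξ₀) x
  simp only [gradCompDeriv] at h
  simp only [add_apply, smul_apply, sum_apply, ContinuousLinearMap.comp_apply, smul_eq_mul,
    ContinuousLinearMap.proj_apply, ContinuousLinearMap.inl_apply, h, fibreEigen]

end HamiltonianAnsatz

/-! ### Positive solutions of the linear equation at infinity. -/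

section ScalarEquation

variable {h h' : ℝ → ℝ}

/-- A positive function cannot have derivative eventually at most `-1`. -/
theorem false_of_deriv_le_neg_one (hpos : ∀ᶠ t in atTop, 0 < h t)
    (hd : ∀ᶠ t in atTop, HasDerivAt h (h' t) t) (hle : ∀ᶠ t in atTop, h' t ≤ -1) : False := by
  obtain ⟨T, hT⟩ := eventually_atTop.1 ((hpos.and hd).and hle)
  have hder : ∀ t ∈ Ici T, HasDerivAt (fun t => h t + t) (h' t + 1) t := fun t ht =>
    (hT t ht).1.2.add (hasDerivAt_id t)
  have hanti : AntitoneOn (fun t => h t + t) (Ici T) := by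
    refine antitoneOn_of_deriv_nonpos (convex_Ici T)
      (fun t ht => (hder t ht).continuousAt.continuousWithinAt) (fun t ht => ?_) fun t ht => ?_
    · exact (hder t (interior_subset ht)).differentiableAt.differentiableWithinAt
    · rw [(hder t (interior_subset ht)).deriv]
      linarith [(hT t (interior_subset ht)).2]
  have h0 := (hT T le_rfl).1.1
  -- Since `h t + t` is non-increasing, `h` must have reached zero by the time `T + h T`.
  have ht : T + h T ∈ Ici T := by simpa using h0.le
  have h1 := hanti (mem_Ici.2 le_rfl) ht ht
  have h2 := (hT (T + h T) ht).1.1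
  simp only at h1
  linarith

/-- A positive function with `h' ≥ k h` grows exponentially. -/
theorem exp_le_of_mul_le_deriv {k : ℝ} (hpos : ∀ᶠ t in atTop, 0 < h t)
    (hd : ∀ᶠ t in atTop, HasDerivAt h (h' t) t) (hle : ∀ᶠ t in atTop, k * h t ≤ h' t) :
    ∃ c > 0, ∀ᶠ t in atTop, c * Real.exp (k * t) ≤ h t := by
  obtain ⟨T, hT⟩ := eventually_atTop.1 ((hpos.and hd).and hle)
  have hexp : ∀ t, HasDerivAt (fun t => Real.exp (-(k * t))) (Real.exp (-(k * t)) * -(k * 1)) t :=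
    fun t => (((hasDerivAt_id t).const_mul k).neg).exp
  have hder : ∀ t ∈ Ici T, HasDerivAt (fun t => h t * Real.exp (-(k * t)))
      (h' t * Real.exp (-(k * t)) + h t * (Real.exp (-(k * t)) * -(k * 1))) t := fun t ht =>
    (hT t ht).1.2.mul (hexp t)
  have hmono : MonotoneOn (fun t => h t * Real.exp (-(k * t))) (Ici T) := by
    refine monotoneOn_of_deriv_nonneg (convex_Ici T)
      (fun t ht => (hder t ht).continuousAt.continuousWithinAt) (fun t ht => ?_) fun t ht => ?_
    · exact (hder t (interior_subset ht)).differentiableAt.differentiableWithinAt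
    · rw [(hder t (interior_subset ht)).deriv]
      have h1 := (hT t (interior_subset ht)).2
      have h2 := mul_nonneg (sub_nonneg.2 h1) (Real.exp_pos (-(k * t))).le
      linarith
  refine ⟨h T * Real.exp (-(k * T)), mul_pos (hT T le_rfl).1.1 (Real.exp_pos _), ?_⟩
  filter_upwards [eventually_ge_atTop T] with t ht
  have h1 := hmono (mem_Ici.2 le_rfl) (mem_Ici.2 ht) ht
  have h2 := mul_le_mul_of_nonneg_right h1 (Real.exp_pos (k * t)).le
  simp only [mul_assoc, ← Real.exp_add, neg_add_cancel, Real.exp_zero, mul_one] at h2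
  rw [mul_assoc, ← Real.exp_add]
  exact h2

variable {r b : ℝ → ℝ} {c lam L : ℝ}

theorem tendsto_linear_add (hlam : lam < 0) (hb : Tendsto b atTop (𝓝 L)) :
    Tendsto (fun t => -2 * lam * t + b t) atTop atTop :=
  (tendsto_id.const_mul_atTop (by linarith : 0 < -2 * lam)).atTop_add hb

/-- The equation `h' = -(c + r) h - 2 λ t + b` has no positive solution near `∞` if `λ > 0`,
`c ≥ 0`, `r ≥ 0`. -/
theorem false_of_shrinking (hlam : 0 < lam) (hc : 0 ≤ c) (hpos : ∀ᶠ t in atTop, 0 < h t)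
    (hr : ∀ᶠ t in atTop, 0 ≤ r t) (hb : Tendsto b atTop (𝓝 L))
    (hd : ∀ᶠ t in atTop, HasDerivAt h (-(c + r t) * h t - 2 * lam * t + b t) t) : False := by
  refine false_of_deriv_le_neg_one hpos hd ?_
  -- Applied to `-λ` and `-b`, so that `2λt - b → ∞`.
  have h1 := tendsto_linear_add (neg_neg_of_pos hlam) hb.neg
  filter_upwards [h1.eventually_ge_atTop 1, hpos, hr] with t h1 h2 h3
  have := mul_nonneg (add_nonneg hc h3) h2.le
  linarith

/-- Positive solutions of `h' = -(c + r) h - 2 λ t + b` near `∞` grow exponentially if `λ < 0`,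
`c < 0`, `r → 0`. -/
theorem exp_le_of_expanding (hlam : lam < 0) (hc : c < 0) (hpos : ∀ᶠ t in atTop, 0 < h t)
    (hr : Tendsto r atTop (𝓝 0)) (hb : Tendsto b atTop (𝓝 L))
    (hd : ∀ᶠ t in atTop, HasDerivAt h (-(c + r t) * h t - 2 * lam * t + b t) t) :
    ∃ k > 0, ∃ C > 0, ∀ᶠ t in atTop, C * Real.exp (k * t) ≤ h t := by
  -- Half of the limiting rate `-c`: the other half absorbs `r → 0`, and the inhomogeneous term is
  -- eventually nonnegative.
  refine ⟨-c / 2, by linarith, exp_le_of_mul_le_deriv hpos hd ?_⟩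
  have h1 := tendsto_linear_add hlam hb
  filter_upwards [h1.eventually_ge_atTop 0, hpos, hr.eventually_le_const
    (show (0 : ℝ) < -c / 2 by linarith)] with t h1 h2 h3
  have := mul_nonneg (sub_nonneg.2 h3) h2.le
  linarith

end ScalarEquation

/-! ### Behaviour at an end of the momentum domain -/

theorem tendsto_inv_sub {δ : ℝ} (hδ : δ = 1 ∨ δ = -1) (y : ℝ) :
    Tendsto (fun t => (δ * t - y)⁻¹) atTop (𝓝 0) := by
  rcases hδ with rfl | rfl
  · refine tendsto_inv_atTop_zero.comp ?_
    simpa [sub_eq_add_neg] using tendsto_atTop_add_const_right atTop (-y) (tendsto_id (α := ℝ))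
  · refine tendsto_inv_atBot_zero.comp ?_
    simpa [sub_eq_add_neg] using tendsto_atBot_add_const_right atTop (-y)
      (tendsto_neg_atTop_atBot (G := ℝ))

theorem eventually_mul_inv_sub_nonneg {δ : ℝ} (hδ : δ = 1 ∨ δ = -1) (y : ℝ) :
    ∀ᶠ t in atTop, 0 ≤ δ * (δ * t - y)⁻¹ := by
  rcases hδ with rfl | rfl
  · filter_upwards [eventually_ge_atTop y] with t ht
    rw [one_mul, one_mul]
    exact inv_nonneg.2 (sub_nonneg.2 ht)
  · filter_upwards [eventually_ge_atTop (-y)] with t ht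
    rw [neg_one_mul, neg_one_mul, ← inv_neg]
    exact inv_nonneg.2 (by linarith)

/-- For `k ≠ j`, `Δ(ξ_k)` is an affine function of `ξ_j`. -/
theorem Δ_update {ℓ : ℕ} (ξ : Fin ℓ → ℝ) {j k : Fin ℓ} (hkj : k ≠ j) (t : ℝ) :
    Δ (Function.update ξ j t) k
      = (ξ k - t) * ∏ i ∈ (Finset.univ.erase k).erase j, (ξ k - ξ i) := by
  rw [Δ, ← Finset.mul_prod_erase _ _ (Finset.mem_erase.2 ⟨hkj.symm, Finset.mem_univ j⟩),
    Function.update_self, Function.update_of_ne hkj]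
  congr 1
  refine Finset.prod_congr rfl fun i hi => ?_
  rw [Function.update_of_ne (Finset.ne_of_mem_erase hi)]

theorem hasDerivAt_update_mul {ℓ : ℕ} (ξ : Fin ℓ → ℝ) (j : Fin ℓ) (δ t : ℝ) :
    HasDerivAt (fun t : ℝ => Function.update ξ j (δ * t)) (Pi.single j δ) t := by
  rw [hasDerivAt_pi]
  intro i
  rcases eq_or_ne i j with rfl | hij
  · simpa using (hasDerivAt_id t).const_mul δ
  · simpa [hij] using hasDerivAt_const t (ξ i)

namespace HamiltonianAnsatz

set_option synthInstance.maxHeartbeats 400000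

variable {ℓ : ℕ} {M : KahlerManifold.{u}} {φ : TwoTensor M.dim M.Carrier} {I : Fin ℓ → Set ℝ}
  (A : HamiltonianAnsatz.{u, v, w} M φ I)

theorem metric_coordinate_vector {ξ : Fin ℓ → ℝ} (hξ : ξ ∈ univ.pi I) (p : A.Q.P) (j : Fin ℓ)
    (δ : ℝ) : formAt M.g (A.Φ (ξ, p)) (A.derivΦ (ξ, p) (Pi.single j δ, 0))
      (A.derivΦ (ξ, p) (Pi.single j δ, 0)) = δ * δ * (gradComp A.profile ξ j)⁻¹ := by
  rw [A.metric_formAt hξ]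
  have h0 : ∀ i, tau ξ 0 i = 0 := fun i => by simp [tau]
  simp only [baseMet, fibreMetric, map_zero, mul_zero, Finset.sum_const_zero, zero_add, h0,
    add_zero]
  rw [Finset.sum_eq_single j (fun i _ hij => by simp [hij]) (by simp), Pi.single_eq_same]
  ring

/-- `Y_j` is the inverse squared length of `∂/∂ξ_j`, so its sign comes from positivity of `g`, with
no sign count for `F_j`, `p_c` and `Δ`. -/
theorem gradComp_pos {ξ : Fin ℓ → ℝ} (hξ : ξ ∈ univ.pi I) (p : A.Q.P) (j : Fin ℓ) :
    0 < gradComp A.profile ξ j := by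
  have hne : A.derivΦ (ξ, p) (Pi.single j 1, 0) ≠ 0 := fun h => by
    have h1 := congrArg Prod.fst ((A.derivΦ_bijective hξ p).1 (h.trans (map_zero _).symm))
    have h2 : (Pi.single j (1 : ℝ) : Fin ℓ → ℝ) j = 0 := congrFun h1 j
    simp at h2
  have h := formAt_pos (A.Φ (ξ, p)) hne
  rw [A.metric_coordinate_vector hξ, one_mul, one_mul] at h
  exact inv_pos.1 h

/-- Along an end of the momentum domain, where only `ξ_j` varies and tends to `±∞`, the soliton
equation is a first order linear equation for `|∇ξ_j|²`. -/
theorem exists_end_equation (hI : ∀ j, IsOpen (I j)) (hconv : ∀ j, Convex ℝ (I j))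
    (hinj : ∀ ξ ∈ univ.pi I, Function.Injective ξ) {K : ∀ x, M.T x}
    (hK : A.IsHamiltonianField 1 K) {a lam : ℝ}
    (hsol : IsGradientKahlerRicciSoliton M (fun x => a • J x (K x)) lam)
    {ξ : Fin ℓ → ℝ} (p : A.Q.P) {j : Fin ℓ} {δ : ℝ} (hδ : δ = 1 ∨ δ = -1)
    (hend : ∀ᶠ t in atTop, Function.update ξ j (δ * t) ∈ univ.pi I) :
    ∃ (r b : ℝ → ℝ) (L : ℝ), Tendsto r atTop (𝓝 0) ∧ (∀ᶠ t in atTop, 0 ≤ r t) ∧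
      Tendsto b atTop (𝓝 L) ∧ ∀ᶠ t in atTop,
        HasDerivAt (fun t => gradComp A.profile (Function.update ξ j (δ * t)) j)
          (-(δ * a + r t) * gradComp A.profile (Function.update ξ j (δ * t)) j
            - 2 * lam * t + b t) t := by
  -- The domain is convex, hence connected, so the conserved quantity is a single constant `k`.
  obtain ⟨k, hk⟩ := (isOpen_set_pi finite_univ fun j _ => hI j).exists_is_const_of_fderiv_eq_zero
    (convex_pi fun j _ => hconv j).isPreconnected
    (fun x hx => (A.hasFDerivAt_soliton hI hinj hK hsol hx p).differentiableAt.differentiableWithinAt)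
    (fun x hx => (A.hasFDerivAt_soliton hI hinj hK hsol hx p).fderiv)
  let x : ℝ → Fin ℓ → ℝ := fun t => Function.update ξ j (δ * t)
  have hxj : ∀ t, x t j = δ * t := fun t => Function.update_self ..
  have hxi : ∀ t, ∀ i ∈ Finset.univ.erase j, x t i = ξ i := fun t i hi =>
    Function.update_of_ne (Finset.ne_of_mem_erase hi) ..
  let rest : ℝ → ℝ := fun t => ∑ i ∈ Finset.univ.erase j,
    (deriv (A.F i) (x t i) / (pc A.B A.η (x t i) * Δ (x t) i) + a * gradComp A.profile (x t) i
      + 2 * lam * x t i)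
  -- For `i ≠ j` the numerators are frozen while `Δ(ξ_i)` is a nonconstant affine function of `ξ_j`;
  -- only `2λξ_i` survives in the limit.
  have hrest : Tendsto rest atTop (𝓝 (∑ i ∈ Finset.univ.erase j, 2 * lam * ξ i)) := by
    refine tendsto_finsetSum _ fun i hi => ?_
    have hij := Finset.ne_of_mem_erase hi
    set P := ∏ k ∈ (Finset.univ.erase i).erase j, (ξ i - ξ k)
    have hlim := ((tendsto_inv_sub hδ (ξ i)).const_mul (-((deriv (A.F i) (ξ i)
      / pc A.B A.η (ξ i) + a * A.profile i (ξ i)) / P))).add_const (2 * lam * ξ i)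
    rw [mul_zero, zero_add] at hlim
    refine hlim.congr fun t => ?_
    rw [gradComp, hxi t i hi, Δ_update ξ hij, ← neg_sub (δ * t) (ξ i)]
    simp only [div_eq_mul_inv, mul_inv, inv_neg]
    ring
  -- `r` is the logarithmic `t`-derivative of `Δ(ξ_j) p_c(ξ_j)`, and `b` collects the constant `k`
  -- and the other indices. The factors `δ` come from `ξ_j = δt`.
  refine ⟨fun t => ∑ i ∈ Finset.univ.erase j, δ * (δ * t - ξ i)⁻¹
    + ∑ c, ((A.B c).dim : ℝ) * (δ * (δ * t - A.η c)⁻¹), fun t => δ * (k - rest t),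
    δ * (k - ∑ i ∈ Finset.univ.erase j, 2 * lam * ξ i), ?_, ?_, ?_, ?_⟩
  · have h1 := (tendsto_finsetSum (Finset.univ.erase j) fun i _ =>
      (tendsto_inv_sub hδ (ξ i)).const_mul δ).add (tendsto_finsetSum Finset.univ fun c _ =>
        ((tendsto_inv_sub hδ (A.η c)).const_mul δ).const_mul ((A.B c).dim : ℝ))
    simpa using h1
  · have h1 : ∀ᶠ t in atTop, ∀ i, 0 ≤ δ * (δ * t - ξ i)⁻¹ :=
      eventually_all.2 fun i => eventually_mul_inv_sub_nonneg hδ (ξ i)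
    have h2 : ∀ᶠ t in atTop, ∀ c, 0 ≤ δ * (δ * t - A.η c)⁻¹ :=
      eventually_all.2 fun c => eventually_mul_inv_sub_nonneg hδ (A.η c)
    filter_upwards [h1, h2] with t h1 h2
    exact add_nonneg (Finset.sum_nonneg fun i _ => h1 i)
      (Finset.sum_nonneg fun c _ => mul_nonneg (Nat.cast_nonneg _) (h2 c))
  · exact (tendsto_const_nhds.sub hrest).const_mul δ
  · filter_upwards [hend] with t ht
    have hinjt := hinj _ ht
    have hder := (hasFDerivAt_gradComp (q' := A.profileDeriv (x t)) hinjt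
      (A.hasDerivAt_profile hI ht j)).comp_hasDerivAt t (hasDerivAt_update_mul ξ j δ t)
    refine hder.congr_deriv ?_
    have hS := hk _ ht
    have hF : deriv (A.F j) (x t j) / (pc A.B A.η (x t j) * Δ (x t) j)
        = A.profileDeriv (x t) j / Δ (x t) j + gradComp A.profile (x t) j
          * ∑ c, ((A.B c).dim : ℝ) * (x t j - A.η c)⁻¹ := A.deriv_F_div hI ht hinjt j
    have hsplit : k = deriv (A.F j) (x t j) / (pc A.B A.η (x t j) * Δ (x t) j)
        + a * gradComp A.profile (x t) j + 2 * lam * x t j + rest t := by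
      rw [← hS, laplacian, Finset.mul_sum, Finset.mul_sum, ← Finset.sum_add_distrib,
        ← Finset.sum_add_distrib, ← Finset.add_sum_erase _ _ (Finset.mem_univ j)]
    have hdiag : ∑ i, (x t j - x t i)⁻¹ = ∑ i ∈ Finset.univ.erase j, (δ * t - ξ i)⁻¹ := by
      rw [← Finset.add_sum_erase _ _ (Finset.mem_univ j), sub_self, inv_zero, zero_add]
      exact Finset.sum_congr rfl fun i hi => by rw [hxj, hxi t i hi]
    have hoff : ∑ i, (x t j - x t i)⁻¹ * (Pi.single j δ : Fin ℓ → ℝ) i = 0 :=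
      Finset.sum_eq_zero fun i _ => by
        rcases eq_or_ne i j with rfl | hij
        · simp
        · simp [hij]
    have hη : ∑ c, ((A.B c).dim : ℝ) * (δ * (δ * t - A.η c)⁻¹)
        = δ * ∑ c, ((A.B c).dim : ℝ) * (x t j - A.η c)⁻¹ := by
      rw [Finset.mul_sum]
      exact Finset.sum_congr rfl fun c _ => by rw [hxj]; ring
    have hδ2 : δ * δ = 1 := by rcases hδ with rfl | rfl <;> norm_num
    simp only [add_apply, smul_apply, sum_apply, smul_eq_mul, ContinuousLinearMap.proj_apply,
      Pi.single_eq_same]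
    change gradCompDiag A.profile (A.profileDeriv (x t)) (x t) j * δ
      + gradComp A.profile (x t) j * ∑ i, (x t j - x t i)⁻¹ * (Pi.single j δ : Fin ℓ → ℝ) i = _
    rw [hoff, gradCompDiag, hdiag, hη, hsplit, hxj]
    change _ = -(_ + _) * gradComp A.profile (x t) j - _ + _
    rw [← Finset.mul_sum]
    rw [hxj] at hF
    rw [hF]
    linear_combination -2 * lam * t * hδ2

end HamiltonianAnsatz

/-! ### Completeness and ends of finite length. -/

theorem KahlerManifold.enorm_eq (M : KahlerManifold.{u}) (x : M.Carrier)
    (v : TangentSpace 𝓘(ℝ, Cn M.dim) x) :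
    letI : RiemannianBundle (fun x : M.Carrier => TangentSpace 𝓘(ℝ, Cn M.dim) x) :=
      ⟨M.metric.toRiemannianMetric⟩
    ‖v‖ₑ = ENNReal.ofReal (Real.sqrt (M.g x v v)) := by
  let : RiemannianBundle (fun x : M.Carrier => TangentSpace 𝓘(ℝ, Cn M.dim) x) :=
      ⟨M.metric.toRiemannianMetric⟩
  change ‖v‖ₑ = _
  rw [← ofReal_norm, norm_eq_sqrt_real_inner]
  rfl

/-- In a complete Kähler manifold, a curve whose speed decays exponentially converges. -/
theorem KahlerManifold.IsComplete.exists_tendsto_curve {M : KahlerManifold.{u}}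
    (hM : M.IsComplete) {γ : ℝ → M.Carrier} {T C k : ℝ} (hk : 0 < k)
    (hγ : ContMDiffOn 𝓘(ℝ, ℝ) 𝓘(ℝ, Cn M.dim) 1 γ (Ici T))
    (hspeed : ∀ t ≥ T, Real.sqrt (M.g (γ t) (mfderiv 𝓘(ℝ, ℝ) 𝓘(ℝ, Cn M.dim) γ t (1 : ℝ))
      (mfderiv 𝓘(ℝ, ℝ) 𝓘(ℝ, Cn M.dim) γ t (1 : ℝ))) ≤ C * Real.exp (-(k * t))) :
    ∃ x, Tendsto (fun n : ℕ => γ (T + n)) atTop (𝓝 x) := by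
  let : RiemannianBundle (fun x : M.Carrier => TangentSpace 𝓘(ℝ, Cn M.dim) x) :=
      ⟨M.metric.toRiemannianMetric⟩
  have hdist : ∀ s t, T ≤ s → s ≤ t → Manifold.riemannianEDist 𝓘(ℝ, Cn M.dim) (γ s) (γ t)
      ≤ ENNReal.ofReal (C / k * Real.exp (-(k * s))) := by
    intro s t hs hst
    have hC : 0 ≤ C := by
      have := (Real.sqrt_nonneg _).trans (hspeed s hs)
      exact nonneg_of_mul_nonneg_left this (Real.exp_pos _)
    refine (Manifold.riemannianEDist_le_pathELength
      (hγ.mono (Icc_subset_Ici_self.trans (Ici_subset_Ici.2 hs))) rfl rfl hst).trans ?_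
    rw [Manifold.pathELength_eq_lintegral_mfderiv_Icc]
    have hd : ∀ u, HasDerivAt (fun u => -(C / k) * Real.exp (-(k * u))) (C * Real.exp (-(k * u))) u :=
      fun u => by
        refine ((((hasDerivAt_id u).const_mul k).neg.exp).const_mul (-(C / k))).congr_deriv ?_
        simp only [id, mul_one]
        field_simp
        rfl
    have hcont : Continuous fun u => C * Real.exp (-(k * u)) := by fun_prop
    have hintegrable : MeasureTheory.IntegrableOn (fun u => C * Real.exp (-(k * u))) (Icc s t) :=
      hcont.continuousOn.integrableOn_Icc
    calc ∫⁻ u in Icc s t, ‖mfderiv 𝓘(ℝ, ℝ) 𝓘(ℝ, Cn M.dim) γ u (1 : ℝ)‖ₑ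
        ≤ ∫⁻ u in Icc s t, ENNReal.ofReal (C * Real.exp (-(k * u))) := by
          refine MeasureTheory.setLIntegral_mono' measurableSet_Icc fun u hu => ?_
          rw [M.enorm_eq]
          exact ENNReal.ofReal_le_ofReal (hspeed u (hs.trans hu.1))
      _ = ENNReal.ofReal (∫ u in Icc s t, C * Real.exp (-(k * u))) := by
          rw [MeasureTheory.ofReal_integral_eq_lintegral_ofReal hintegrable
            (Eventually.of_forall fun u => mul_nonneg hC (Real.exp_pos _).le)]
      _ ≤ _ := by
          refine ENNReal.ofReal_le_ofReal ?_
          rw [MeasureTheory.integral_Icc_eq_integral_Ioc, ← intervalIntegral.integral_of_le hst,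
            intervalIntegral.integral_eq_sub_of_hasDerivAt (fun u _ => hd u)
              (hcont.intervalIntegrable s t)]
          have := mul_nonneg (div_nonneg hC hk.le) (Real.exp_pos (-(k * t))).le
          linarith
  -- The tail bound `(C/k) e^{-ks}` makes the integer samples a Cauchy sequence.
  refine hM (fun n : ℕ => γ (T + n)) fun ε hε => ?_
  have hlim : Tendsto (fun n : ℕ => ENNReal.ofReal (C / k * Real.exp (-(k * (T + n))))) atTop
      (𝓝 0) := by
    have h1 : Tendsto (fun n : ℕ => k * (T + n)) atTop atTop :=
      (tendsto_atTop_add_const_left atTop T tendsto_natCast_atTop_atTop).const_mul_atTop hk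
    have h2 := (Real.tendsto_exp_neg_atTop_nhds_zero.comp h1).const_mul (C / k)
    rw [mul_zero] at h2
    have h3 := ENNReal.tendsto_ofReal h2
    rw [ENNReal.ofReal_zero] at h3
    exact h3
  obtain ⟨N, hN⟩ := eventually_atTop.1 (hlim.eventually_lt_const hε)
  have hle : ∀ i ≥ N, ∀ j ≥ i,
      Manifold.riemannianEDist 𝓘(ℝ, Cn M.dim) (γ (T + i)) (γ (T + j)) < ε := fun i hi j hj =>
    (hdist _ _ (by simp) (by simpa using hj)).trans_lt (hN i hi)
  refine ⟨N, fun i hi j hj => ?_⟩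
  rcases le_total i j with h | h
  · exact hle i hi j h
  · rw [Manifold.riemannianEDist_comm]
    exact hle j hj i h

namespace HamiltonianAnsatz

set_option synthInstance.maxHeartbeats 400000

variable {ℓ : ℕ} {M : KahlerManifold.{u}} {φ : TwoTensor M.dim M.Carrier} {I : Fin ℓ → Set ℝ}
  (A : HamiltonianAnsatz.{u, v, w} M φ I)

/-- The curve in `M` along which only the coordinate `ξ_j = δt` varies. -/
def coordCurve (ξ : Fin ℓ → ℝ) (p : A.Q.P) (j : Fin ℓ) (δ t : ℝ) : M.Carrier :=
  A.Φ (Function.update ξ j (δ * t), p)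

theorem contMDiffAt_coordCurve (hI : ∀ j, IsOpen (I j)) {ξ : Fin ℓ → ℝ} (p : A.Q.P) {j : Fin ℓ}
    {δ t : ℝ} (ht : Function.update ξ j (δ * t) ∈ univ.pi I) :
    ContMDiffAt 𝓘(ℝ, ℝ) 𝓘(ℝ, Cn M.dim) ∞ (A.coordCurve ξ p j δ) t := by
  have h1 : ContDiff ℝ ∞ fun t : ℝ => Function.update ξ j (δ * t) :=
    (contDiff_update ∞ ξ j).comp (contDiff_const.mul contDiff_id)
  exact ContMDiffAt.comp (g := A.Φ) t (A.contMDiffAt_Φ hI ht p)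
    (h1.contMDiff.contMDiffAt.prodMk contMDiffAt_const)

theorem mfderiv_coordCurve (hI : ∀ j, IsOpen (I j)) {ξ : Fin ℓ → ℝ} (p : A.Q.P) {j : Fin ℓ}
    {δ t : ℝ} (ht : Function.update ξ j (δ * t) ∈ univ.pi I) :
    mfderiv 𝓘(ℝ, ℝ) 𝓘(ℝ, Cn M.dim) (A.coordCurve ξ p j δ) t (1 : ℝ)
      = A.derivΦ (Function.update ξ j (δ * t), p) (Pi.single j δ, 0) := by
  have h1 : HasMFDerivAt 𝓘(ℝ, ℝ) 𝓘(ℝ, Fin ℓ → ℝ) (fun t : ℝ => Function.update ξ j (δ * t)) t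
      (ContinuousLinearMap.toSpanSingleton ℝ (Pi.single j δ : Fin ℓ → ℝ)) :=
    (hasDerivAt_update_mul ξ j δ t).hasFDerivAt.hasMFDerivAt
  have h2 : HasMFDerivAt 𝓘(ℝ, ℝ) 𝓘(ℝ, A.Q.E) (fun _ : ℝ => p) t _ := hasMFDerivAt_const p t
  have h3 := ((A.contMDiffAt_Φ hI ht p).mdifferentiableAt (by simp)).hasMFDerivAt
  have h4 := (HasMFDerivAt.comp (g := A.Φ) t h3 (h1.prodMk h2)).mfderiv
  change mfderiv 𝓘(ℝ, ℝ) 𝓘(ℝ, Cn M.dim) (A.Φ ∘ fun t => (Function.update ξ j (δ * t), p)) t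
    (1 : ℝ) = _
  rw [h4]
  change A.derivΦ (Function.update ξ j (δ * t), p) ((1 : ℝ) • Pi.single j δ, 0) = _
  rw [one_smul]

/-- The potential of `aJK_1` is an affine function of the coordinate `ξ_j`. -/
theorem hasDerivAt_potential (hI : ∀ j, IsOpen (I j)) {K : ∀ x, M.T x}
    (hK : A.IsHamiltonianField 1 K) {a : ℝ} {f : M.Carrier → ℝ}
    (hf : ContMDiff 𝓘(ℝ, Cn M.dim) 𝓘(ℝ, ℝ) ∞ f)
    (hgrad : ∀ (x : M.Carrier) (v : M.T x), M.g x (a • J x (K x)) v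
      = mfderiv 𝓘(ℝ, Cn M.dim) 𝓘(ℝ, ℝ) f x v)
    {ξ : Fin ℓ → ℝ} (p : A.Q.P) {j : Fin ℓ} {δ t : ℝ}
    (ht : Function.update ξ j (δ * t) ∈ univ.pi I) :
    HasDerivAt (fun t => f (A.coordCurve ξ p j δ t)) (-(a * δ)) t := by
  have h1 := ((A.contMDiffAt_coordCurve hI p ht).mdifferentiableAt (by simp)).hasMFDerivAt
  have h2 := ((hf (A.coordCurve ξ p j δ t)).mdifferentiableAt (by simp)).hasMFDerivAt
  let L : ℝ →L[ℝ] ℝ := ContinuousLinearMap.comp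
    (mfderiv 𝓘(ℝ, Cn M.dim) 𝓘(ℝ, ℝ) f (A.coordCurve ξ p j δ t))
    (mfderiv 𝓘(ℝ, ℝ) 𝓘(ℝ, Cn M.dim) (A.coordCurve ξ p j δ) t)
  have h3 : HasFDerivAt (fun t => f (A.coordCurve ξ p j δ t)) L t :=
    (HasMFDerivAt.comp t h2 h1).hasFDerivAt
  refine h3.hasDerivAt.congr_deriv ?_
  change mfderiv 𝓘(ℝ, Cn M.dim) 𝓘(ℝ, ℝ) f (A.coordCurve ξ p j δ t)
    (mfderiv 𝓘(ℝ, ℝ) 𝓘(ℝ, Cn M.dim) (A.coordCurve ξ p j δ) t (1 : ℝ)) = _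
  rw [A.mfderiv_coordCurve hI p ht]
  refine (hgrad _ _).symm.trans ?_
  -- The pairing `g(JK_1, ·)` is definitionally `ω(K_1, ·)`, so the slope is read off from `-dσ_1`.
  have h4 := hK _ ht p (Pi.single j δ, 0)
  rw [dσ_one] at h4
  rw [map_smul]
  refine (congrArg (a * ·) h4).trans ?_
  simp

/-- If `|∇ξ_j|²` grows exponentially along an end of the momentum domain, the end has finite
length, but the potential of `aJK_1` is unbounded on it, so the metric is incomplete. -/
theorem false_of_complete (hM : M.IsComplete) (hI : ∀ j, IsOpen (I j))
    {K : ∀ x, M.T x} (hK : A.IsHamiltonianField 1 K) {a lam : ℝ} (ha : a ≠ 0)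
    (hsol : IsGradientKahlerRicciSoliton M (fun x => a • J x (K x)) lam)
    {ξ : Fin ℓ → ℝ} (p : A.Q.P) {j : Fin ℓ} {δ : ℝ} (hδ : δ = 1 ∨ δ = -1)
    (hend : ∀ᶠ t in atTop, Function.update ξ j (δ * t) ∈ univ.pi I) {k C : ℝ} (hk : 0 < k)
    (hC : 0 < C) (hgrowth : ∀ᶠ t in atTop,
      C * Real.exp (k * t) ≤ gradComp A.profile (Function.update ξ j (δ * t)) j) : False := by
  obtain ⟨T, hT⟩ := eventually_atTop.1 (hend.and hgrowth)
  obtain ⟨f, hf, hgrad⟩ := hsol.gradient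
  have hδ2 : δ * δ = 1 := by rcases hδ with rfl | rfl <;> norm_num
  -- The speed is `Y_j^(-1/2)`, so the growth bound `C e^{kt}` becomes the decay `C^(-1/2)
  -- e^{-kt/2}`.
  obtain ⟨x, hx⟩ := hM.exists_tendsto_curve (γ := A.coordCurve ξ p j δ) (T := T)
    (C := Real.sqrt C⁻¹) (k := k / 2) (by linarith)
    (fun t ht => ((A.contMDiffAt_coordCurve hI p (hT t ht).1).of_le
      (by norm_num)).contMDiffWithinAt) (fun t ht => by
    have h1 : M.g (A.coordCurve ξ p j δ t)
        (mfderiv 𝓘(ℝ, ℝ) 𝓘(ℝ, Cn M.dim) (A.coordCurve ξ p j δ) t (1 : ℝ))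
        (mfderiv 𝓘(ℝ, ℝ) 𝓘(ℝ, Cn M.dim) (A.coordCurve ξ p j δ) t (1 : ℝ))
        = (gradComp A.profile (Function.update ξ j (δ * t)) j)⁻¹ := by
      rw [A.mfderiv_coordCurve hI p (hT t ht).1]
      refine (A.metric_coordinate_vector (hT t ht).1 p j δ).trans ?_
      rw [hδ2, one_mul]
    rw [h1]
    have h2 : (gradComp A.profile (Function.update ξ j (δ * t)) j)⁻¹
        ≤ C⁻¹ * Real.exp (-(k * t)) := by
      rw [Real.exp_neg, ← mul_inv]
      exact inv_anti₀ (mul_pos hC (Real.exp_pos _)) (hT t ht).2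
    refine (Real.sqrt_le_sqrt h2).trans (le_of_eq ?_)
    rw [Real.sqrt_mul (inv_nonneg.2 hC.le), ← Real.exp_half]
    ring_nf)
  have hfx : Tendsto (fun n : ℕ => f (A.coordCurve ξ p j δ (T + n))) atTop (𝓝 (f x)) :=
    (hf.continuous.tendsto x).comp hx
  have haff : ∀ n : ℕ, f (A.coordCurve ξ p j δ (T + n))
      = f (A.coordCurve ξ p j δ T) - a * δ * n := fun n => by
    have hd : ∀ t ∈ Ici T, HasDerivAt (fun t => f (A.coordCurve ξ p j δ t) + a * δ * t) 0 t :=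
      fun t ht => ((A.hasDerivAt_potential hI hK hf hgrad p (hT t ht).1).add
        ((hasDerivAt_id t).const_mul (a * δ))).congr_deriv (by ring)
    have := (convex_Ici T).is_const_of_fderivWithin_eq_zero (𝕜 := ℝ)
      (fun t ht => (hd t ht).differentiableAt.differentiableWithinAt)
      (fun t ht => by
        have h := (hd t ht).hasDerivWithinAt.hasFDerivWithinAt (s := Ici T)
        rw [h.fderivWithin ((uniqueDiffOn_Ici T) t ht)]
        ext
        simp) (mem_Ici.2 (le_refl T)) (mem_Ici.2 (by simp : T ≤ T + n))
    linarith
  have hne : a * δ ≠ 0 := mul_ne_zero ha fun h => by simp [h] at hδ2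
  -- Solving the affine relation for `n` would make the integers converge.
  have hlin : Tendsto (fun n : ℕ => (n : ℝ)) atTop
      (𝓝 ((f (A.coordCurve ξ p j δ T) - f x) / (a * δ))) := by
    refine ((tendsto_const_nhds.sub hfx).div_const (a * δ)).congr fun n => ?_
    rw [haff, sub_sub_cancel, mul_div_cancel_left₀ _ hne]
  exact not_tendsto_nhds_of_tendsto_atTop tendsto_natCast_atTop_atTop _ hlin

end HamiltonianAnsatz

/-! ### Geometry of Type 2 domains. -/

section TypeTwo

variable {ℓ : ℕ} {α : Fin ℓ → ℝ}

theorem isOpen_type2Interval (α : Fin ℓ → ℝ) (j : Fin ℓ) : IsOpen (type2Interval α j) := by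
  unfold type2Interval
  split_ifs
  exacts [isOpen_Ioi, isOpen_Iio, isOpen_Ioo]

theorem convex_type2Interval (α : Fin ℓ → ℝ) (j : Fin ℓ) : Convex ℝ (type2Interval α j) := by
  unfold type2Interval
  split_ifs
  exacts [convex_Ioi _, convex_Iio _, convex_Ioo _ _]

/-- The factors of a Type 2 domain are ordered. -/
theorem strictMono_of_mem_type2 (hα : IsType2 α) {ξ : Fin ℓ → ℝ}
    (hξ : ξ ∈ univ.pi (type2Interval α)) : StrictMono ξ := by
  intro i j hij
  have hi := hξ i (mem_univ i)
  have hj := hξ j (mem_univ j)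
  have hij' : i.val < j.val := hij
  -- Since `i < j`, the factor of index `i` is not the last one and so is bounded above by `α i`.
  have hiu : ξ i < α i := by
    unfold type2Interval at hi
    rw [if_neg (by omega)] at hi
    split_ifs at hi
    · exact hi
    · exact hi.2
  unfold type2Interval at hj
  split_ifs at hj with h1 h2
  · exact hiu.trans ((hα.strictMono hij).trans hj)
  · omega
  -- In a middle factor, `α_i ≤ α_{j-1} < ξ_j`.
  · refine hiu.trans_le ((hα.strictMono.monotone ?_).trans hj.1.le)
    rw [Fin.le_def]
    simp only
    omega

theorem update_mem_pi {I : Fin ℓ → Set ℝ} {ξ : Fin ℓ → ℝ} (hξ : ξ ∈ univ.pi I) {j : Fin ℓ} {t : ℝ}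
    (ht : t ∈ I j) : Function.update ξ j t ∈ univ.pi I := by
  intro i _
  rcases eq_or_ne i j with rfl | hij
  · rwa [Function.update_self]
  · rw [Function.update_of_ne hij]
    exact hξ i (mem_univ i)

/-- A Type 2 domain has an end in either direction. -/
theorem exists_end_type2 (hℓ : 2 ≤ ℓ) {ξ : Fin ℓ → ℝ} (hξ : ξ ∈ univ.pi (type2Interval α))
    {δ : ℝ} (hδ : δ = 1 ∨ δ = -1) : ∃ j : Fin ℓ, ∀ᶠ t in atTop,
      Function.update ξ j (δ * t) ∈ univ.pi (type2Interval α) := by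
  rcases hδ with rfl | rfl
  · refine ⟨⟨ℓ - 1, by omega⟩, ?_⟩
    filter_upwards [eventually_gt_atTop (α ⟨ℓ - 1, by omega⟩)] with t ht
    refine update_mem_pi hξ ?_
    rw [type2Interval, if_pos (by simp only; omega), one_mul]
    exact ht
  -- The index `0` is not the last one because `ℓ ≥ 2`, so its factor is the half-line to `-∞`.
  · refine ⟨⟨0, by omega⟩, ?_⟩
    filter_upwards [eventually_gt_atTop (-α ⟨0, by omega⟩)] with t ht
    refine update_mem_pi hξ ?_
    rw [type2Interval, if_neg (by simp only; omega), if_pos rfl, neg_one_mul]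
    exact neg_lt.1 ht

end TypeTwo

end KRS

end

/-! ### The choice of the end in the two cases. -/

theorem lemmal (M : KRS.KahlerManifold.{u}) (hM : Nonempty M.Carrier)
    (ℓ : ℕ) (hℓ : 2 ≤ ℓ) (α : Fin ℓ → ℝ) (hα : KRS.IsType2 α)
    (φ : KRS.TwoTensor M.dim M.Carrier) (hφ : KRS.IsHamiltonianTwoForm M φ)
    (A : KRS.HamiltonianAnsatz.{u, v, w} M φ (KRS.type2Interval α))
    (K₁ : ∀ x, M.T x) (hK₁ : A.IsHamiltonianField 1 K₁)
    (a lam : ℝ) (hlam : lam ≠ 0) (ha : lam < 0 → a ≠ 0) :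
    ¬ (M.IsComplete ∧
      KRS.IsGradientKahlerRicciSoliton M (fun x => a • KRS.J x (K₁ x)) lam) := by
  rintro ⟨hcomplete, hsol⟩
  -- A dense subset of a nonempty space is nonempty; this supplies the base point of the coordinate
  -- lines.
  obtain ⟨_, ⟨⟨ξ, p⟩, ⟨hξ, -⟩, -⟩⟩ := A.Φ_dense.nonempty
  have hI := KRS.isOpen_type2Interval α
  have hinj : ∀ ξ ∈ univ.pi (KRS.type2Interval α), Function.Injective ξ := fun ξ hξ =>
    (KRS.strictMono_of_mem_type2 hα hξ).injective
  rcases lt_or_gt_of_ne hlam with hneg | hpos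
  -- Expanding case: the end is chosen so that the coefficient `-δa` of `h` is positive and forces
  -- exponential growth.
  · obtain ⟨δ, hδ, hδa⟩ : ∃ δ : ℝ, (δ = 1 ∨ δ = -1) ∧ δ * a < 0 := by
      rcases lt_or_gt_of_ne (ha hneg) with h | h
      · exact ⟨1, Or.inl rfl, by linarith⟩
      · exact ⟨-1, Or.inr rfl, by linarith⟩
    obtain ⟨j, hend⟩ := KRS.exists_end_type2 hℓ hξ hδ
    obtain ⟨r, b, L, hr, -, hb, hd⟩ :=
      A.exists_end_equation hI (KRS.convex_type2Interval α) hinj hK₁ hsol p hδ hend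
    obtain ⟨k, hk, C, hC, hgrowth⟩ := KRS.exp_le_of_expanding hneg hδa
      (hend.mono fun t ht => A.gradComp_pos ht p j) hr hb hd
    exact A.false_of_complete hcomplete hI hK₁ (ha hneg) hsol p hδ hend hk hC hgrowth
  -- Shrinking case: the end is chosen so that the homogeneous term does not increase `h`, and
  -- `-2λt` drives it below zero; `a = 0` is allowed.
  · obtain ⟨δ, hδ, hδa⟩ : ∃ δ : ℝ, (δ = 1 ∨ δ = -1) ∧ 0 ≤ δ * a := by
      rcases le_total 0 a with h | h
      · exact ⟨1, Or.inl rfl, by linarith⟩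
      · exact ⟨-1, Or.inr rfl, by linarith⟩
    obtain ⟨j, hend⟩ := KRS.exists_end_type2 hℓ hξ hδ
    obtain ⟨r, b, L, -, hr, hb, hd⟩ :=
      A.exists_end_equation hI (KRS.convex_type2Interval α) hinj hK₁ hsol p hδ hend
    exact KRS.false_of_shrinking hpos hδa
      (hend.mono fun t ht => A.gradComp_pos ht p j) hr hb hd
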